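/- Let $f:[0,\infty)\to\mathbb R$ be $C^2$ and let $q_0>0$ with $f'(q_0)>0$. For $v>0$, a dark soliton with speed $v$ is a solution $U$ of $$-ivU'+\tfrac12U''+\bigl(f(q_0)-f(|U|^2)\bigr)U=0\quad\text{on }\mathbb R$$ (so that $u(x,t)=U(x-vt)e^{-if(q_0)t}$ solves $iu_t=-\frac12u_{xx}+f(|u|^2)u$) of the form $U=\Phi e^{i\Theta}$ with $\Phi,\Theta:\mathbb R\to\mathbb R$ of class $C^2$, $0<\Phi<\sqrt{q_0}$, $\Phi'(0)=0$, $\Phi\to\sqrt{q_0}$ as $z\to\pm\infty$, $\Theta\to0$ as $z\to+\infty$ and $\Theta\to\Theta_-\in\mathbb R$ as $z\to-\infty$, all limits being exponentially fast. Let $U_v$ be a dark soliton with speed $v$ for all sufficiently small $v>0$, and suppose that $U_v\to\phi_0$ pointwise as $v\downarrow0$, where $\phi_0$ is real-valued and $C^2$. The limit $\phi_0$ is called a kink if it is odd (in particular $\phi_0(0)=0$) and tends to $\pm\sqrt{q_0}$ at $\pm\infty$ exponentially fast; it is called a bubble if it is even, $0\le\phi_0(0)<\sqrt{q_0}$, and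 it tends to $\sqrt{q_0}$ at $\pm\infty$ exponentially fast. Put $$P_r(v)=\frac i2\int_{\mathbb R}\bigl(\bar U_vU_v'-U_v\bar U_v'\bigr)\Bigl(1-\frac{q_0}{|U_v|^2}\Bigr)dx,\qquad L_-=-\tfrac12\partial_x^2+f(\phi_0^2)-f(q_0),$$ where $L_-$ acts in $L^2(\mathbb R,\mathbb C)$ with domain $H^2(\mathbb R)$, let $(\cdot,\cdot)$ be the inner product of $L^2$, and let $$X_c=\{w\in H^2(\mathbb R):(w,\phi_0')=0\}.$$ A real number $\mu$ is an eigenvalue of $L_-$ in $X_c$ if there are $0\ne w\in X_c$ and $\nu\in\mathbb C$ with $(L_--\mu)w=-\nu\phi_0'$, that is, if it is an eigenvalue of the compression of $L_-$ to the orthogonal complement of $\phi_0'$. (a) If $\phi_0$ is a kink, then $P_r$ is differentiable at all sufficiently small $v>0$ and the limit $P_r'|_{v\downarrow0}=\lim_{v\downarrow0}P_r'(v)$ exists in $\mathbb R$. For all $\mu<0$ sufficiently close to $0$ the equation $(L_--\mu)w=\phi_0'$ has a unique solution $w=(L_--\mu)^{-1}\phi_0'$ in $H^2(\mathbb R)$,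 and $g(\mu)=-\bigl(\phi_0',(L_--\mu)^{-1}\phi_0'\bigr)$ satisfies $$\lim_{\mu\uparrow0}g(\mu)=\tfrac12P_r'|_{v\downarrow0}.$$ If $P_r'|_{v\downarrow0}<0$, then $L_-$ has exactly one negative eigenvalue in $X_c$, and this eigenvalue is simple. If $P_r'|_{v\downarrow0}>0$, then $L_-$ has no negative eigenvalue in $X_c$. (b) If $\phi_0$ is a bubble, then $L_-$ is non-negative in $X_c$: $(w,L_-w)\ge0$ for all $w\in X_c$. -/

import Mathlib

open MeasureTheory Filter Topology Set
open scoped ContDiff ComplexConjugate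

namespace BlackSoliton

/-- `U` is the profile of a dark soliton `u(x,t) = U(x - v t) exp(-i f(q₀) t)` of
`i u_t = -(1/2) u_xx + f(|u|²) u`: it solves the travelling-wave equation and has the polar form
`U = Φ exp(iΘ)` with `0 < Φ < √q₀`, `Φ'(0) = 0`, `Φ → √q₀` at `±∞`, `Θ → 0` at `+∞` and
`Θ → Θ₋` at `-∞`, all limits being attained exponentially fast.
The phase `Θ` is a continuous real-valued lift of the argument. -/
def IsDarkSoliton (f : ℝ → ℝ) (q₀ v : ℝ) (U : ℝ → ℂ) : Prop :=
  (∀ z : ℝ, -Complex.I * (v : ℂ) * deriv U z + (1 / 2 : ℂ) * deriv (deriv U) z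
      + ((f q₀ - f (‖U z‖ ^ 2) : ℝ) : ℂ) * U z = 0) ∧
  ∃ Φ Θ : ℝ → ℝ, ContDiff ℝ 2 Φ ∧ ContDiff ℝ 2 Θ ∧
    (∀ z, U z = (Φ z : ℂ) * Complex.exp (Complex.I * (Θ z : ℂ))) ∧
    (∀ z, 0 < Φ z ∧ Φ z < √q₀) ∧ deriv Φ 0 = 0 ∧
    ∃ Θm C κ : ℝ, 0 < κ ∧
      (∀ z, |Φ z - √q₀| ≤ C * Real.exp (-κ * |z|)) ∧
      (∀ z, 0 ≤ z → |Θ z| ≤ C * Real.exp (-κ * |z|)) ∧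
      (∀ z, z ≤ 0 → |Θ z - Θm| ≤ C * Real.exp (-κ * |z|))

/-- The renormalized momentum
`P_r[u] = (i/2) ∫ (ū u_x - u ū_x) (1 - q₀/|u|²) dx` (a real number). -/
noncomputable def momentum (q₀ : ℝ) (u : ℝ → ℂ) : ℝ :=
  (Complex.I / 2 * ∫ x : ℝ, (conj (u x) * deriv u x - u x * conj (deriv u x)) *
    (1 - (q₀ : ℂ) / ((‖u x‖ ^ 2 : ℝ) : ℂ))).re

/-- `φ₀` is the black soliton of the family of dark solitons `U v`, `v` small and positive: a
real-valued twice continuously differentiable pointwise limit of `U v` as `v ↓ 0`. -/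
def IsBlackSoliton (f : ℝ → ℝ) (q₀ : ℝ) (U : ℝ → ℝ → ℂ) (φ₀ : ℝ → ℝ) : Prop :=
  (∀ᶠ v in 𝓝[>] (0 : ℝ), IsDarkSoliton f q₀ v (U v)) ∧
  ContDiff ℝ 2 φ₀ ∧
  ∀ x, Tendsto (fun v => U v x) (𝓝[>] (0 : ℝ)) (𝓝 (φ₀ x : ℂ))

/-- Odd profile with limits `±√q₀` at `±∞`, attained exponentially fast. -/
def IsKink (q₀ : ℝ) (φ₀ : ℝ → ℝ) : Prop :=
  (∀ x, φ₀ (-x) = -φ₀ x) ∧ φ₀ 0 = 0 ∧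
  ∃ C κ : ℝ, 0 < κ ∧
    (∀ x, 0 ≤ x → |φ₀ x - √q₀| ≤ C * Real.exp (-κ * |x|)) ∧
    (∀ x, x ≤ 0 → |φ₀ x + √q₀| ≤ C * Real.exp (-κ * |x|))

/-- Even profile with `0 ≤ φ₀(0) < √q₀` and limit `√q₀` at `±∞`, attained exponentially fast. -/
def IsBubble (q₀ : ℝ) (φ₀ : ℝ → ℝ) : Prop :=
  (∀ x, φ₀ (-x) = φ₀ x) ∧ 0 ≤ φ₀ 0 ∧ φ₀ 0 < √q₀ ∧
  ∃ C κ : ℝ, 0 < κ ∧ ∀ x, |φ₀ x - √q₀| ≤ C * Real.exp (-κ * |x|)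

/-- The complex Hilbert space `L²(ℝ)`. -/
abbrev L2 : Type := Lp ℂ 2 (volume : Measure ℝ)

/-- `g` is the weak derivative of `w`. -/
def HasWeakDeriv (w g : L2) : Prop :=
  ∀ θ : ℝ → ℝ, ContDiff ℝ ∞ θ → HasCompactSupport θ →
    ∫ x, deriv θ x • w x = -∫ x, θ x • g x

theorem integrable_smul_coe (w : L2) {θ : ℝ → ℝ} (hθ : Continuous θ)
    (hc : HasCompactSupport θ) : Integrable (fun x => θ x • w x) := by
  have h : MemLp θ 2 volume := hθ.memLp_of_hasCompactSupport hc
  exact memLp_one_iff_integrable.mp (MemLp.smul (p := 2) (q := 2) (r := 1) (Lp.memLp w) h)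

theorem integrable_deriv_smul_coe (w : L2) {θ : ℝ → ℝ} (hθ : ContDiff ℝ ∞ θ)
    (hc : HasCompactSupport θ) : Integrable (fun x => deriv θ x • w x) :=
  integrable_smul_coe w (hθ.continuous_deriv (by simp)) hc.deriv

theorem hasWeakDeriv_zero : HasWeakDeriv 0 0 := by
  intro θ _ _
  have h : ((0 : L2) : ℝ → ℂ) =ᵐ[volume] 0 := Lp.coeFn_zero _ _ _
  rw [integral_eq_zero_of_ae, integral_eq_zero_of_ae, neg_zero]
  · filter_upwards [h] with x _; simp
  · filter_upwards [h] with x _; simp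

theorem HasWeakDeriv.add {w g w' g' : L2} (h : HasWeakDeriv w g) (h' : HasWeakDeriv w' g') :
    HasWeakDeriv (w + w') (g + g') := by
  intro θ hθ hc
  have e1 : ∫ x, deriv θ x • (w + w' : L2) x
      = (∫ x, deriv θ x • w x) + ∫ x, deriv θ x • w' x := by
    rw [← integral_add (integrable_deriv_smul_coe w hθ hc)
      (integrable_deriv_smul_coe w' hθ hc)]
    refine integral_congr_ae ?_
    filter_upwards [Lp.coeFn_add w w'] with x hx
    rw [hx, Pi.add_apply, smul_add]
  have e2 : ∫ x, θ x • (g + g' : L2) x = (∫ x, θ x • g x) + ∫ x, θ x • g' x := by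
    rw [← integral_add (integrable_smul_coe g hθ.continuous hc)
      (integrable_smul_coe g' hθ.continuous hc)]
    refine integral_congr_ae ?_
    filter_upwards [Lp.coeFn_add g g'] with x hx
    rw [hx, Pi.add_apply, smul_add]
  rw [e1, e2, h θ hθ hc, h' θ hθ hc, neg_add]

theorem HasWeakDeriv.smul {w g : L2} (a : ℂ) (h : HasWeakDeriv w g) :
    HasWeakDeriv (a • w) (a • g) := by
  intro θ hθ hc
  have e1 : ∫ x, deriv θ x • (a • w : L2) x = a * ∫ x, deriv θ x • w x := by
    rw [← integral_const_mul]
    refine integral_congr_ae ?_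
    filter_upwards [Lp.coeFn_smul a w] with x hx
    simp [hx, mul_left_comm]
  have e2 : ∫ x, θ x • (a • g : L2) x = a * ∫ x, θ x • g x := by
    rw [← integral_const_mul]
    refine integral_congr_ae ?_
    filter_upwards [Lp.coeFn_smul a g] with x hx
    simp [hx, mul_left_comm]
  rw [e1, e2, h θ hθ hc, mul_neg]

/-- Weak derivatives are unique. -/
theorem HasWeakDeriv.eq_zero {g : L2} (h : HasWeakDeriv 0 g) : g = 0 := by
  have hz : ((0 : L2) : ℝ → ℂ) =ᵐ[volume] 0 := Lp.coeFn_zero _ _ _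
  have key : ∀ᵐ x ∂(volume : Measure ℝ), g x = 0 := by
    refine ae_eq_zero_of_integral_contDiff_smul_eq_zero
      ((Lp.memLp g).locallyIntegrable (by norm_num)) ?_
    intro θ hθ hc
    have h1 := h θ hθ hc
    rw [integral_eq_zero_of_ae] at h1
    · exact neg_eq_zero.mp h1.symm
    · filter_upwards [hz] with x _; simp
  rw [Lp.eq_zero_iff_ae_eq_zero]
  exact key

/-- The Sobolev space `H²(ℝ)`. -/
def H2 : Submodule ℂ L2 where
  carrier := {w | ∃ g₁ g₂ : L2, HasWeakDeriv w g₁ ∧ HasWeakDeriv g₁ g₂}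
  zero_mem' := ⟨0, 0, hasWeakDeriv_zero, hasWeakDeriv_zero⟩
  add_mem' := by
    rintro w w' ⟨g₁, g₂, h₁, h₂⟩ ⟨k₁, k₂, l₁, l₂⟩
    exact ⟨g₁ + k₁, g₂ + k₂, h₁.add l₁, h₂.add l₂⟩
  smul_mem' := by
    rintro a w ⟨g₁, g₂, h₁, h₂⟩
    exact ⟨a • g₁, a • g₂, h₁.smul a, h₂.smul a⟩

/-- The graph of `w ↦ -(1/2) w'' + V w`. -/
def schrodingerGraph (V : ℝ → ℝ) : Submodule ℂ (L2 × L2) where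
  carrier := {p | ∃ g₁ g₂ : L2, HasWeakDeriv p.1 g₁ ∧ HasWeakDeriv g₁ g₂ ∧
    ∀ᵐ x ∂(volume : Measure ℝ), p.2 x = -(1 / 2 : ℂ) * g₂ x + (V x : ℂ) * p.1 x}
  zero_mem' := by
    refine ⟨0, 0, hasWeakDeriv_zero, hasWeakDeriv_zero, ?_⟩
    have h : ((0 : L2) : ℝ → ℂ) =ᵐ[volume] 0 := Lp.coeFn_zero _ _ _
    filter_upwards [h] with x _
    simp
  add_mem' := by
    rintro p p' ⟨g₁, g₂, h₁, h₂, h₃⟩ ⟨k₁, k₂, l₁, l₂, l₃⟩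
    refine ⟨g₁ + k₁, g₂ + k₂, h₁.add l₁, h₂.add l₂, ?_⟩
    filter_upwards [h₃, l₃, Lp.coeFn_add p.1 p'.1, Lp.coeFn_add p.2 p'.2,
      Lp.coeFn_add g₂ k₂] with x e₁ e₂ e₃ e₄ e₅
    simp only [Prod.fst_add, Prod.snd_add, e₃, e₄, e₅, Pi.add_apply, e₁, e₂]
    ring
  smul_mem' := by
    rintro a p ⟨g₁, g₂, h₁, h₂, h₃⟩
    refine ⟨a • g₁, a • g₂, h₁.smul a, h₂.smul a, ?_⟩
    filter_upwards [h₃, Lp.coeFn_smul a p.1, Lp.coeFn_smul a p.2,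
      Lp.coeFn_smul a g₂] with x e₁ e₂ e₃ e₄
    simp only [Prod.smul_fst, Prod.smul_snd, e₂, e₃, e₄, Pi.smul_apply, smul_eq_mul, e₁]
    ring

theorem schrodingerGraph_functional (V : ℝ → ℝ) :
    ∀ p ∈ schrodingerGraph V, p.1 = 0 → p.2 = 0 := by
  rintro ⟨w, h⟩ ⟨g₁, g₂, h₁, h₂, h₃⟩ hw
  simp only at hw h₁ h₃ ⊢
  subst hw
  obtain rfl := h₁.eq_zero
  obtain rfl := h₂.eq_zero
  rw [Lp.eq_zero_iff_ae_eq_zero]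
  have hz : ((0 : L2) : ℝ → ℂ) =ᵐ[volume] 0 := Lp.coeFn_zero _ _ _
  filter_upwards [h₃, hz] with x e₁ e₂
  rw [e₁, e₂]; simp

/-- The Schrödinger operator `-(1/2) ∂ₓ² + V` in `L²(ℝ)`, with domain the set of `w` in `H²(ℝ)`
for which `V w` is in `L²(ℝ)`; this is all of `H²(ℝ)` when `V` is bounded. -/
noncomputable def schrodinger (V : ℝ → ℝ) : L2 →ₗ.[ℂ] L2 :=
  (schrodingerGraph V).toLinearPMap

theorem schrodinger_graph (V : ℝ → ℝ) : (schrodinger V).graph = schrodingerGraph V :=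
  Submodule.toLinearPMap_graph_eq _ (schrodingerGraph_functional V)

theorem schrodinger_domain {V : ℝ → ℝ} (hV : Continuous V) {C : ℝ} (hC : ∀ x, |V x| ≤ C) :
    (schrodinger V).domain = H2 := by
  ext w
  rw [LinearPMap.mem_domain_iff, schrodinger_graph]
  constructor
  · rintro ⟨h, g₁, g₂, h₁, h₂, -⟩
    exact ⟨g₁, g₂, h₁, h₂⟩
  · rintro ⟨g₁, g₂, h₁, h₂⟩
    have hm : MemLp (fun x => -(1 / 2 : ℂ) * g₂ x + (V x : ℂ) * w x) 2 volume := by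
      refine ((Lp.memLp g₂).const_mul _).add ?_
      refine MemLp.of_le_mul (c := C) (Lp.memLp w) ?_ ?_
      · exact (Complex.continuous_ofReal.comp hV).aestronglyMeasurable.mul
          (Lp.memLp w).aestronglyMeasurable
      · refine Eventually.of_forall fun x => ?_
        rw [norm_mul, Complex.norm_real, Real.norm_eq_abs]
        exact mul_le_mul_of_nonneg_right (hC x) (norm_nonneg _)
    exact ⟨hm.toLp, g₁, g₂, h₁, h₂, hm.coeFn_toLp⟩

/-- `L₋ = -(1/2) ∂ₓ² + f(φ₀²) - f(q₀)`. -/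
noncomputable def Lminus (f : ℝ → ℝ) (q₀ : ℝ) (φ₀ : ℝ → ℝ) : L2 →ₗ.[ℂ] L2 :=
  schrodinger (fun x => f (φ₀ x ^ 2) - f q₀)

/-- The constrained space `X_c = {w ∈ H²(ℝ) : (w, φ₀') = 0}`. -/
def Xc (φ₀ : ℝ → ℝ) : Set L2 :=
  {w | w ∈ H2 ∧ ∫ x, w x * ((deriv φ₀ x : ℝ) : ℂ) = 0}

/-- `w` is an eigenvector, for the eigenvalue `μ`, of `L₋` in the constrained space:
`w ∈ X_c`, `w ≠ 0` and `(L₋ - μ) w = -ν φ₀'` for some Lagrange multiplier `ν`, that is, `w` is an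
eigenvector of the compression of `L₋` to the orthogonal complement of `φ₀'`. -/
def IsConstrainedEigenvector (f : ℝ → ℝ) (q₀ : ℝ) (φ₀ : ℝ → ℝ) (μ : ℝ) (w : L2) : Prop :=
  w ≠ 0 ∧ w ∈ Xc φ₀ ∧ ∃ hw : w ∈ (Lminus f q₀ φ₀).domain, ∃ ν : ℂ,
    ∀ᵐ x ∂(volume : Measure ℝ),
      (Lminus f q₀ φ₀ ⟨w, hw⟩ - (μ : ℂ) • w : L2) x = -ν * ((deriv φ₀ x : ℝ) : ℂ)

/-- `w = (L₋ - μ)⁻¹ φ₀'` in the sense that `w ∈ H²(ℝ)` and `(L₋ - μ) w = φ₀'`. -/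
def IsResolventSolution (f : ℝ → ℝ) (q₀ : ℝ) (φ₀ : ℝ → ℝ) (μ : ℝ) (w : L2) : Prop :=
  ∃ hw : w ∈ (Lminus f q₀ φ₀).domain, ∀ᵐ x ∂(volume : Measure ℝ),
    (Lminus f q₀ φ₀ ⟨w, hw⟩ - (μ : ℂ) • w : L2) x = ((deriv φ₀ x : ℝ) : ℂ)

end BlackSoliton

/-! Write V = f(φ₀²) - f(q₀), so that L₋ = -½∂² + V. Passing to the limit v ↓ 0 in the travelling
wave equation shows L₋φ₀ = 0 for the bounded function φ₀. Where φ₀ > 0, Jacobi's substitution turns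
|u'|² + 2V|u|² into |u' - (φ₀'/φ₀)u|² plus the derivative of (φ₀'/φ₀)|u|². For a bubble, φ₀ > 0 and
φ₀'(0) = 0, so the boundary term at 0 vanishes for every u and the form is non-negative on the whole
domain; this is (b). For a kink φ₀ has a simple zero at 0 and the boundary term vanishes when u(0) =
0, so the form is non-negative on the kernel of one functional ε, evaluation at 0
(`IsKink.form_nonneg`). It does take negative values, at cut-offs of √(φ₀² + δ²)
(`IsKink.exists_negative`). Thus there is exactly one negative direction.

Let w_T = (L₋ + T)⁻¹φ₀' for small T > 0. In the shifted form ⟨u, (L₋ + T)v⟩ the vector w_T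
represents the functional ⟨φ₀', ·⟩. If ⟨φ₀', w_T⟩ < 0, then w_T already uses up the negative
direction and nothing negative is left in the complement of φ₀'. If it is > 0, the form-orthogonal
projection along w_T moves a negative vector into the complement, and a minimizing sequence there
produces the eigenvalue. So (a) reduces to the limit of ⟨φ₀', w_T⟩ as T ↓ 0.

Since V vanishes at infinity, 0 is in the essential spectrum and L₋ cannot simply be inverted there.
Instead a bounded χ with L₋χ = φ₀' is written down (`IsKink.exists_generalized_resolvent`), and χ/(1
+ Tx²) solves the shifted equation up to O(√T) in L². The pairing error is then at most a constant
times √T‖w_T‖, which tends to 0 by an almost-monotonicity argument (`resolvent_tendsto`). Hence the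
limit is ∫χφ₀'.

For the momentum, the density q = |U|² and the slope s = q'/(2(q₀ - q)) satisfy s² = h(q) - v² with
h(q) = 2qG(q), where (q - q₀)²G(q) is the antiderivative of f - f(q₀) vanishing at q₀. The
derivative of arctan(s/v) isolates the part singular as v ↓ 0: with c² = h(q₀), P_r(v) = -2(q₀
arccos(v/c) - v W(v)), where W is differentiable near 0 (`IsKink.momentum_deriv`). Both computations
give the same number: P_r' tends to 2(q₀/c + W(0)) and ∫χφ₀' = -(q₀/c + W(0)). -/

namespace BlackSoliton

/-! ### Symmetric operators whose form is non-negative on the kernel of one functional: inverting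
the shift. -/

section Abstract

open scoped InnerProductSpace

variable {H : Type*} [NormedAddCommGroup H] [InnerProductSpace ℂ H]

/-- Symmetry of a partially defined operator. -/
def IsSymm (A : H →ₗ.[ℂ] H) : Prop :=
  ∀ u v : A.domain, ⟪A u, (v : H)⟫_ℂ = ⟪(u : H), A v⟫_ℂ

/-- Every vector in the domain of the adjoint lies in the domain of the operator. -/
def AdjointLE (A : H →ₗ.[ℂ] H) : Prop :=
  ∀ u k : H, (∀ θ : A.domain, ⟪u, A θ⟫_ℂ = ⟪k, (θ : H)⟫_ℂ) →
    ∃ hu : u ∈ A.domain, A ⟨u, hu⟩ = k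

/-- The sesquilinear form `⟨u, (A + T) v⟩`. -/
noncomputable def shiftForm (A : H →ₗ.[ℂ] H) (T : ℝ) (u v : A.domain) : ℂ :=
  ⟪(u : H), A v + (T : ℂ) • (v : H)⟫_ℂ

variable {A : H →ₗ.[ℂ] H}

theorem shiftForm_eq (T : ℝ) (u v : A.domain) :
    shiftForm A T u v = ⟪(u : H), A v⟫_ℂ + T * ⟪(u : H), (v : H)⟫_ℂ := by
  rw [shiftForm, inner_add_right, inner_smul_right]

theorem shiftForm_conj (hA : IsSymm A) (T : ℝ) (u v : A.domain) :
    conj (shiftForm A T u v) = shiftForm A T v u := by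
  rw [shiftForm_eq, shiftForm_eq, map_add, map_mul, Complex.conj_ofReal, inner_conj_symm,
    inner_conj_symm, hA]

theorem shiftForm_symm (hA : IsSymm A) (T : ℝ) (u v : A.domain) :
    ⟪A u + (T : ℂ) • (u : H), (v : H)⟫_ℂ = shiftForm A T u v := by
  rw [← shiftForm_conj hA, shiftForm, inner_conj_symm]

theorem shiftForm_self_re (T : ℝ) (u : A.domain) :
    (shiftForm A T u u).re = (⟪(u : H), A u⟫_ℂ).re + T * ‖(u : H)‖ ^ 2 := by
  rw [shiftForm_eq, inner_self_eq_norm_sq_to_K]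
  simp [← Complex.ofReal_pow]

theorem shiftForm_add_smul (hA : IsSymm A) (T : ℝ) (u e : A.domain) (a b : ℂ) :
    (shiftForm A T (a • u + b • e) (a • u + b • e)).re
      = ‖a‖ ^ 2 * (shiftForm A T u u).re + 2 * (conj b * a * shiftForm A T e u).re
        + ‖b‖ ^ 2 * (shiftForm A T e e).re := by
  have h1 : shiftForm A T (a • u + b • e) (a • u + b • e)
      = conj a * a * shiftForm A T u u + conj a * b * shiftForm A T u e
        + conj b * a * shiftForm A T e u + conj b * b * shiftForm A T e e := by
    simp only [shiftForm_eq, LinearPMap.map_add, LinearPMap.map_smul, Submodule.coe_add,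
      Submodule.coe_smul, inner_add_left, inner_add_right, inner_smul_left, inner_smul_right]
    ring
  have h2 : conj a * b * shiftForm A T u e = conj (conj b * a * shiftForm A T e u) := by
    rw [map_mul, map_mul, shiftForm_conj hA, Complex.conj_conj]; ring
  rw [h1, h2, Complex.conj_mul', Complex.conj_mul', Complex.add_re, Complex.add_re,
    Complex.add_re, Complex.conj_re, ← Complex.ofReal_pow, ← Complex.ofReal_pow,
    Complex.re_ofReal_mul, Complex.re_ofReal_mul]
  ring

theorem shiftForm_sub (hA : IsSymm A) (T : ℝ) (u e : A.domain) (b : ℂ) :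
    (shiftForm A T (u - b • e) (u - b • e)).re
      = (shiftForm A T u u).re - 2 * (conj b * shiftForm A T e u).re
        + ‖b‖ ^ 2 * (shiftForm A T e e).re := by
  have := shiftForm_add_smul hA T u e 1 (-b)
  rw [one_smul, neg_smul, ← sub_eq_add_neg] at this
  rw [this]
  simp
  ring

/-- The data of a symmetric form that is non-negative on the kernel of a functional `ε`. -/
theorem le_of_functional {ε : A.domain →ₗ[ℂ] ℂ}
    (hε : ∀ u, ε u = 0 → 0 ≤ (⟪(u : H), A u⟫_ℂ).re) {T : ℝ} {u : A.domain} (hu : ε u = 0) :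
    T * ‖(u : H)‖ ^ 2 ≤ (shiftForm A T u u).re := by
  rw [shiftForm_self_re]; linarith [hε u hu]

theorem functional_ne_zero {ε : A.domain →ₗ[ℂ] ℂ}
    (hε : ∀ u, ε u = 0 → 0 ≤ (⟪(u : H), A u⟫_ℂ).re) {T : ℝ} (hT : 0 ≤ T) {u : A.domain}
    (hu : (shiftForm A T u u).re < 0) : ε u ≠ 0 := fun h => by
  have := le_of_functional hε (T := T) h
  have : 0 ≤ T * ‖(u : H)‖ ^ 2 := by positivity
  linarith

/-- Two form-orthogonal vectors cannot both be negative. -/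
theorem not_two_negative (hA : IsSymm A) {ε : A.domain →ₗ[ℂ] ℂ}
    (hε : ∀ u, ε u = 0 → 0 ≤ (⟪(u : H), A u⟫_ℂ).re) {T : ℝ} (hT : 0 ≤ T) {u e : A.domain}
    (hu : (shiftForm A T u u).re < 0) (he : (shiftForm A T e e).re < 0)
    (hue : shiftForm A T e u = 0) : False := by
  -- The combination ε(e)u - ε(u)e is killed by ε, yet its shifted form is a sum of two non-positive
  -- terms, one of them strictly negative.
  have h1 := shiftForm_add_smul hA T u e (ε e) (-ε u)
  have h2 : ε (ε e • u + (-ε u) • e) = 0 := by simp; ring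
  have h3 := le_of_functional hε (T := T) h2
  have h4 : 0 ≤ T * ‖((ε e • u + (-ε u) • e : A.domain) : H)‖ ^ 2 := by positivity
  rw [h1, hue] at h3
  have h5 : 0 < ‖ε e‖ ^ 2 := by
    have := functional_ne_zero hε hT he; positivity
  have h6 : 0 ≤ ‖-ε u‖ ^ 2 := by positivity
  simp only [mul_zero, Complex.zero_re] at h3
  nlinarith

/-- The basic estimate for a vector split along a negative direction. -/
theorem basic_estimate (hA : IsSymm A) {ε : A.domain →ₗ[ℂ] ℂ}
    (hε : ∀ u, ε u = 0 → 0 ≤ (⟪(u : H), A u⟫_ℂ).re) {T a : ℝ} {e : A.domain}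
    (he : (shiftForm A T e e).re ≤ -a) (hεe : ε e ≠ 0) (u : A.domain) :
    T * ‖((u - (ε u / ε e) • e : A.domain) : H)‖ ^ 2 + a * ‖ε u / ε e‖ ^ 2
      ≤ (shiftForm A T u u).re + 2 * (‖ε u / ε e‖ * ‖shiftForm A T e u‖) := by
  -- This coefficient puts u - b e in the kernel of ε, where the unshifted form is non-negative.
  set b := ε u / ε e with hb
  have h0 : ε (u - b • e) = 0 := by
    rw [map_sub, map_smul, smul_eq_mul, hb, div_mul_cancel₀ _ hεe, sub_self]
  have h1 := le_of_functional hε (T := T) h0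
  rw [shiftForm_sub hA] at h1
  have h2 : -(‖b‖ * ‖shiftForm A T e u‖) ≤ (conj b * shiftForm A T e u).re := by
    have := Complex.abs_re_le_norm (conj b * shiftForm A T e u)
    rw [norm_mul, Complex.norm_conj] at this
    linarith [neg_abs_le (conj b * shiftForm A T e u).re]
  nlinarith [sq_nonneg ‖b‖]

/-- Pairings with a fixed θ in the domain pass to the limit, so the limits satisfy the adjoint
relation. Together the two hypotheses amount to self-adjointness. -/
theorem AdjointLE.closed (hA : IsSymm A) (hs : AdjointLE A) {u : ℕ → A.domain} {x k : H}
    (hu : Tendsto (fun n => (u n : H)) atTop (𝓝 x))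
    (hk : Tendsto (fun n => A (u n)) atTop (𝓝 k)) :
    ∃ hx : x ∈ A.domain, A ⟨x, hx⟩ = k := by
  refine hs x k fun θ => ?_
  have h1 : Tendsto (fun n => ⟪(u n : H), A θ⟫_ℂ) atTop (𝓝 ⟪x, A θ⟫_ℂ) :=
    hu.inner tendsto_const_nhds
  have h2 : Tendsto (fun n => ⟪A (u n), (θ : H)⟫_ℂ) atTop (𝓝 ⟪k, (θ : H)⟫_ℂ) :=
    hk.inner tendsto_const_nhds
  exact tendsto_nhds_unique h1 (h2.congr fun n => hA (u n) θ)

/-- A vector orthogonal to the domain is an adjoint image of 0, hence equals A 0 = 0. This is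
density of the domain, which is thus not a separate assumption. -/
theorem AdjointLE.exists_inner_ne_zero (hs : AdjointLE A) {φ : H} (hφ : φ ≠ 0) :
    ∃ θ : A.domain, ⟪φ, (θ : H)⟫_ℂ ≠ 0 := by
  by_contra! h
  obtain ⟨hu, h0⟩ := hs 0 φ (fun θ => by rw [h θ, inner_zero_left])
  exact hφ (h0 ▸ A.map_zero)

/-- The shifted form is indefinite, but it is coercive on the kernel of ε and strictly negative at
ψ. `basic_estimate` therefore bounds both pieces of u = (u - bψ) + bψ by ‖(A + T)u‖, after absorbing
cross terms. -/
theorem shift_lower_bound (hA : IsSymm A) {ε : A.domain →ₗ[ℂ] ℂ}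
    (hε : ∀ u, ε u = 0 → 0 ≤ (⟪(u : H), A u⟫_ℂ).re) {T : ℝ} (hT : 0 < T) {ψ : A.domain}
    (hψ : (shiftForm A T ψ ψ).re < 0) :
    ∃ C : ℝ, ∀ u : A.domain, ‖(u : H)‖ ≤ C * ‖A u + (T : ℂ) • (u : H)‖ := by
  set a := -(shiftForm A T ψ ψ).re with ha
  have ha0 : 0 < a := by linarith
  -- The summands come from Young's inequality for F r and for 3‖b‖‖ψ‖F. In the factor 3, one comes
  -- from ‖u‖ ≤ r + ‖b‖‖ψ‖ and two from the cross term.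
  set K := 1 / (2 * T) + 9 * ‖(ψ : H)‖ ^ 2 / (2 * a) with hK
  have hK0 : 0 < K := by positivity
  refine ⟨√(2 * K / T) + √(2 * K / a) * ‖(ψ : H)‖, fun u => ?_⟩
  set F := ‖A u + (T : ℂ) • (u : H)‖ with hF
  have h1 := basic_estimate hA hε (T := T) (a := a) (e := ψ) (by linarith)
    (functional_ne_zero hε hT.le hψ) u
  set b := ε u / ε ψ with hb
  set r := ‖((u - b • ψ : A.domain) : H)‖ with hr
  have hu : ‖(u : H)‖ ≤ r + ‖b‖ * ‖(ψ : H)‖ := by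
    have : (u : H) = ((u - b • ψ : A.domain) : H) + b • (ψ : H) := by simp
    rw [this]
    exact (norm_add_le _ _).trans (by rw [norm_smul])
  have h2 : (shiftForm A T u u).re ≤ ‖(u : H)‖ * F :=
    (Complex.re_le_norm _).trans (norm_inner_le_norm _ _)
  have h3 : ‖shiftForm A T ψ u‖ ≤ ‖(ψ : H)‖ * F := norm_inner_le_norm _ _
  have hF0 : 0 ≤ F := norm_nonneg _
  have hb0 : 0 ≤ ‖b‖ := norm_nonneg _
  have hr0 : 0 ≤ r := norm_nonneg _
  have hp0 : 0 ≤ ‖(ψ : H)‖ := norm_nonneg _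
  have h4 : T * r ^ 2 + a * ‖b‖ ^ 2 ≤ F * r + 3 * (‖b‖ * ‖(ψ : H)‖ * F) := by
    have := mul_le_mul_of_nonneg_right hu hF0
    have := mul_le_mul_of_nonneg_left h3 hb0
    nlinarith
  have h5 : F * r ≤ T * r ^ 2 / 2 + F ^ 2 / (2 * T) := by
    have : T * r ^ 2 / 2 + F ^ 2 / (2 * T) - F * r = (T * r - F) ^ 2 / (2 * T) := by
      field_simp; ring
    have : 0 ≤ (T * r - F) ^ 2 / (2 * T) := by positivity
    linarith
  have h6 : 3 * (‖b‖ * ‖(ψ : H)‖ * F) ≤ a * ‖b‖ ^ 2 / 2 + 9 * ‖(ψ : H)‖ ^ 2 / (2 * a) * F ^ 2 := by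
    have : a * ‖b‖ ^ 2 / 2 + 9 * ‖(ψ : H)‖ ^ 2 / (2 * a) * F ^ 2 - 3 * (‖b‖ * ‖(ψ : H)‖ * F)
        = (a * ‖b‖ - 3 * ‖(ψ : H)‖ * F) ^ 2 / (2 * a) := by
      field_simp; ring
    have : 0 ≤ (a * ‖b‖ - 3 * ‖(ψ : H)‖ * F) ^ 2 / (2 * a) := by positivity
    linarith
  have h7 : T * r ^ 2 + a * ‖b‖ ^ 2 ≤ 2 * K * F ^ 2 := by
    have : K * F ^ 2 = F ^ 2 / (2 * T) + 9 * ‖(ψ : H)‖ ^ 2 / (2 * a) * F ^ 2 := by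
      rw [hK]; ring
    linarith
  have h8 : r ≤ √(2 * K / T) * F := by
    refine le_of_sq_le_sq ?_ (by positivity)
    rw [mul_pow, Real.sq_sqrt (by positivity), div_mul_eq_mul_div, le_div_iff₀ hT]
    nlinarith [mul_nonneg ha0.le (sq_nonneg ‖b‖)]
  have h9 : ‖b‖ ≤ √(2 * K / a) * F := by
    refine le_of_sq_le_sq ?_ (by positivity)
    rw [mul_pow, Real.sq_sqrt (by positivity), div_mul_eq_mul_div, le_div_iff₀ ha0]
    nlinarith [mul_nonneg hT.le (sq_nonneg r)]
  calc ‖(u : H)‖ ≤ r + ‖b‖ * ‖(ψ : H)‖ := hu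
    _ ≤ √(2 * K / T) * F + √(2 * K / a) * F * ‖(ψ : H)‖ := by gcongr
    _ = _ := by ring

theorem shift_injective (hA : IsSymm A) {ε : A.domain →ₗ[ℂ] ℂ}
    (hε : ∀ u, ε u = 0 → 0 ≤ (⟪(u : H), A u⟫_ℂ).re) {T : ℝ} (hT : 0 < T) {ψ : A.domain}
    (hψ : (shiftForm A T ψ ψ).re < 0) {u v : A.domain}
    (h : A u + (T : ℂ) • (u : H) = A v + (T : ℂ) • (v : H)) : u = v := by
  obtain ⟨C, hC⟩ := shift_lower_bound hA hε hT hψ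
  have h1 := hC (u - v)
  have h2 : A (u - v) + (T : ℂ) • ((u - v : A.domain) : H) = 0 := by
    rw [LinearPMap.map_sub, Submodule.coe_sub, smul_sub, ← sub_eq_zero.mpr h]
    abel
  rw [h2, norm_zero, mul_zero] at h1
  have h3 : ((u - v : A.domain) : H) = 0 := norm_le_zero_iff.mp h1
  exact sub_eq_zero.mp (Subtype.ext h3)

/-- The lower bound and closedness of A make the range closed. A vector orthogonal to the range lies
in the domain, because the adjoint is contained in A, and is annihilated by A + T, hence is 0 by
injectivity. -/
theorem shift_surjective [CompleteSpace H] (hA : IsSymm A) (hs : AdjointLE A)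
    {ε : A.domain →ₗ[ℂ] ℂ} (hε : ∀ u, ε u = 0 → 0 ≤ (⟪(u : H), A u⟫_ℂ).re) {T : ℝ}
    (hT : 0 < T) {ψ : A.domain} (hψ : (shiftForm A T ψ ψ).re < 0) (f : H) :
    ∃ u : A.domain, A u + (T : ℂ) • (u : H) = f := by
  obtain ⟨C, hC⟩ := shift_lower_bound hA hε hT hψ
  set L : A.domain →ₗ[ℂ] H := A.toFun + (T : ℂ) • A.domain.subtype with hL
  have hLu : ∀ u : A.domain, L u = A u + (T : ℂ) • (u : H) := fun u => rfl
  have hclosed : IsClosed (LinearMap.range L : Set H) := by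
    refine IsSeqClosed.isClosed ?_
    intro y f hy hyf
    choose u hu using hy
    have hcu : CauchySeq fun n => (u n : H) := by
      have hc := hyf.cauchySeq
      rw [Metric.cauchySeq_iff] at hc ⊢
      intro δ hδ
      obtain ⟨N, hN⟩ := hc (δ / (|C| + 1)) (by positivity)
      refine ⟨N, fun m hm n hn => ?_⟩
      have h1 := hC (u m - u n)
      rw [← hLu, map_sub, hu, hu, Submodule.coe_sub] at h1
      have h2 := hN m hm n hn
      rw [dist_eq_norm, lt_div_iff₀ (by positivity)] at h2
      rw [dist_eq_norm]
      have : C * ‖y m - y n‖ ≤ |C| * ‖y m - y n‖ :=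
        mul_le_mul_of_nonneg_right (le_abs_self C) (norm_nonneg _)
      nlinarith [norm_nonneg (y m - y n)]
    obtain ⟨x, hx⟩ := cauchySeq_tendsto_of_complete hcu
    have hAu : Tendsto (fun n => A (u n)) atTop (𝓝 (f - (T : ℂ) • x)) := by
      refine (hyf.sub (hx.const_smul (T : ℂ))).congr fun n => ?_
      rw [← hu n, hLu]; simp
    obtain ⟨hx', hAx⟩ := hs.closed hA hx hAu
    exact ⟨⟨x, hx'⟩, by rw [hLu, hAx]; simp⟩
  have : CompleteSpace (LinearMap.range L) := hclosed.completeSpace_coe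
  have htop : LinearMap.range L = ⊤ := by
    rw [← Submodule.orthogonal_eq_bot_iff, Submodule.eq_bot_iff]
    intro z hz
    rw [Submodule.mem_orthogonal'] at hz
    obtain ⟨hz1, hz2⟩ := hs z (-(T : ℂ) • z) (fun θ => by
      have := hz (L θ) ⟨θ, rfl⟩
      rw [hLu, inner_add_right, inner_smul_right] at this
      rw [inner_smul_left]
      simp only [map_neg, Complex.conj_ofReal]
      linear_combination this)
    have h0 : (⟨z, hz1⟩ : A.domain) = 0 := by
      refine shift_injective hA hε hT hψ ?_
      rw [hz2]; simp
    exact congrArg Subtype.val h0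
  obtain ⟨u, hu⟩ := LinearMap.range_eq_top.mp htop f
  exact ⟨u, hu⟩

end Abstract

/-! ### The limit of ⟨φ, (A + T)⁻¹φ⟩ as T ↓ 0, from approximate solutions. -/

section Abstract

open scoped InnerProductSpace

variable {H : Type*} [NormedAddCommGroup H] [InnerProductSpace ℂ H] {A : H →ₗ.[ℂ] H}

/-- A function that is bounded above near `0` and increases towards `0` up to `C √T` converges. -/
theorem exists_tendsto_of_almost_antitone {g : ℝ → ℝ} {T₀ C M : ℝ} (hT₀ : 0 < T₀)
    (hM : ∀ T, 0 < T → T < T₀ → g T ≤ M)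
    (hg : ∀ S T, 0 < S → S < T → T < T₀ → g T ≤ g S + C * √T) :
    ∃ l, Tendsto g (𝓝[>] (0 : ℝ)) (𝓝 l) := by
  have hC : ∀ S T, 0 < S → S < T → T < T₀ → g T ≤ g S + |C| * √T := fun S T h1 h2 h3 =>
    (hg S T h1 h2 h3).trans (by gcongr; exact le_abs_self C)
  -- The supremum of the corrected values g T - |C|√T is the limit of g: almost monotonicity keeps g
  -- S above the corrected value at any T₁ > S, and the correction at S itself disappears.
  set s : Set ℝ := (fun T => g T - |C| * √T) '' Ioo 0 T₀ with hs
  have hbdd : BddAbove s := by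
    refine ⟨M, ?_⟩
    rintro _ ⟨T, hT, rfl⟩
    have : 0 ≤ |C| * √T := by positivity
    simp only; linarith [hM T hT.1 hT.2]
  have hne : s.Nonempty := ⟨_, ⟨T₀ / 2, ⟨by linarith, by linarith⟩, rfl⟩⟩
  refine ⟨sSup s, ?_⟩
  have hsq : Tendsto (fun T : ℝ => |C| * √T) (𝓝[>] (0 : ℝ)) (𝓝 0) := by
    have h : Tendsto (fun T : ℝ => |C| * √T) (𝓝 0) (𝓝 (|C| * √0)) :=
      (continuous_const.mul Real.continuous_sqrt).tendsto 0
    rw [Real.sqrt_zero, mul_zero] at h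
    exact h.mono_left nhdsWithin_le_nhds
  rw [Metric.tendsto_nhds]
  intro δ hδ
  obtain ⟨_, ⟨T₁, hT₁, rfl⟩, hlt⟩ := exists_lt_of_lt_csSup hne (show sSup s - δ < sSup s by linarith)
  have hsmall : ∀ᶠ T : ℝ in 𝓝[>] (0 : ℝ), |C| * √T < δ := hsq.eventually_lt_const hδ
  have hIoo : ∀ᶠ T : ℝ in 𝓝[>] (0 : ℝ), T ∈ Ioo 0 T₁ := Ioo_mem_nhdsGT hT₁.1
  filter_upwards [hsmall, hIoo] with S hS hS2
  have h1 := hC S T₁ hS2.1 hS2.2 hT₁.2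
  have h2 : g S - |C| * √S ≤ sSup s :=
    le_csSup hbdd ⟨S, ⟨hS2.1, hS2.2.trans hT₁.2⟩, rfl⟩
  rw [Real.dist_eq, abs_lt]
  simp only at hlt
  constructor <;> linarith

theorem bounded_of_quadratic {s b a C₁ C₂ C₃ : ℝ} (ha : 0 < a)
    (h : s ^ 2 + a * b ^ 2 ≤ C₁ + C₂ * s + C₃ * b) :
    s ≤ √(2 * |C₁| + C₂ ^ 2 + C₃ ^ 2 / a) ∧ b ≤ √((2 * |C₁| + C₂ ^ 2 + C₃ ^ 2 / a) / a) := by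
  have h1 : C₂ * s ≤ s ^ 2 / 2 + C₂ ^ 2 / 2 := by nlinarith [sq_nonneg (s - C₂)]
  have h2 : C₃ * b ≤ a * b ^ 2 / 2 + C₃ ^ 2 / a / 2 := by
    have : a * b ^ 2 / 2 + C₃ ^ 2 / a / 2 - C₃ * b = (a * b - C₃) ^ 2 / (2 * a) := by
      field_simp; ring
    have : 0 ≤ (a * b - C₃) ^ 2 / (2 * a) := by positivity
    linarith
  have h3 : s ^ 2 + a * b ^ 2 ≤ 2 * |C₁| + C₂ ^ 2 + C₃ ^ 2 / a := by
    linarith [le_abs_self C₁]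
  constructor
  · exact Real.le_sqrt_of_sq_le (by nlinarith [mul_nonneg ha.le (sq_nonneg b)])
  · refine Real.le_sqrt_of_sq_le ?_
    rw [le_div_iff₀ ha]
    nlinarith [sq_nonneg s]

/-- Here X T solves the shifted equation for φ up to C√T. By symmetry ⟨φ, w⟩ - ⟨X, φ⟩ is the pairing
of the defect with w. The shifted form at w has real part Re ⟨φ, w⟩, so it is bounded by a constant
plus |C|√T‖w‖, and `basic_estimate` closes into bounds on √T‖w‖ and on the coefficient along ψ that
are uniform as T ↓ 0. -/
theorem resolvent_bound (hA : IsSymm A) {ε : A.domain →ₗ[ℂ] ℂ}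
    (hε : ∀ u, ε u = 0 → 0 ≤ (⟪(u : H), A u⟫_ℂ).re) {ψ : A.domain}
    (hψ : (⟪(ψ : H), A ψ⟫_ℂ).re < 0) {φ : H} {X w : ℝ → A.domain} {C : ℝ} {c : ℂ}
    (hX : ∀ᶠ T in 𝓝[>] (0 : ℝ), ‖φ - (A (X T) + (T : ℂ) • (X T : H))‖ ≤ C * √T)
    (hc : Tendsto (fun T => ⟪φ, (X T : H)⟫_ℂ) (𝓝[>] (0 : ℝ)) (𝓝 c))
    (hw : ∀ᶠ T in 𝓝[>] (0 : ℝ), A (w T) + (T : ℂ) • (w T : H) = φ) :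
    ∃ T₀ K : ℝ, 0 < T₀ ∧ ∀ T, 0 < T → T < T₀ →
      A (w T) + (T : ℂ) • (w T : H) = φ ∧ (shiftForm A T ψ ψ).re < 0 ∧
      ‖⟪φ, (w T : H)⟫_ℂ - ⟪(X T : H), φ⟫_ℂ‖ ≤ C * (√T * ‖(w T : H)‖) ∧
      √T * ‖(w T : H)‖ ≤ K ∧ ‖ε (w T) / ε ψ‖ ≤ K ∧ (⟪φ, (w T : H)⟫_ℂ).re ≤ K := by
  -- Half of the negative value of the form at ψ, so that the shifted form there stays ≤ -a for all
  -- small T.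
  set a := -(⟪(ψ : H), A ψ⟫_ℂ).re / 2 with ha
  have ha0 : 0 < a := by rw [ha]; linarith
  set P := ‖(ψ : H)‖ with hP
  have hP0 : 0 ≤ P := norm_nonneg _
  have h1 : ∀ᶠ T : ℝ in 𝓝[>] (0 : ℝ), T * P ^ 2 < a := by
    have h : Tendsto (fun T : ℝ => T * P ^ 2) (𝓝 0) (𝓝 (0 * P ^ 2)) :=
      (continuous_id.mul continuous_const).tendsto 0
    rw [zero_mul] at h
    exact (h.mono_left nhdsWithin_le_nhds).eventually_lt_const ha0
  have h2 : ∀ᶠ T : ℝ in 𝓝[>] (0 : ℝ), ‖⟪φ, (X T : H)⟫_ℂ‖ < ‖c‖ + 1 :=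
    hc.norm.eventually_lt_const (by linarith)
  have h3 : ∀ᶠ T : ℝ in 𝓝[>] (0 : ℝ), T ∈ Ioo (0 : ℝ) 1 := Ioo_mem_nhdsGT one_pos
  have h4 := (h1.and (h2.and (h3.and (hX.and hw))))
  rw [eventually_nhdsWithin_iff, Metric.eventually_nhds_iff] at h4
  obtain ⟨T₀, hT₀, h4⟩ := h4
  set C₁ := ‖c‖ + 1
  set C₃ := |C| * P + 2 * (P * ‖φ‖)
  set M := 2 * |C₁| + |C| ^ 2 + C₃ ^ 2 / a
  have hM : 0 ≤ M := by positivity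
  set K₁ := √M + √(M / a) * P
  refine ⟨T₀, K₁ + √(M / a) + (C₁ + |C| * K₁), hT₀, fun T hT hTT => ?_⟩
  obtain ⟨h1, h2, h3, hX, hw⟩ := h4 (y := T) (by rw [Real.dist_eq, sub_zero, abs_of_pos hT]; exact hTT) hT
  have hneg : (shiftForm A T ψ ψ).re ≤ -a := by
    rw [shiftForm_self_re, ha]; rw [ha] at h1; linarith
  have hεψ := functional_ne_zero hε hT.le (show (shiftForm A T ψ ψ).re < 0 by linarith)
  have htest : ‖⟪φ, (w T : H)⟫_ℂ - ⟪(X T : H), φ⟫_ℂ‖ ≤ C * (√T * ‖(w T : H)‖) := by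
    have : ⟪φ, (w T : H)⟫_ℂ - ⟪(X T : H), φ⟫_ℂ
        = ⟪φ - (A (X T) + (T : ℂ) • (X T : H)), (w T : H)⟫_ℂ := by
      rw [inner_sub_left, shiftForm_symm hA, shiftForm, hw]
    rw [this, ← mul_assoc]
    exact (norm_inner_le_norm _ _).trans (mul_le_mul_of_nonneg_right hX (norm_nonneg _))
  have hest := basic_estimate hA hε hneg hεψ (w T)
  set b := ε (w T) / ε ψ with hb
  set r := ‖((w T - b • ψ : A.domain) : H)‖ with hr
  have hb0 : 0 ≤ ‖b‖ := norm_nonneg _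
  have hsT : 0 ≤ √T := Real.sqrt_nonneg T
  have hsT1 : √T ≤ 1 := Real.sqrt_le_one.mpr h3.2.le
  have hwr : ‖(w T : H)‖ ≤ r + ‖b‖ * P := by
    have : (w T : H) = ((w T - b • ψ : A.domain) : H) + b • (ψ : H) := by simp
    rw [this]
    exact (norm_add_le _ _).trans (by rw [norm_smul])
  have hsw : √T * ‖(w T : H)‖ ≤ √T * r + ‖b‖ * P := by
    have h5 := mul_le_mul_of_nonneg_left hwr hsT
    have h6 : √T * (‖b‖ * P) ≤ 1 * (‖b‖ * P) := mul_le_mul_of_nonneg_right hsT1 (by positivity)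
    linarith
  have hG : (shiftForm A T (w T) (w T)).re = (⟪φ, (w T : H)⟫_ℂ).re := by
    rw [← shiftForm_symm hA, hw]
  have hGle : (⟪φ, (w T : H)⟫_ℂ).re ≤ C₁ + |C| * (√T * ‖(w T : H)‖) := by
    have h5 : ‖⟪(X T : H), φ⟫_ℂ‖ < C₁ := by rwa [norm_inner_symm]
    have h6 := (Complex.re_le_norm ⟪φ, (w T : H)⟫_ℂ).trans
      (norm_le_norm_add_norm_sub' _ ⟪(X T : H), φ⟫_ℂ)
    have h7 : C * (√T * ‖(w T : H)‖) ≤ |C| * (√T * ‖(w T : H)‖) :=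
      mul_le_mul_of_nonneg_right (le_abs_self C) (by positivity)
    linarith
  have h5 : ‖shiftForm A T ψ (w T)‖ ≤ P * ‖φ‖ := by
    rw [shiftForm, hw]; exact norm_inner_le_norm _ _
  have hquad : (√T * r) ^ 2 + a * ‖b‖ ^ 2 ≤ C₁ + |C| * (√T * r) + C₃ * ‖b‖ := by
    have h6 : (√T * r) ^ 2 = T * r ^ 2 := by rw [mul_pow, Real.sq_sqrt hT.le]
    have h7 : |C| * (√T * ‖(w T : H)‖) ≤ |C| * (√T * r + ‖b‖ * P) :=
      mul_le_mul_of_nonneg_left hsw (abs_nonneg C)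
    have h8 := mul_le_mul_of_nonneg_left h5 hb0
    have h9 : C₃ * ‖b‖ = |C| * (‖b‖ * P) + 2 * (‖b‖ * (P * ‖φ‖)) := by ring
    rw [h6, h9]
    linarith
  obtain ⟨hq1, hq2⟩ := bounded_of_quadratic ha0 hquad
  have hK : √T * ‖(w T : H)‖ ≤ K₁ := by
    have := mul_le_mul_of_nonneg_right hq2 hP0
    linarith
  have hK0 : 0 ≤ K₁ := by positivity
  have hs0 : 0 ≤ √(M / a) := Real.sqrt_nonneg _
  have hC10 : 0 ≤ C₁ := by positivity
  have hCK : 0 ≤ |C| * K₁ := by positivity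
  refine ⟨hw, by linarith, htest, by linarith, hq2.trans (by linarith), ?_⟩
  have := mul_le_mul_of_nonneg_left hK (abs_nonneg C)
  linarith

/-- The defect contributes at most C√T‖w_T‖, so it suffices that T‖w_T‖² → 0. The derivative of ⟨φ,
w_T⟩ in T is formally -‖w_T‖²: the pairing is almost decreasing in T and bounded above, hence
convergent, and its increments, which tend to 0, control T‖w_T‖². -/
theorem resolvent_tendsto (hA : IsSymm A) {ε : A.domain →ₗ[ℂ] ℂ}
    (hε : ∀ u, ε u = 0 → 0 ≤ (⟪(u : H), A u⟫_ℂ).re) {ψ : A.domain}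
    (hψ : (⟪(ψ : H), A ψ⟫_ℂ).re < 0) {φ : H} {X w : ℝ → A.domain} {C c : ℝ}
    (hX : ∀ᶠ T in 𝓝[>] (0 : ℝ), ‖φ - (A (X T) + (T : ℂ) • (X T : H))‖ ≤ C * √T)
    (hc : Tendsto (fun T => ⟪φ, (X T : H)⟫_ℂ) (𝓝[>] (0 : ℝ)) (𝓝 (c : ℂ)))
    (hw : ∀ᶠ T in 𝓝[>] (0 : ℝ), A (w T) + (T : ℂ) • (w T : H) = φ) :
    Tendsto (fun T => ⟪φ, (w T : H)⟫_ℂ) (𝓝[>] (0 : ℝ)) (𝓝 (c : ℂ)) := by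
  obtain ⟨T₀, K, hT₀, hK⟩ := resolvent_bound hA hε hψ hX hc hw
  set P := ‖(ψ : H)‖ with hP
  have hP0 : 0 ≤ P := norm_nonneg _
  set g : ℝ → ℝ := fun T => (⟪φ, (w T : H)⟫_ℂ).re with hg
  have hK0 : 0 ≤ K := by
    obtain ⟨-, -, -, h, -⟩ := hK (T₀ / 2) (by linarith) (by linarith)
    exact le_trans (by positivity) h
  -- With y = w_S - w_T the increment is (T - S)(‖w_T‖² + Re ⟨w_T, y⟩). The second term is the
  -- S-shifted form at y, which can be negative only through the component of y along ψ; that loss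
  -- is linear in ‖w_T‖.
  have hdiff : ∀ S T, 0 < S → S < T → T < T₀ →
      (T - S) * (‖(w T : H)‖ ^ 2 - 4 * (K * P) * ‖(w T : H)‖) ≤ g S - g T := by
    intro S T hS hST hT
    obtain ⟨hwS, hψS, -, -, hbS, -⟩ := hK S hS (hST.trans hT)
    obtain ⟨hwT, -, -, -, hbT, -⟩ := hK T (hS.trans hST) hT
    set y := w S - w T with hy
    have hAy : A y + (S : ℂ) • (y : H) = ((T - S : ℝ) : ℂ) • (w T : H) := by
      have : A y + (S : ℂ) • (y : H)
          = (A (w S) + (S : ℂ) • (w S : H)) - (A (w T) + (T : ℂ) • (w T : H))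
            + ((T - S : ℝ) : ℂ) • (w T : H) := by
        rw [hy, LinearPMap.map_sub, Submodule.coe_sub, Complex.ofReal_sub, sub_smul, smul_sub]
        abel
      rw [this, hwS, hwT, sub_self, zero_add]
    have hAy' : A y + (T : ℂ) • (y : H) = ((T - S : ℝ) : ℂ) • ((w T : H) + (y : H)) := by
      rw [smul_add, ← hAy, Complex.ofReal_sub, sub_smul]; abel
    have e1 : g S - g T = (T - S) * (‖(w T : H)‖ ^ 2 + (⟪(w T : H), (y : H)⟫_ℂ).re) := by
      have : ⟪φ, (w S : H)⟫_ℂ - ⟪φ, (w T : H)⟫_ℂ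
          = ((T - S : ℝ) : ℂ) * (⟪(w T : H), (w T : H)⟫_ℂ + ⟪(w T : H), (y : H)⟫_ℂ) := by
        rw [← inner_sub_right, ← Submodule.coe_sub, ← hwT, shiftForm_symm hA, shiftForm, ← hy,
          hAy', inner_smul_right, inner_add_right]
      rw [hg]
      simp only
      rw [← Complex.sub_re, this, Complex.re_ofReal_mul, Complex.add_re,
        inner_self_eq_norm_sq_to_K]
      simp [← Complex.ofReal_pow]
    have e2 : (T - S) * (⟪(w T : H), (y : H)⟫_ℂ).re = (shiftForm A S y y).re := by
      rw [← shiftForm_symm hA, hAy, inner_smul_left, Complex.conj_ofReal, Complex.re_ofReal_mul]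
    have hεψ := functional_ne_zero hε hS.le hψS
    have e3 := basic_estimate hA hε (T := S) (a := 0) (e := ψ) (by linarith) hεψ y
    have e4 : ‖ε y / ε ψ‖ ≤ 2 * K := by
      rw [hy, map_sub, sub_div]
      exact (norm_sub_le _ _).trans (by linarith)
    have e5 : ‖shiftForm A S ψ y‖ ≤ (T - S) * (P * ‖(w T : H)‖) := by
      rw [shiftForm, hAy, inner_smul_right, norm_mul, Complex.norm_real, Real.norm_eq_abs,
        abs_of_pos (by linarith)]
      exact mul_le_mul_of_nonneg_left (norm_inner_le_norm _ _) (by linarith)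
    have e6 : ‖ε y / ε ψ‖ * ‖shiftForm A S ψ y‖ ≤ 2 * K * ((T - S) * (P * ‖(w T : H)‖)) :=
      mul_le_mul e4 e5 (norm_nonneg _) (by linarith)
    have e7 : 0 ≤ S * ‖((y - (ε y / ε ψ) • ψ : A.domain) : H)‖ ^ 2 := by positivity
    rw [e1, mul_add, e2]
    rw [zero_mul, add_zero] at e3
    nlinarith
  have hwb : ∀ T, 0 < T → T < T₀ → T * ‖(w T : H)‖ ≤ K * √T := fun T h0 h1 => by
    have h2 := (hK T h0 h1).2.2.2.1
    calc T * ‖(w T : H)‖ = √T * (√T * ‖(w T : H)‖) := by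
          rw [← mul_assoc, Real.mul_self_sqrt h0.le]
      _ ≤ √T * K := mul_le_mul_of_nonneg_left h2 (Real.sqrt_nonneg _)
      _ = K * √T := mul_comm _ _
  obtain ⟨l, hl⟩ := exists_tendsto_of_almost_antitone (g := g) (C := 4 * (K * P) * K) hT₀
    (fun T h0 h1 => (hK T h0 h1).2.2.2.2.2)
    (fun S T hS hST hT => by
      have h1 := hdiff S T hS hST hT
      have h2 := hwb T (hS.trans hST) hT
      have h3 : 0 ≤ (T - S) * ‖(w T : H)‖ ^ 2 := mul_nonneg (by linarith) (sq_nonneg _)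
      have h4 : (T - S) * ‖(w T : H)‖ ≤ T * ‖(w T : H)‖ :=
        mul_le_mul_of_nonneg_right (by linarith) (norm_nonneg _)
      have h5 : 4 * (K * P) * ((T - S) * ‖(w T : H)‖) ≤ 4 * (K * P) * (K * √T) :=
        mul_le_mul_of_nonneg_left (h4.trans h2) (by positivity)
      nlinarith)
  have hhalf : Tendsto (fun T : ℝ => T / 2) (𝓝[>] (0 : ℝ)) (𝓝[>] (0 : ℝ)) := by
    refine tendsto_nhdsWithin_iff.mpr ⟨?_, ?_⟩
    · have : Tendsto (fun T : ℝ => T / 2) (𝓝 0) (𝓝 (0 / 2)) :=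
        (continuous_id.div_const 2).tendsto 0
      rw [zero_div] at this
      exact this.mono_left nhdsWithin_le_nhds
    · filter_upwards [self_mem_nhdsWithin] with T hT
      exact half_pos (mem_Ioi.mp hT)
  have hsqrt : Tendsto (fun T : ℝ => √T) (𝓝[>] (0 : ℝ)) (𝓝 0) := by
    have := Real.continuous_sqrt.tendsto 0
    rw [Real.sqrt_zero] at this
    exact this.mono_left nhdsWithin_le_nhds
  -- Taking S = T/2, the increment of g bounds T‖w_T‖²/2 up to O(√T), and g(T/2) - g(T) → 0 because
  -- g converges.
  have hTw : Tendsto (fun T => (√T * ‖(w T : H)‖) ^ 2) (𝓝[>] (0 : ℝ)) (𝓝 0) := by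
    have hup : Tendsto (fun T => 2 * (g (T / 2) - g T) + 4 * (K * P) * (K * √T))
        (𝓝[>] (0 : ℝ)) (𝓝 (2 * (l - l) + 4 * (K * P) * (K * 0))) :=
      (((hl.comp hhalf).sub hl).const_mul 2).add ((hsqrt.const_mul K).const_mul _)
    rw [sub_self, mul_zero, mul_zero, mul_zero, add_zero] at hup
    refine tendsto_of_tendsto_of_tendsto_of_le_of_le' tendsto_const_nhds hup
      (Eventually.of_forall fun T => sq_nonneg _) ?_
    filter_upwards [Ioo_mem_nhdsGT hT₀] with T hT
    have h1 := hdiff (T / 2) T (half_pos hT.1) (half_lt_self hT.1) hT.2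
    have h2 := mul_le_mul_of_nonneg_left (hwb T hT.1 hT.2) (show 0 ≤ 4 * (K * P) by positivity)
    rw [mul_pow, Real.sq_sqrt hT.1.le]
    nlinarith
  have hsw : Tendsto (fun T => √T * ‖(w T : H)‖) (𝓝[>] (0 : ℝ)) (𝓝 0) := by
    have := hTw.sqrt
    rw [Real.sqrt_zero] at this
    exact this.congr fun T => Real.sqrt_sq (by positivity)
  have hd : Tendsto (fun T => ⟪φ, (w T : H)⟫_ℂ - ⟪(X T : H), φ⟫_ℂ) (𝓝[>] (0 : ℝ)) (𝓝 0) := by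
    rw [tendsto_zero_iff_norm_tendsto_zero]
    have h := hsw.const_mul C
    rw [mul_zero] at h
    refine tendsto_of_tendsto_of_tendsto_of_le_of_le' tendsto_const_nhds h
      (Eventually.of_forall fun T => norm_nonneg _) ?_
    filter_upwards [Ioo_mem_nhdsGT hT₀] with T hT
    exact (hK T hT.1 hT.2).2.2.1
  have hc' : Tendsto (fun T => ⟪(X T : H), φ⟫_ℂ) (𝓝[>] (0 : ℝ)) (𝓝 (c : ℂ)) := by
    have h := (Complex.continuous_conj.tendsto _).comp hc
    rw [Complex.conj_ofReal] at h
    exact h.congr fun T => inner_conj_symm _ _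
  have h := hd.add hc'
  rw [zero_add] at h
  exact h.congr fun T => by ring

end Abstract

/-! ### Negative eigenvalues of the compression to the orthogonal complement of φ. -/

section Abstract

open scoped InnerProductSpace

variable {H : Type*} [NormedAddCommGroup H] [InnerProductSpace ℂ H] {A : H →ₗ.[ℂ] H}

/-- Eigenvectors of the compression of `A` to the orthogonal complement of `φ`. -/
def IsCompressedEigenvector (A : H →ₗ.[ℂ] H) (φ : H) (μ : ℝ) (w : A.domain) : Prop :=
  (w : H) ≠ 0 ∧ ⟪φ, (w : H)⟫_ℂ = 0 ∧ ∃ ν : ℂ, A w - (μ : ℂ) • (w : H) = -ν • φ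

theorem IsCompressedEigenvector.shiftForm_eq {φ : H} {μ : ℝ} {w : A.domain}
    (hw : IsCompressedEigenvector A φ μ w) (T : ℝ) {u : A.domain} (hu : ⟪φ, (u : H)⟫_ℂ = 0) :
    shiftForm A T u w = ((μ + T : ℝ) : ℂ) * ⟪(u : H), (w : H)⟫_ℂ := by
  obtain ⟨-, -, ν, hν⟩ := hw
  have h : A w + (T : ℂ) • (w : H) = ((μ + T : ℝ) : ℂ) • (w : H) + -ν • φ := by
    rw [← hν, Complex.ofReal_add, add_smul]; abel
  rw [shiftForm, h, inner_add_right, inner_smul_right, inner_smul_right,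
    inner_eq_zero_symm.mp hu, mul_zero, add_zero]

theorem IsCompressedEigenvector.shiftForm_self_neg {φ : H} {μ : ℝ} {w : A.domain}
    (hw : IsCompressedEigenvector A φ μ w) {T : ℝ} (hT : μ + T < 0) :
    (shiftForm A T w w).re < 0 := by
  rw [hw.shiftForm_eq T hw.2.1, Complex.re_ofReal_mul, inner_self_eq_norm_sq_to_K]
  simp only [Complex.coe_algebraMap, ← Complex.ofReal_pow, Complex.ofReal_re]
  have : 0 < ‖(w : H)‖ ^ 2 := by have := norm_pos_iff.mpr hw.1; positivity
  nlinarith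

theorem IsCompressedEigenvector.orthogonal (hA : IsSymm A) {φ : H} {μ μ' : ℝ} {w w' : A.domain}
    (hw : IsCompressedEigenvector A φ μ w) (hw' : IsCompressedEigenvector A φ μ' w')
    (hμ : μ ≠ μ') : ⟪(w : H), (w' : H)⟫_ℂ = 0 := by
  have h1 := hw'.shiftForm_eq 0 hw.2.1
  have h2 := congrArg conj (hw.shiftForm_eq 0 hw'.2.1)
  rw [shiftForm_conj hA, map_mul, Complex.conj_ofReal, inner_conj_symm, h1, add_zero,
    add_zero] at h2
  have h3 : ((μ' : ℂ) - μ) * ⟪(w : H), (w' : H)⟫_ℂ = 0 := by linear_combination h2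
  rcases mul_eq_zero.mp h3 with h | h
  · exact absurd (Complex.ofReal_injective (sub_eq_zero.mp h)).symm hμ
  · exact h

/-- Orthogonal eigenvectors with negative eigenvalues are form-orthogonal negative vectors, which
`not_two_negative` excludes. Distinct eigenvalues give orthogonality directly; for equal ones,
Gram–Schmidt produces it unless the vectors are proportional. -/
theorem IsCompressedEigenvector.unique (hA : IsSymm A) {ε : A.domain →ₗ[ℂ] ℂ}
    (hε : ∀ u, ε u = 0 → 0 ≤ (⟪(u : H), A u⟫_ℂ).re) {φ : H} {μ μ' : ℝ} {w w' : A.domain}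
    (hw : IsCompressedEigenvector A φ μ w) (hw' : IsCompressedEigenvector A φ μ' w')
    (hμ : μ < 0) (hμ' : μ' < 0) : μ' = μ ∧ ∃ a : ℂ, (w' : H) = a • (w : H) := by
  have key : ∀ {κ κ' : ℝ} {z z' : A.domain}, IsCompressedEigenvector A φ κ z →
      IsCompressedEigenvector A φ κ' z' → κ < 0 → κ' < 0 → ⟪(z : H), (z' : H)⟫_ℂ = 0 → False := by
    intro κ κ' z z' hz hz' h h' hzz
    refine not_two_negative hA hε le_rfl (u := z') (e := z)
      (hz'.shiftForm_self_neg (by linarith)) (hz.shiftForm_self_neg (by linarith)) ?_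
    rw [hz'.shiftForm_eq 0 hz.2.1, hzz, mul_zero]
  by_cases hne : μ' = μ
  · refine ⟨hne, ?_⟩
    subst hne
    set a := ⟪(w : H), (w' : H)⟫_ℂ / ⟪(w : H), (w : H)⟫_ℂ with ha
    refine ⟨a, ?_⟩
    by_contra hcon
    obtain ⟨ν, hν⟩ := hw.2.2
    obtain ⟨ν', hν'⟩ := hw'.2.2
    have hz : IsCompressedEigenvector A φ μ' (w' - a • w) := by
      refine ⟨?_, ?_, ν' - a * ν, ?_⟩
      · rw [Submodule.coe_sub, Submodule.coe_smul]
        exact sub_ne_zero.mpr hcon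
      · rw [Submodule.coe_sub, Submodule.coe_smul, inner_sub_right, inner_smul_right, hw.2.1,
          hw'.2.1, mul_zero, sub_zero]
      · have : A (w' - a • w) - (μ' : ℂ) • ((w' - a • w : A.domain) : H)
            = (A w' - (μ' : ℂ) • (w' : H)) - a • (A w - (μ' : ℂ) • (w : H)) := by
          rw [LinearPMap.map_sub, LinearPMap.map_smul, Submodule.coe_sub, Submodule.coe_smul,
            smul_sub, smul_sub, smul_comm]
          abel
        rw [this, hν, hν']
        module
    refine key hw hz hμ hμ ?_
    have hww : ⟪(w : H), (w : H)⟫_ℂ ≠ 0 := inner_self_ne_zero.mpr hw.1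
    rw [Submodule.coe_sub, Submodule.coe_smul, inner_sub_right, inner_smul_right, ha,
      div_mul_cancel₀ _ hww, sub_self]
  · exact (key hw hw' hμ hμ' (hw.orthogonal hA hw' (Ne.symm hne))).elim

/-- The vector y = (A + T)⁻¹φ is negative for the shifted form, and everything orthogonal to φ is
form-orthogonal to y. An eigenvector with μ < -T would be a second negative vector. -/
theorem not_isCompressedEigenvector (hA : IsSymm A) {ε : A.domain →ₗ[ℂ] ℂ}
    (hε : ∀ u, ε u = 0 → 0 ≤ (⟪(u : H), A u⟫_ℂ).re) {φ : H} {T : ℝ} (hT : 0 ≤ T)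
    {y : A.domain} (hy : A y + (T : ℂ) • (y : H) = φ) (hneg : (⟪φ, (y : H)⟫_ℂ).re < 0)
    {μ : ℝ} (hμ : μ + T < 0) {w : A.domain} : ¬ IsCompressedEigenvector A φ μ w := fun hw => by
  refine not_two_negative hA hε hT (u := y) (e := w) ?_ (hw.shiftForm_self_neg hμ) ?_
  · rwa [← shiftForm_symm hA, hy]
  · rw [shiftForm, hy, inner_eq_zero_symm.mp hw.2.1]

/-- Subtract from ψ its form-projection onto y. Since y represents ⟨φ, ·⟩ in the shifted form, the
result is orthogonal to φ, and because the form is positive at y the subtraction only lowers the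
value of the form. -/
theorem exists_negative_orthogonal (hA : IsSymm A) {φ : H} {T : ℝ} (hT : 0 ≤ T)
    {y : A.domain} (hy : A y + (T : ℂ) • (y : H) = φ) (hpos : 0 < (⟪φ, (y : H)⟫_ℂ).re)
    {ψ : A.domain} (hψ : (shiftForm A T ψ ψ).re < 0) :
    ∃ e : A.domain, ⟪φ, (e : H)⟫_ℂ = 0 ∧ (⟪(e : H), A e⟫_ℂ).re < 0 := by
  have hreal : (((⟪φ, (y : H)⟫_ℂ).re : ℝ) : ℂ) = ⟪φ, (y : H)⟫_ℂ := by
    have h := shiftForm_conj hA T y y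
    rw [← shiftForm_symm hA, hy] at h
    exact (Complex.conj_eq_iff_re.mp h)
  have hne : ⟪φ, (y : H)⟫_ℂ ≠ 0 := by
    rw [← hreal]; exact_mod_cast hpos.ne'
  set b := ⟪φ, (ψ : H)⟫_ℂ / ⟪φ, (y : H)⟫_ℂ with hb
  have hbm : b * ⟪φ, (y : H)⟫_ℂ = ⟪φ, (ψ : H)⟫_ℂ := div_mul_cancel₀ _ hne
  refine ⟨ψ - b • y, ?_, ?_⟩
  · rw [Submodule.coe_sub, Submodule.coe_smul, inner_sub_right, inner_smul_right, hbm, sub_self]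
  · have h1 := shiftForm_sub hA T ψ y b
    rw [← shiftForm_symm hA T y ψ, ← shiftForm_symm hA T y y, hy, ← hbm, ← mul_assoc,
      Complex.conj_mul', ← Complex.ofReal_pow, Complex.re_ofReal_mul] at h1
    have h2 := shiftForm_self_re T (ψ - b • y)
    have h3 : 0 ≤ T * ‖((ψ - b • y : A.domain) : H)‖ ^ 2 := by positivity
    have h4 : 0 ≤ ‖b‖ ^ 2 * (⟪φ, (y : H)⟫_ℂ).re := by positivity
    linarith

/-- Cauchy–Schwarz for a form that is non-negative on a subspace. -/
theorem shiftForm_cauchy_schwarz (hA : IsSymm A) {T : ℝ} {u e : A.domain}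
    (h : ∀ a b : ℂ, 0 ≤ (shiftForm A T (a • u + b • e) (a • u + b • e)).re) :
    ‖shiftForm A T e u‖ ^ 2 ≤ (shiftForm A T u u).re * (shiftForm A T e e).re := by
  set z := shiftForm A T e u with hz
  set p := (shiftForm A T u u).re with hp
  set q := (shiftForm A T e e).re with hq
  have hp0 : 0 ≤ p := by simpa using h 1 0
  have h1 : ∀ s : ℝ, 0 ≤ s ^ 2 * p - 2 * s * ‖z‖ ^ 2 + ‖z‖ ^ 2 * q := by
    intro s
    -- The phase of z is put into the second coefficient, which leaves a real quadratic polynomial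
    -- in s.
    have h2 := h s (-z)
    rw [shiftForm_add_smul hA, ← hz] at h2
    have h3 : (conj (-z) * (s : ℂ) * z).re = -(s * ‖z‖ ^ 2) := by
      have : conj (-z) * (s : ℂ) * z = ((-(s * ‖z‖ ^ 2) : ℝ) : ℂ) := by
        rw [map_neg]; push_cast; rw [← Complex.conj_mul']; ring
      rw [this, Complex.ofReal_re]
    rw [h3, norm_neg, Complex.norm_real, Real.norm_eq_abs, sq_abs] at h2
    linarith
  by_cases hz0 : ‖z‖ = 0
  · rw [hz0]
    have hq0 : 0 ≤ q := by simpa using h 0 1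
    simpa using mul_nonneg hp0 hq0
  · have hz1 : 0 < ‖z‖ ^ 2 := by positivity
    by_cases hp1 : p = 0
    · have h2 := h1 ((q + 1) / 2)
      rw [hp1] at h2
      nlinarith
    · have hp2 : 0 < p := lt_of_le_of_ne hp0 (Ne.symm hp1)
      have h2 := h1 (‖z‖ ^ 2 / p)
      have h3 : (‖z‖ ^ 2 / p) ^ 2 * p - 2 * (‖z‖ ^ 2 / p) * ‖z‖ ^ 2 + ‖z‖ ^ 2 * q
          = ‖z‖ ^ 2 * (p * q - ‖z‖ ^ 2) / p := by field_simp; ring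
      rw [h3] at h2
      have h4 : 0 ≤ ‖z‖ ^ 2 * (p * q - ‖z‖ ^ 2) := by
        have := mul_nonneg h2 hp0
        rwa [div_mul_cancel₀ _ hp1] at this
      have := nonneg_of_mul_nonneg_right h4 hz1
      linarith

/-- Minimize the Rayleigh quotient on the complement of φ. The infimum lam is negative, and on the
kernel of ε the form shifted by -lam dominates -lam‖·‖². So compactness can fail only along one
direction, where bounded scalars have a convergent subsequence; the minimizing sequence then
converges strongly. -/
theorem exists_isCompressedEigenvector [CompleteSpace H] (hA : IsSymm A) (hs : AdjointLE A)
    {M : ℝ} (hM : ∀ u : A.domain, -M * ‖(u : H)‖ ^ 2 ≤ (⟪(u : H), A u⟫_ℂ).re)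
    {ε : A.domain →ₗ[ℂ] ℂ} (hε : ∀ u, ε u = 0 → 0 ≤ (⟪(u : H), A u⟫_ℂ).re) {φ : H} (hφ : φ ≠ 0)
    {e₀ : A.domain} (he₀ : ⟪φ, (e₀ : H)⟫_ℂ = 0) (hneg : (⟪(e₀ : H), A e₀⟫_ℂ).re < 0) :
    ∃ μ : ℝ, μ < 0 ∧ ∃ w : A.domain, IsCompressedEigenvector A φ μ w := by
  set q : A.domain → ℝ := fun u => (⟪(u : H), A u⟫_ℂ).re with hq
  set s : Set ℝ := {t | ∃ u : A.domain, ⟪φ, (u : H)⟫_ℂ = 0 ∧ ‖(u : H)‖ = 1 ∧ q u = t} with hsd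
  have hqs : ∀ (a : ℂ) (u : A.domain), q (a • u) = ‖a‖ ^ 2 * q u := by
    intro a u
    simp only [hq, LinearPMap.map_smul, Submodule.coe_smul, inner_smul_left, inner_smul_right]
    rw [← mul_assoc, mul_comm a, Complex.conj_mul', ← Complex.ofReal_pow, Complex.re_ofReal_mul]
  have hnorm : ∀ u : A.domain, ⟪φ, (u : H)⟫_ℂ = 0 → (u : H) ≠ 0 → q u / ‖(u : H)‖ ^ 2 ∈ s := by
    intro u hu hu0
    have hn : ‖(u : H)‖ ≠ 0 := norm_ne_zero_iff.mpr hu0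
    refine ⟨((‖(u : H)‖⁻¹ : ℝ) : ℂ) • u, ?_, ?_, ?_⟩
    · rw [Submodule.coe_smul, inner_smul_right, hu, mul_zero]
    · rw [Submodule.coe_smul, norm_smul, Complex.norm_real, norm_inv, norm_norm,
        inv_mul_cancel₀ hn]
    · rw [hqs, Complex.norm_real, norm_inv, norm_norm, inv_pow]; field_simp
  have hbdd : BddBelow s := by
    refine ⟨-M, ?_⟩
    rintro _ ⟨u, -, hu, rfl⟩
    have := hM u
    rw [hu] at this
    simpa using this
  have he0 : (e₀ : H) ≠ 0 := by
    intro h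
    rw [h, inner_zero_left] at hneg
    simp at hneg
  have hne : s.Nonempty := ⟨_, hnorm e₀ he₀ he0⟩
  set lam := sInf s with hlam
  have hlam0 : lam < 0 := by
    refine (csInf_le hbdd (hnorm e₀ he₀ he0)).trans_lt ?_
    have : 0 < ‖(e₀ : H)‖ ^ 2 := by have := norm_pos_iff.mpr he0; positivity
    exact div_neg_of_neg_of_pos hneg this
  have hpos : ∀ u : A.domain, ⟪φ, (u : H)⟫_ℂ = 0 → 0 ≤ (shiftForm A (-lam) u u).re := by
    intro u hu
    rw [shiftForm_self_re]
    by_cases hu0 : (u : H) = 0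
    · simp [hu0]
    · have h1 := csInf_le hbdd (hnorm u hu hu0)
      have : 0 < ‖(u : H)‖ ^ 2 := by have := norm_pos_iff.mpr hu0; positivity
      rw [← hlam, le_div_iff₀ this] at h1
      simp only [hq] at h1
      linarith
  have hseq : ∀ n : ℕ, ∃ u : A.domain, ⟪φ, (u : H)⟫_ℂ = 0 ∧ ‖(u : H)‖ = 1 ∧
      (shiftForm A (-lam) u u).re < 1 / ((n : ℝ) + 1) := by
    intro n
    obtain ⟨t, ⟨u, hu1, hu2, rfl⟩, ht⟩ := exists_lt_of_csInf_lt hne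
      (show sInf s < lam + 1 / ((n : ℝ) + 1) by
        have : (0 : ℝ) < 1 / ((n : ℝ) + 1) := by positivity
        linarith)
    refine ⟨u, hu1, hu2, ?_⟩
    rw [shiftForm_self_re, hu2]
    simp only [hq] at ht
    linarith
  choose u huφ hu1 huq using hseq
  have hq0 : Tendsto (fun n => (shiftForm A (-lam) (u n) (u n)).re) atTop (𝓝 0) :=
    tendsto_of_tendsto_of_tendsto_of_le_of_le tendsto_const_nhds
      tendsto_one_div_add_atTop_nhds_zero_nat (fun n => hpos _ (huφ n)) (fun n => (huq n).le)
  -- a fixed admissible direction that is negative for a slightly larger level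
  obtain ⟨_, ⟨e, heφ, he1, rfl⟩, hel⟩ := exists_lt_of_csInf_lt hne
    (show sInf s < lam / 2 by linarith)
  have heneg : (shiftForm A (-(lam / 2)) e e).re < 0 := by
    rw [shiftForm_self_re, he1]; simp only [hq] at hel; linarith
  set a := -(shiftForm A (-(lam / 2)) e e).re with ha
  have ha0 : 0 < a := by linarith
  have hεe : ε e ≠ 0 := functional_ne_zero hε (by linarith) heneg
  set b : ℕ → ℂ := fun n => ε (u n) / ε e with hb
  set D := ‖A e + ((-(lam / 2) : ℝ) : ℂ) • (e : H)‖ with hD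
  have hbb : ∀ n, ‖b n‖ ≤ √((2 * |1 - lam| + 0 ^ 2 + (2 * D) ^ 2 / a) / a) := by
    intro n
    have h1 := basic_estimate hA hε (T := -(lam / 2)) (a := a) (e := e) (by linarith) hεe (u n)
    have h2 : ‖shiftForm A (-(lam / 2)) e (u n)‖ ≤ D := by
      rw [← shiftForm_symm hA]
      exact (norm_inner_le_norm _ _).trans (by rw [hu1, mul_one])
    have h3 : (shiftForm A (-(lam / 2)) (u n) (u n)).re ≤ 1 - lam := by
      have h4 := huq n
      have h5 : 1 / ((n : ℝ) + 1) ≤ 1 := by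
        rw [div_le_one (by positivity)]
        linarith [Nat.cast_nonneg (α := ℝ) n]
      rw [shiftForm_self_re, hu1] at h4 ⊢
      linarith
    have h4 : 0 ≤ -(lam / 2) * ‖((u n - (ε (u n) / ε e) • e : A.domain) : H)‖ ^ 2 :=
      mul_nonneg (by linarith) (sq_nonneg _)
    have h5 := mul_le_mul_of_nonneg_left h2 (norm_nonneg (b n))
    refine (bounded_of_quadratic (s := 0) (C₁ := 1 - lam) (C₂ := 0) (C₃ := 2 * D) ha0 ?_).2
    simp only [hb] at h5 ⊢
    nlinarith
  obtain ⟨bl, -, φs, hφs, hbt⟩ := tendsto_subseq_of_bounded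
    (Metric.isBounded_closedBall (x := (0 : ℂ)))
    (fun n => (mem_closedBall_zero_iff.mpr (hbb n)))
  set v : ℕ → A.domain := fun n => u (φs n) with hv
  have hvq : Tendsto (fun n => (shiftForm A (-lam) (v n) (v n)).re) atTop (𝓝 0) :=
    hq0.comp hφs.tendsto_atTop
  -- The corrected difference lies in the kernel of ε, so its norm is controlled by the form; the
  -- form is non-negative on the complement of φ, so the parallelogram law bounds it by the small
  -- values along the sequence.
  have hdiffle : ∀ m n, -lam * ‖((v m - v n - (b (φs m) - b (φs n)) • e : A.domain) : H)‖ ^ 2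
      ≤ 4 * ((shiftForm A (-lam) (v m) (v m)).re + (shiftForm A (-lam) (v n) (v n)).re)
        + 2 * (‖b (φs m) - b (φs n)‖ ^ 2 * (shiftForm A (-lam) e e).re) := by
    intro m n
    have h0 : ε (v m - v n - (b (φs m) - b (φs n)) • e) = 0 := by
      rw [map_sub, map_sub, map_smul, smul_eq_mul, sub_mul]
      simp only [hb, hv]
      rw [div_mul_cancel₀ _ hεe, div_mul_cancel₀ _ hεe, sub_self]
    have h1 := le_of_functional hε (T := -lam) h0
    have par : ∀ x y : A.domain, ⟪φ, (x : H)⟫_ℂ = 0 → ⟪φ, (y : H)⟫_ℂ = 0 → ∀ c : ℂ,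
        (shiftForm A (-lam) (x - c • y) (x - c • y)).re
        ≤ 2 * (shiftForm A (-lam) x x).re + 2 * (‖c‖ ^ 2 * (shiftForm A (-lam) y y).re) := by
      intro x y hx hy c
      have h2 := hpos (x + c • y) (by
        rw [Submodule.coe_add, Submodule.coe_smul, inner_add_right, inner_smul_right, hx, hy,
          mul_zero, add_zero])
      have h3 := shiftForm_sub hA (-lam) x y c
      have h4 := shiftForm_sub hA (-lam) x y (-c)
      rw [neg_smul, sub_neg_eq_add, map_neg, neg_mul, Complex.neg_re, norm_neg] at h4
      linarith
    have h2 := par (v m) (v n) (huφ _) (huφ _) 1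
    rw [one_smul, norm_one, one_pow, one_mul] at h2
    have h3 := par (v m - v n) e (by
      rw [Submodule.coe_sub, inner_sub_right, huφ, huφ, sub_zero]) heφ (b (φs m) - b (φs n))
    linarith
  have hcv : CauchySeq fun n => (v n : H) - b (φs n) • (e : H) := by
    rw [Metric.cauchySeq_iff']
    intro δ hδ
    have hE : 0 ≤ (shiftForm A (-lam) e e).re := hpos e heφ
    set E := (shiftForm A (-lam) e e).re with hEd
    -- Error budget: two form values below η/16, weighted by 4, give less than η/2, and the scalar
    -- term, at most η/4 and weighted by 2, gives the other half.
    set η := -lam * δ ^ 2 with hη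
    have hη0 : 0 < η := by have : 0 < -lam := by linarith
                           positivity
    have h1 : ∀ᶠ n in atTop, (shiftForm A (-lam) (v n) (v n)).re < η / 16 :=
      hvq.eventually_lt_const (by positivity)
    have hbc := (hbt.cauchySeq)
    rw [Metric.cauchySeq_iff'] at hbc
    obtain ⟨N₁, hN₁⟩ := eventually_atTop.mp h1
    have hbt' : Tendsto (fun n => b (φs n) - bl) atTop (𝓝 0) := by
      have := hbt.sub_const bl
      rwa [sub_self] at this
    have h2 : ∀ᶠ n in atTop, ‖b (φs n) - bl‖ < √(η / (16 * (E + 1))) := by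
      have := hbt'.norm
      rw [norm_zero] at this
      exact this.eventually_lt_const (by positivity)
    obtain ⟨N₂, hN₂⟩ := eventually_atTop.mp h2
    refine ⟨max N₁ N₂, fun n hn => ?_⟩
    have hn1 := hN₁ n (le_of_max_le_left hn)
    have hn2 := hN₂ n (le_of_max_le_right hn)
    have hm1 := hN₁ (max N₁ N₂) (le_max_left _ _)
    have hm2 := hN₂ (max N₁ N₂) (le_max_right _ _)
    have h3 := hdiffle n (max N₁ N₂)
    have h4 : ‖b (φs n) - b (φs (max N₁ N₂))‖ ≤ 2 * √(η / (16 * (E + 1))) := by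
      have : b (φs n) - b (φs (max N₁ N₂))
          = (b (φs n) - bl) - (b (φs (max N₁ N₂)) - bl) := by ring
      rw [this]
      exact (norm_sub_le _ _).trans (by linarith)
    have h5 : ‖b (φs n) - b (φs (max N₁ N₂))‖ ^ 2 * E ≤ η / 4 := by
      have h6 := pow_le_pow_left₀ (norm_nonneg _) h4 2
      rw [mul_pow, Real.sq_sqrt (by positivity)] at h6
      have h7 := mul_le_mul_of_nonneg_right h6 hE
      refine h7.trans ?_
      have : 2 ^ 2 * (η / (16 * (E + 1))) * E = η / 4 * (E / (E + 1)) := by field_simp; ring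
      rw [this]
      exact mul_le_of_le_one_right (by positivity) (by rw [div_le_one (by positivity)]; linarith)
    have h8 : -lam * ‖((v n - v (max N₁ N₂) - (b (φs n) - b (φs (max N₁ N₂))) • e : A.domain) : H)‖ ^ 2
        < -lam * δ ^ 2 := by
      linarith
    have h9 := lt_of_mul_lt_mul_left h8 (by linarith)
    have h10 := lt_of_pow_lt_pow_left₀ 2 hδ.le h9
    have h11 : ((v n : H) - b (φs n) • (e : H)) - ((v (max N₁ N₂) : H)
        - b (φs (max N₁ N₂)) • (e : H))
        = ((v n - v (max N₁ N₂) - (b (φs n) - b (φs (max N₁ N₂))) • e : A.domain) : H) := by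
      simp only [Submodule.coe_sub, Submodule.coe_smul, sub_smul]
      abel
    rw [dist_eq_norm, h11]
    exact h10
  obtain ⟨z, hz⟩ := cauchySeq_tendsto_of_complete hcv
  set x := z + bl • (e : H) with hx
  have hvx : Tendsto (fun n => (v n : H)) atTop (𝓝 x) := by
    refine (hz.add (hbt.smul_const (e : H))).congr fun n => ?_
    exact sub_add_cancel _ _
  clear_value x
  have hx1 : ‖x‖ = 1 := by
    have := hvx.norm
    refine tendsto_nhds_unique this ?_
    simp only [hv, hu1]
    exact tendsto_const_nhds
  have hxφ : ⟪φ, x⟫_ℂ = 0 := by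
    have h : Tendsto (fun n => ⟪φ, (v n : H)⟫_ℂ) atTop (𝓝 ⟪φ, x⟫_ℂ) :=
      tendsto_const_nhds.inner hvx
    refine tendsto_nhds_unique h ?_
    simp only [hv, huφ]
    exact tendsto_const_nhds
  -- Euler–Lagrange equation in weak form: by Cauchy–Schwarz the form between v n and θ is at most
  -- the square root of a quantity tending to 0.
  have hortho : ∀ θ : A.domain, ⟪φ, (θ : H)⟫_ℂ = 0 →
      ⟪x, A θ + ((-lam : ℝ) : ℂ) • (θ : H)⟫_ℂ = 0 := by
    intro θ hθ
    have h : Tendsto (fun n => shiftForm A (-lam) (v n) θ) atTop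
        (𝓝 ⟪x, A θ + ((-lam : ℝ) : ℂ) • (θ : H)⟫_ℂ) := hvx.inner tendsto_const_nhds
    refine tendsto_nhds_unique h ?_
    rw [tendsto_zero_iff_norm_tendsto_zero]
    have h2 := (hvq.const_mul (shiftForm A (-lam) θ θ).re).sqrt
    rw [mul_zero, Real.sqrt_zero] at h2
    refine squeeze_zero (fun n => norm_nonneg _) (fun n => ?_) h2
    refine Real.le_sqrt_of_sq_le ?_
    refine shiftForm_cauchy_schwarz hA (u := θ) (e := v n) fun c d => hpos _ ?_
    rw [Submodule.coe_add, Submodule.coe_smul, Submodule.coe_smul, inner_add_right,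
      inner_smul_right, inner_smul_right, hθ, huφ, mul_zero, mul_zero, add_zero]
  obtain ⟨θ₁, hθ₁⟩ := hs.exists_inner_ne_zero hφ
  -- Lagrange multiplier. Correcting a general θ by a multiple of θ₁ makes it orthogonal to φ; the
  -- resulting identity is an adjoint relation, which also places x in the domain.
  set ν := ⟪x, A θ₁ + ((-lam : ℝ) : ℂ) • (θ₁ : H)⟫_ℂ / ⟪φ, (θ₁ : H)⟫_ℂ with hν
  obtain ⟨hxD, hAx⟩ := hs x ((lam : ℂ) • x + conj ν • φ) (fun θ => by
    have h1 := hortho (θ - (⟪φ, (θ : H)⟫_ℂ / ⟪φ, (θ₁ : H)⟫_ℂ) • θ₁) (by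
      rw [Submodule.coe_sub, Submodule.coe_smul, inner_sub_right, inner_smul_right,
        div_mul_cancel₀ _ hθ₁, sub_self])
    have h2 : A (θ - (⟪φ, (θ : H)⟫_ℂ / ⟪φ, (θ₁ : H)⟫_ℂ) • θ₁) + ((-lam : ℝ) : ℂ) •
          ((θ - (⟪φ, (θ : H)⟫_ℂ / ⟪φ, (θ₁ : H)⟫_ℂ) • θ₁ : A.domain) : H)
        = (A θ + ((-lam : ℝ) : ℂ) • (θ : H)) - (⟪φ, (θ : H)⟫_ℂ / ⟪φ, (θ₁ : H)⟫_ℂ) •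
          (A θ₁ + ((-lam : ℝ) : ℂ) • (θ₁ : H)) := by
      rw [LinearPMap.map_sub, LinearPMap.map_smul, Submodule.coe_sub, Submodule.coe_smul]
      module
    rw [h2, inner_sub_right, inner_smul_right, inner_add_right, inner_smul_right] at h1
    rw [inner_add_left, inner_smul_left, inner_smul_left, Complex.conj_conj, Complex.conj_ofReal]
    rw [hν]
    push_cast at h1 ⊢
    linear_combination h1)
  refine ⟨lam, hlam0, ⟨x, hxD⟩, ?_, hxφ, -conj ν, ?_⟩
  · intro h
    simp only at h
    rw [h, norm_zero] at hx1
    exact zero_ne_one hx1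
  · rw [hAx, neg_neg]
    simp

end Abstract

/-! ### Weak derivatives in L², density of test functions, and the free resolvent. -/

section Weak

open scoped InnerProductSpace

/-- Integrate from the left of the support: the primitive vanishes on the left trivially, and on the
right because the total integral is 0. -/
theorem exists_test_primitive {ψ : ℝ → ℝ} (hψ : ContDiff ℝ ∞ ψ) (hc : HasCompactSupport ψ)
    (h0 : ∫ x, ψ x = 0) : ∃ η : ℝ → ℝ, ContDiff ℝ ∞ η ∧ HasCompactSupport η ∧ deriv η = ψ := by
  obtain ⟨R, hR⟩ := hc.isCompact.isBounded.subset_closedBall 0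
  rw [Real.closedBall_eq_Icc, zero_sub, zero_add] at hR
  have hz : ∀ x, x ∉ Icc (-R) R → ψ x = 0 := fun x hx =>
    image_eq_zero_of_notMem_tsupport fun h => hx (hR h)
  have hder : ∀ x, HasDerivAt (fun x => ∫ t in (-R)..x, ψ t) (ψ x) x := fun x =>
    hψ.continuous.integral_hasStrictDerivAt (-R) x |>.hasDerivAt
  have hd : deriv (fun x => ∫ t in (-R)..x, ψ t) = ψ := funext fun x => (hder x).deriv
  refine ⟨fun x => ∫ t in (-R)..x, ψ t, ?_, ?_, hd⟩
  · rw [contDiff_infty_iff_deriv, hd]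
    exact ⟨fun x => (hder x).differentiableAt, hψ⟩
  · refine HasCompactSupport.intro (isCompact_Icc (a := -R) (b := R)) fun x hx => ?_
    have hsupp : ∀ a b : ℝ, (∀ t ∈ Ioc a b, t ∉ Icc (-R) R) → ∫ t in a..b, ψ t = 0 ∨ b < a := by
      intro a b hab
      by_cases h : a ≤ b
      · left
        rw [intervalIntegral.integral_of_le h]
        exact setIntegral_eq_zero_of_forall_eq_zero fun t ht => hz t (hab t ht)
      · right; exact not_le.mp h
    rw [mem_Icc, not_and_or, not_le, not_le] at hx
    rcases hx with hx | hx
    · rw [intervalIntegral.integral_symm, intervalIntegral.integral_of_le hx.le,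
        integral_Ioc_eq_integral_Ioo, neg_eq_zero]
      exact setIntegral_eq_zero_of_forall_eq_zero fun t ht =>
        hz t fun h => absurd h.1 (not_le.mpr ht.2)
    · by_cases hRR : -R ≤ x
      · rw [intervalIntegral.integral_of_le hRR, ← h0, ← integral_Icc_eq_integral_Ioc]
        refine setIntegral_eq_integral_of_forall_compl_eq_zero fun t ht => hz t fun h => ht ?_
        exact ⟨h.1, h.2.trans hx.le⟩
      · rw [intervalIntegral.integral_symm, intervalIntegral.integral_of_le (not_le.mp hRR).le,
          neg_eq_zero]
        refine setIntegral_eq_zero_of_forall_eq_zero fun t ht => hz t fun h => ?_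
        exact absurd h.2 (not_le.mpr (hx.trans ht.1))

/-- A locally integrable function with vanishing weak derivative is constant. -/
theorem ae_eq_const_of_integral_deriv_smul_eq_zero {s : ℝ → ℂ} (hs : LocallyIntegrable s)
    (h : ∀ θ : ℝ → ℝ, ContDiff ℝ ∞ θ → HasCompactSupport θ → ∫ x, deriv θ x • s x = 0) :
    ∃ c : ℂ, s =ᵐ[volume] fun _ => c := by
  let b : ContDiffBump (0 : ℝ) := ⟨1, 2, one_pos, one_lt_two⟩
  set θ₀ : ℝ → ℝ := b.normed volume with hθ₀
  have hθ₀s : ContDiff ℝ ∞ θ₀ := b.contDiff_normed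
  have hθ₀c : HasCompactSupport θ₀ := b.hasCompactSupport_normed
  have hint : ∀ θ : ℝ → ℝ, ContDiff ℝ ∞ θ → HasCompactSupport θ →
      Integrable fun x => θ x • s x := fun θ h1 h2 =>
    hs.integrable_smul_left_of_hasCompactSupport h1.continuous h2
  set c : ℂ := ∫ x, θ₀ x • s x with hc
  refine ⟨c, ?_⟩
  have key : ∀ᵐ x ∂(volume : Measure ℝ), s x - c = 0 := by
    refine ae_eq_zero_of_integral_contDiff_smul_eq_zero
      (hs.sub (continuous_const.locallyIntegrable)) fun θ hθ hθc => ?_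
    have hiθ : Integrable θ := hθ.continuous.integrable_of_hasCompactSupport hθc
    have hiθ₀ : Integrable θ₀ := hθ₀s.continuous.integrable_of_hasCompactSupport hθ₀c
    -- Subtracting the right multiple of a normalized bump makes the integral vanish, so the
    -- difference is the derivative of a test function and pairs to 0 with s.
    have hψs : ContDiff ℝ ∞ (fun x => θ x - (∫ y, θ y) * θ₀ x) :=
      hθ.sub (contDiff_const.mul hθ₀s)
    have hψc : HasCompactSupport (fun x => θ x - (∫ y, θ y) * θ₀ x) :=
      hθc.sub hθ₀c.mul_left
    have hψ0 : ∫ x, (θ x - (∫ y, θ y) * θ₀ x) = 0 := by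
      rw [integral_sub hiθ (hiθ₀.const_mul _), integral_const_mul, hθ₀, b.integral_normed,
        mul_one, sub_self]
    obtain ⟨η, hη, hηc, hηd⟩ := exists_test_primitive hψs hψc hψ0
    have h1 := h η hη hηc
    rw [hηd] at h1
    have h2 : ∫ x, (θ x - (∫ y, θ y) * θ₀ x) • s x
        = (∫ x, θ x • s x) - ((∫ y, θ y : ℝ) : ℂ) * c := by
      rw [hc, ← integral_const_mul, ← integral_sub (hint θ hθ hθc)
        ((hint θ₀ hθ₀s hθ₀c).const_mul _)]
      refine integral_congr_ae (Eventually.of_forall fun x => ?_)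
      simp only [Complex.real_smul]
      push_cast
      ring
    rw [h2] at h1
    have h3 : ∫ x, θ x • (s x - c) = (∫ x, θ x • s x) - ((∫ y, θ y : ℝ) : ℂ) * c := by
      have hi2 : Integrable (fun x => (θ x : ℂ) * c) := hiθ.ofReal.mul_const c
      rw [← integral_complex_ofReal, ← integral_mul_const, ← integral_sub (hint θ hθ hθc) hi2]
      refine integral_congr_ae (Eventually.of_forall fun x => ?_)
      simp only [Complex.real_smul]
      ring
    change ∫ x, θ x • (s x - c) = 0
    rw [h3, h1]
  filter_upwards [key] with x hx
  exact sub_eq_zero.mp hx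

/-- A real continuous compactly supported function as an element of `L²(ℝ, ℂ)`. -/
theorem memLp_ofReal_of_hasCompactSupport {θ : ℝ → ℝ} (hθ : Continuous θ)
    (hc : HasCompactSupport θ) : MemLp (fun x => (θ x : ℂ)) 2 (volume : Measure ℝ) :=
  (hθ.memLp_of_hasCompactSupport hc).ofReal

theorem inner_toLp_ofReal {θ : ℝ → ℝ} (hθ : MemLp (fun x => (θ x : ℂ)) 2 (volume : Measure ℝ))
    (w : L2) : ⟪hθ.toLp, w⟫_ℂ = ∫ x, θ x • w x := by
  rw [L2.inner_def]
  refine integral_congr_ae ?_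
  filter_upwards [hθ.coeFn_toLp] with x hx
  rw [hx, RCLike.inner_apply, Complex.real_smul, Complex.conj_ofReal, mul_comm]

/-- Expressed through pairings with fixed vectors of L², the relation is visibly closed under L²
limits. -/
theorem hasWeakDeriv_iff {w g : L2} : HasWeakDeriv w g ↔
    ∀ (θ : ℝ → ℝ) (hθ : ContDiff ℝ ∞ θ) (hc : HasCompactSupport θ),
      ⟪(memLp_ofReal_of_hasCompactSupport (hθ.continuous_deriv (by simp)) hc.deriv).toLp, w⟫_ℂ
        = -⟪(memLp_ofReal_of_hasCompactSupport hθ.continuous hc).toLp, g⟫_ℂ := by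
  simp only [inner_toLp_ofReal]
  rfl

/-- The graph of the weak derivative, in the Hilbert space `L² × L²`. -/
noncomputable def weakGraph : Submodule ℂ (WithLp 2 (L2 × L2)) where
  carrier := {p | HasWeakDeriv p.fst p.snd}
  zero_mem' := hasWeakDeriv_zero
  add_mem' h h' := h.add h'
  smul_mem' a _ h := h.smul a

theorem mem_weakGraph {p : WithLp 2 (L2 × L2)} : p ∈ weakGraph ↔ HasWeakDeriv p.fst p.snd :=
  Iff.rfl

theorem continuous_fst_withLp : Continuous fun p : WithLp 2 (L2 × L2) => p.fst :=
  continuous_fst.comp (WithLp.prod_continuous_ofLp 2 L2 L2)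

theorem continuous_snd_withLp : Continuous fun p : WithLp 2 (L2 × L2) => p.snd :=
  continuous_snd.comp (WithLp.prod_continuous_ofLp 2 L2 L2)

theorem isClosed_weakGraph : IsClosed (weakGraph : Set (WithLp 2 (L2 × L2))) := by
  have : (weakGraph : Set (WithLp 2 (L2 × L2))) =
      ⋂ (θ : ℝ → ℝ) (hθ : ContDiff ℝ ∞ θ) (hc : HasCompactSupport θ),
        {p | ⟪(memLp_ofReal_of_hasCompactSupport (hθ.continuous_deriv (by simp)) hc.deriv).toLp,
          p.fst⟫_ℂ = -⟪(memLp_ofReal_of_hasCompactSupport hθ.continuous hc).toLp, p.snd⟫_ℂ} := by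
    ext p
    simp only [mem_iInter, mem_ofPred_eq, SetLike.mem_coe, mem_weakGraph]
    exact hasWeakDeriv_iff
  rw [this]
  refine isClosed_iInter fun θ => isClosed_iInter fun hθ => isClosed_iInter fun hc => ?_
  exact isClosed_eq (continuous_const.inner continuous_fst_withLp)
    (continuous_const.inner continuous_snd_withLp).neg

instance : CompleteSpace weakGraph := isClosed_weakGraph.completeSpace_coe

/-- Classical derivatives are weak derivatives. -/
theorem hasWeakDeriv_toLp {u u' : ℝ → ℂ} (hu : ∀ x, HasDerivAt u (u' x) x)
    (h : MemLp u 2 (volume : Measure ℝ)) (h' : MemLp u' 2 (volume : Measure ℝ)) :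
    HasWeakDeriv h.toLp h'.toLp := by
  intro θ hθ hc
  have e1 : ∫ x, deriv θ x • (h.toLp : L2) x = ∫ x, u x * ((deriv θ x : ℝ) : ℂ) := by
    refine integral_congr_ae ?_
    filter_upwards [h.coeFn_toLp] with x hx
    rw [hx, Complex.real_smul, mul_comm]
  have e2 : ∫ x, θ x • (h'.toLp : L2) x = ∫ x, u' x * (θ x : ℂ) := by
    refine integral_congr_ae ?_
    filter_upwards [h'.coeFn_toLp] with x hx
    rw [hx, Complex.real_smul, mul_comm]
  have hi : ∀ {f : ℝ → ℂ} {η : ℝ → ℝ}, MemLp f 2 (volume : Measure ℝ) → Continuous η →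
      HasCompactSupport η → Integrable (fun x => f x * (η x : ℂ)) := fun hf hη hηc =>
    memLp_one_iff_integrable.mp
      (MemLp.mul (p := 2) (q := 2) (r := 1) (memLp_ofReal_of_hasCompactSupport hη hηc) hf)
  rw [e1, e2]
  refine integral_mul_deriv_eq_deriv_mul_of_integrable (v := fun x => (θ x : ℂ))
    (fun x _ => hu x) (fun x _ => ?_) (hi h (hθ.continuous_deriv (by simp)) hc.deriv)
    (hi h' hθ.continuous hc) (hi h hθ.continuous hc)
  exact ((hθ.differentiable (by simp)) x).hasDerivAt.ofReal_comp

/-- Pairs `(θ, θ')` with `θ` a real test function. -/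
def testPairs : Set (WithLp 2 (L2 × L2)) :=
  {p | ∃ (θ : ℝ → ℝ) (hθ : ContDiff ℝ ∞ θ) (hc : HasCompactSupport θ),
    p = WithLp.toLp 2 ((memLp_ofReal_of_hasCompactSupport hθ.continuous hc).toLp,
      (memLp_ofReal_of_hasCompactSupport (hθ.continuous_deriv (by simp)) hc.deriv).toLp)}

theorem testPairs_subset : testPairs ⊆ (weakGraph : Set (WithLp 2 (L2 × L2))) := by
  rintro _ ⟨θ, hθ, hc, rfl⟩
  exact hasWeakDeriv_toLp (fun x => ((hθ.differentiable (by simp)) x).hasDerivAt.ofReal_comp)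
    (memLp_ofReal_of_hasCompactSupport hθ.continuous hc)
    (memLp_ofReal_of_hasCompactSupport (hθ.continuous_deriv (by simp)) hc.deriv)

/-- An `L²` function proportional to its weak derivative with a real factor of modulus one
vanishes. -/
theorem eq_zero_of_hasWeakDeriv_smul {s : L2} {σ : ℝ} (hσ : σ = 1 ∨ σ = -1)
    (h : HasWeakDeriv s ((σ : ℂ) • s)) : s = 0 := by
  have hloc : LocallyIntegrable (fun x => Real.exp (-σ * x) • s x) := by
    have h1 : LocallyIntegrable s := (Lp.memLp s).locallyIntegrable (by norm_num)
    rw [← locallyIntegrableOn_univ] at h1 ⊢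
    exact h1.continuousOn_smul isOpen_univ.isLocallyClosed (by fun_prop)
  -- Multiplication by exp(-σx) turns s' = σs into a vanishing weak derivative, so s is a multiple
  -- of exp(σx).
  obtain ⟨c, hc⟩ := ae_eq_const_of_integral_deriv_smul_eq_zero hloc (fun θ hθ hθc => by
    have hη : ContDiff ℝ ∞ fun x => θ x * Real.exp (-σ * x) := by fun_prop
    have hηc : HasCompactSupport fun x => θ x * Real.exp (-σ * x) := hθc.mul_right
    have h1 := h _ hη hηc
    have hd : ∀ x, deriv (fun x => θ x * Real.exp (-σ * x)) x
        = deriv θ x * Real.exp (-σ * x) - σ * (θ x * Real.exp (-σ * x)) := by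
      intro x
      have h2 : HasDerivAt (fun x => Real.exp (-σ * x)) (Real.exp (-σ * x) * (-σ * 1)) x :=
        ((hasDerivAt_id x).const_mul (-σ)).exp
      have h3 : HasDerivAt (fun x => θ x * Real.exp (-σ * x)) _ x :=
        ((hθ.differentiable (by simp)) x).hasDerivAt.mul h2
      rw [h3.deriv]
      ring
    have hi1 : Integrable fun x => (deriv θ x * Real.exp (-σ * x)) • s x :=
      integrable_smul_coe s ((hθ.continuous_deriv (by simp)).mul (by fun_prop)) hθc.deriv.mul_right
    have hi2 : Integrable fun x => (θ x * Real.exp (-σ * x)) • s x :=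
      integrable_smul_coe s hη.continuous hηc
    have e1 : ∫ x, deriv (fun x => θ x * Real.exp (-σ * x)) x • s x
        = (∫ x, (deriv θ x * Real.exp (-σ * x)) • s x)
          - (σ : ℂ) * ∫ x, (θ x * Real.exp (-σ * x)) • s x := by
      rw [← integral_const_mul, ← integral_sub hi1 (hi2.const_mul _)]
      refine integral_congr_ae (Eventually.of_forall fun x => ?_)
      simp only [hd, Complex.real_smul]
      push_cast
      ring
    have e2 : ∫ x, (θ x * Real.exp (-σ * x)) • ((σ : ℂ) • s : L2) x
        = (σ : ℂ) * ∫ x, (θ x * Real.exp (-σ * x)) • s x := by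
      rw [← integral_const_mul]
      refine integral_congr_ae ?_
      filter_upwards [Lp.coeFn_smul (σ : ℂ) s] with x hx
      rw [hx]
      simp [mul_left_comm]
    rw [e1, e2] at h1
    have h3 : ∫ x, (deriv θ x * Real.exp (-σ * x)) • s x = 0 := by linear_combination h1
    rw [← h3]
    refine integral_congr_ae (Eventually.of_forall fun x => ?_)
    simp only [smul_smul])
  have hs : ∀ᵐ x ∂(volume : Measure ℝ), s x = c * (Real.exp (σ * x) : ℂ) := by
    filter_upwards [hc] with x hx
    rw [← hx, Complex.real_smul, mul_right_comm, ← Complex.ofReal_mul, ← Real.exp_add]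
    simp
  have hc0 : c = 0 := by
    by_contra hcne
    have h1 : Integrable (fun x => ‖s x‖ ^ 2) := by
      have := (Lp.memLp s).integrable_norm_pow (by norm_num)
      simpa using this
    -- A half-line of infinite measure on which exp(σx) ≥ 1; square integrability there forces c =
    -- 0.
    have hS : ∃ S : Set ℝ, MeasurableSet S ∧ volume S = ⊤ ∧ ∀ x ∈ S, 0 ≤ σ * x := by
      rcases hσ with rfl | rfl
      · exact ⟨Ioi 0, measurableSet_Ioi, Real.volume_Ioi, fun x hx => by
          rw [one_mul]; exact (mem_Ioi.mp hx).le⟩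
      · exact ⟨Iio 0, measurableSet_Iio, Real.volume_Iio, fun x hx => by
          have := mem_Iio.mp hx; linarith⟩
    obtain ⟨S, hSm, hSv, hS⟩ := hS
    have h2 : IntegrableOn (fun _ => ‖c‖ ^ 2) S (volume : Measure ℝ) := by
      refine Integrable.mono' h1.integrableOn (by fun_prop) ?_
      rw [ae_restrict_iff' hSm]
      filter_upwards [hs] with x hx hxS
      rw [hx, norm_mul, Complex.norm_real, Real.norm_eq_abs, Real.norm_eq_abs, mul_pow,
        abs_of_nonneg (by positivity)]
      refine le_mul_of_one_le_right (by positivity) ?_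
      rw [sq_abs]
      exact one_le_pow₀ (Real.one_le_exp (hS x hxS))
    rw [integrableOn_const_iff] at h2
    rcases h2 with h2 | h2
    · simp at h2; exact hcne h2
    · rw [hSv] at h2; exact lt_irrefl _ h2
  rw [Lp.eq_zero_iff_ae_eq_zero]
  filter_upwards [hs] with x hx
  rw [hx, hc0]; simp

/-- Test functions are dense in `H¹`. -/
theorem weakGraph_le_closure :
    weakGraph ≤ (Submodule.span ℂ testPairs).topologicalClosure := by
  set K := (Submodule.span ℂ testPairs).topologicalClosure with hK
  have hKle : K ≤ weakGraph :=
    Submodule.topologicalClosure_minimal _ (Submodule.span_le.mpr testPairs_subset)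
      isClosed_weakGraph
  have : CompleteSpace K := (Submodule.isClosed_topologicalClosure _).completeSpace_coe
  intro p hp
  obtain ⟨y, hy, z, hz, rfl⟩ := K.exists_add_mem_mem_orthogonal p
  have hzw : HasWeakDeriv z.fst z.snd := by
    have := weakGraph.sub_mem hp (hKle hy)
    rwa [add_sub_cancel_left] at this
  -- Orthogonality to all pairs (θ, θ') says that the weak derivative of z.snd is z.fst. So both
  -- components are each other's derivative, and their sum and difference solve u' = u and u' = -u.
  have hzr : HasWeakDeriv z.snd z.fst := by
    rw [hasWeakDeriv_iff]
    intro θ hθ hc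
    have h1 := Submodule.inner_right_of_mem_orthogonal
      (Submodule.le_topologicalClosure _ (Submodule.subset_span
        (show WithLp.toLp 2 (_, _) ∈ testPairs from ⟨θ, hθ, hc, rfl⟩))) hz
    rw [WithLp.prod_inner_apply] at h1
    exact eq_neg_of_add_eq_zero_right h1
  have hsum : z.fst + z.snd = 0 := by
    refine eq_zero_of_hasWeakDeriv_smul (σ := 1) (Or.inl rfl) ?_
    rw [Complex.ofReal_one, one_smul]
    have := hzw.add hzr
    rwa [add_comm z.snd] at this
  have hdif : z.fst - z.snd = 0 := by
    refine eq_zero_of_hasWeakDeriv_smul (σ := -1) (Or.inr rfl) ?_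
    have h2 := hzw.add (hzr.smul (-1))
    have e1 : z.fst + (-1 : ℂ) • z.snd = z.fst - z.snd := by rw [neg_one_smul, sub_eq_add_neg]
    have e2 : z.snd + (-1 : ℂ) • z.fst = ((-1 : ℝ) : ℂ) • (z.fst - z.snd) := by
      push_cast
      rw [smul_sub, neg_one_smul, neg_one_smul]; abel
    rwa [e1, e2] at h2
  have hz1 : z.fst = 0 := by
    have : (2 : ℂ) • z.fst = 0 := by
      rw [two_smul]
      calc z.fst + z.fst = (z.fst + z.snd) + (z.fst - z.snd) := by abel
        _ = 0 := by rw [hsum, hdif, add_zero]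
    exact (smul_eq_zero.mp this).resolve_left two_ne_zero
  have hz2 : z.snd = 0 := by rw [hz1, zero_add] at hsum; exact hsum
  have hz0 : z = 0 := by
    rw [← norm_eq_zero, ← sq_eq_zero_iff, WithLp.prod_norm_sq_eq_of_L2, hz1, hz2]
    simp
  rw [hz0, add_zero]
  exact hy

/-- Integration by parts in `H¹`. -/
theorem HasWeakDeriv.inner_eq {w g v k : L2} (h : HasWeakDeriv w g) (h' : HasWeakDeriv v k) :
    ⟪g, v⟫_ℂ = -⟪w, k⟫_ℂ := by
  have hmem : WithLp.toLp 2 (v, k) ∈ (Submodule.span ℂ testPairs).topologicalClosure :=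
    weakGraph_le_closure h'
  have hclosed : IsClosed {p : WithLp 2 (L2 × L2) | ⟪g, p.fst⟫_ℂ = -⟪w, p.snd⟫_ℂ} :=
    isClosed_eq (continuous_const.inner continuous_fst_withLp)
      (continuous_const.inner continuous_snd_withLp).neg
  have hsub : (Submodule.span ℂ testPairs : Set (WithLp 2 (L2 × L2))) ⊆
      {p | ⟪g, p.fst⟫_ℂ = -⟪w, p.snd⟫_ℂ} := by
    intro p hp
    induction hp using Submodule.span_induction with
    | mem p hp =>
      obtain ⟨θ, hθ, hc, rfl⟩ := hp
      have h1 := congrArg conj (hasWeakDeriv_iff.mp h θ hθ hc)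
      rw [map_neg, inner_conj_symm, inner_conj_symm] at h1
      exact neg_eq_iff_eq_neg.mp h1.symm
    | zero => simp
    | add p q _ _ hp hq =>
      simp only [mem_ofPred_eq, WithLp.add_fst, WithLp.add_snd, inner_add_right] at hp hq ⊢
      rw [hp, hq, neg_add]
    | smul a p _ hp =>
      simp only [mem_ofPred_eq, WithLp.smul_fst, WithLp.smul_snd, inner_smul_right] at hp ⊢
      rw [hp, mul_neg]
  exact closure_minimal hsub hclosed hmem

/-- Surjectivity of `1 - ∂²` from `H²` to `L²`. -/
theorem exists_free_resolvent (f : L2) :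
    ∃ y g h : L2, HasWeakDeriv y g ∧ HasWeakDeriv g h ∧ y - h = f := by
  -- The orthogonal projection of (f, 0) onto the graph of the derivative is the variational
  -- solution; orthogonality of the remainder to test pairs is the weak equation.
  obtain ⟨y, hy, z, hz, hyz⟩ := weakGraph.exists_add_mem_mem_orthogonal (WithLp.toLp 2 (f, (0 : L2)))
  have h1 : f = y.fst + z.fst := congrArg (fun p : WithLp 2 (L2 × L2) => p.fst) hyz
  have h2 : 0 = y.snd + z.snd := congrArg (fun p : WithLp 2 (L2 × L2) => p.snd) hyz
  refine ⟨y.fst, y.snd, y.fst - f, hy, ?_, by abel⟩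
  rw [hasWeakDeriv_iff]
  intro θ hθ hc
  have h3 := Submodule.inner_right_of_mem_orthogonal
    (testPairs_subset (show WithLp.toLp 2 (_, _) ∈ testPairs from ⟨θ, hθ, hc, rfl⟩)) hz
  rw [WithLp.prod_inner_apply] at h3
  have e1 : y.fst - f = -z.fst := by rw [h1]; abel
  have e2 : y.snd = -z.snd := eq_neg_of_add_eq_zero_left h2.symm
  rw [e1, e2, inner_neg_right, inner_neg_right, neg_neg]
  exact neg_eq_of_add_eq_zero_left h3

end Weak

/-! ### Continuous and continuously differentiable representatives; evaluation at the origin. -/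

section Representative

open scoped InnerProductSpace

theorem L2_intervalIntegrable (g : L2) (a b : ℝ) : IntervalIntegrable g volume a b :=
  intervalIntegrable_iff.mpr (((Lp.memLp g).locallyIntegrable (by norm_num)).integrableOn_isCompact
    isCompact_uIcc |>.mono_set uIoc_subset_uIcc)

theorem continuous_L2_integral (a b : ℝ) : Continuous fun g : L2 => ∫ x in a..b, g x := by
  have key : ∀ a b : ℝ, a ≤ b → Continuous fun g : L2 => ∫ x in a..b, g x := by
    intro a b hab
    have : (fun g : L2 => ∫ x in a..b, g x)
        = fun g : L2 => ⟪indicatorConstLp 2 (measurableSet_Ioc (a := a) (b := b))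
          (by simp) (1 : ℂ), g⟫_ℂ := by
      ext g
      rw [L2.inner_indicatorConstLp_one, intervalIntegral.integral_of_le hab]
    rw [this]
    exact continuous_const.inner continuous_id
  rcases le_total a b with h | h
  · exact key a b h
  · simp_rw [intervalIntegral.integral_symm b a]
    exact (key b a h).neg

/-- True on the span of test pairs by the fundamental theorem of calculus, and stable under limits:
integrals over bounded intervals are continuous on L², and a subsequence of the functions converges
almost everywhere. -/
theorem HasWeakDeriv.exists_primitive {w g : L2} (h : HasWeakDeriv w g) :
    ∃ c : ℂ, ∀ᵐ x ∂(volume : Measure ℝ), w x = c + ∫ t in (0 : ℝ)..x, g t := by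
  have hspan : ∀ p ∈ Submodule.span ℂ testPairs,
      ∃ c : ℂ, ∀ᵐ x ∂(volume : Measure ℝ), p.fst x = c + ∫ t in (0 : ℝ)..x, p.snd t := by
    intro p hp
    induction hp using Submodule.span_induction with
    | mem p hp =>
      obtain ⟨θ, hθ, hc, rfl⟩ := hp
      refine ⟨(θ 0 : ℂ), ?_⟩
      have h1 := (memLp_ofReal_of_hasCompactSupport hθ.continuous hc).coeFn_toLp
      have h2 := (memLp_ofReal_of_hasCompactSupport (hθ.continuous_deriv (by simp))
        hc.deriv).coeFn_toLp
      filter_upwards [h1] with x hx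
      change (memLp_ofReal_of_hasCompactSupport hθ.continuous hc).toLp _ x = _ + ∫ t in (0 : ℝ)..x,
        (memLp_ofReal_of_hasCompactSupport (hθ.continuous_deriv (by simp)) hc.deriv).toLp _ t
      rw [hx, intervalIntegral.integral_congr_ae (g := fun t => ((deriv θ t : ℝ) : ℂ))
        (h2.mono fun t ht _ => ht), intervalIntegral.integral_ofReal,
        intervalIntegral.integral_deriv_eq_sub
          (fun t _ => (hθ.differentiable (by simp)) t)
          ((hθ.continuous_deriv (by simp)).intervalIntegrable _ _)]
      push_cast
      ring
    | zero =>
      refine ⟨0, ?_⟩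
      filter_upwards [Lp.coeFn_zero ℂ 2 (volume : Measure ℝ)] with x hx
      rw [WithLp.zero_fst, WithLp.zero_snd, intervalIntegral.integral_congr_ae (g := fun t => (0 : ℂ))
        ((Lp.coeFn_zero ℂ 2 (volume : Measure ℝ)).mono fun t ht _ => ht)]
      simp
    | add p q _ _ hp hq =>
      obtain ⟨c, hc⟩ := hp
      obtain ⟨d, hd⟩ := hq
      refine ⟨c + d, ?_⟩
      filter_upwards [hc, hd, Lp.coeFn_add p.fst q.fst] with x h1 h2 h3
      rw [WithLp.add_fst, WithLp.add_snd, h3, intervalIntegral.integral_congr_ae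
        (g := fun t => p.snd t + q.snd t)
        ((Lp.coeFn_add p.snd q.snd).mono fun t ht _ => ht),
        intervalIntegral.integral_add (L2_intervalIntegrable _ _ _) (L2_intervalIntegrable _ _ _),
        Pi.add_apply, h1, h2]
      ring
    | smul a p _ hp =>
      obtain ⟨c, hc⟩ := hp
      refine ⟨a * c, ?_⟩
      filter_upwards [hc, Lp.coeFn_smul a p.fst] with x h1 h3
      rw [WithLp.smul_fst, WithLp.smul_snd, h3, intervalIntegral.integral_congr_ae
        (g := fun t => a * p.snd t)
        ((Lp.coeFn_smul a p.snd).mono fun t ht _ => ht),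
        intervalIntegral.integral_const_mul, Pi.smul_apply, h1, smul_eq_mul]
      ring
  have hmem : WithLp.toLp 2 (w, g) ∈ closure (Submodule.span ℂ testPairs : Set _) :=
    weakGraph_le_closure h
  obtain ⟨p, hp, hlim⟩ := mem_closure_iff_seq_limit.mp hmem
  have h1 : Tendsto (fun n => (p n).fst) atTop (𝓝 w) :=
    (continuous_fst_withLp.tendsto _).comp hlim
  have h2 : Tendsto (fun n => (p n).snd) atTop (𝓝 g) :=
    (continuous_snd_withLp.tendsto _).comp hlim
  choose c hc using fun n => hspan (p n) (hp n)
  obtain ⟨ns, hns, hae⟩ := (tendstoInMeasure_of_tendsto_Lp h1).exists_seq_tendsto_ae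
  -- The constants do not depend on x, so their limit at a single good point x₀ serves almost every
  -- x.
  have key : ∀ᵐ x ∂(volume : Measure ℝ),
      Tendsto (fun n => c (ns n)) atTop (𝓝 (w x - ∫ t in (0 : ℝ)..x, g t)) := by
    filter_upwards [hae, ae_all_iff.mpr hc] with x hx hcx
    have h3 : Tendsto (fun n => ∫ t in (0 : ℝ)..x, (p (ns n)).snd t) atTop
        (𝓝 (∫ t in (0 : ℝ)..x, g t)) :=
      ((continuous_L2_integral 0 x).tendsto g).comp (h2.comp hns.tendsto_atTop)
    refine (hx.sub h3).congr fun n => ?_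
    rw [hcx]; ring
  obtain ⟨x₀, hx₀⟩ := key.exists
  refine ⟨w x₀ - ∫ t in (0 : ℝ)..x₀, g t, ?_⟩
  filter_upwards [key] with x hx
  rw [tendsto_nhds_unique hx₀ hx]; ring

/-- `u` is a continuously differentiable representative of `w`, with derivative `u'`. -/
structure IsC1Rep (w g : L2) (u u' : ℝ → ℂ) : Prop where
  hasDerivAt : ∀ x, HasDerivAt u (u' x) x
  continuous : Continuous u'
  ae_eq : u =ᵐ[volume] w
  ae_eq' : u' =ᵐ[volume] g

theorem IsC1Rep.continuous' {w g : L2} {u u' : ℝ → ℂ} (h : IsC1Rep w g u u') : Continuous u :=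
  continuous_iff_continuousAt.mpr fun x => (h.hasDerivAt x).continuousAt

theorem exists_isC1Rep {w g h : L2} (h₁ : HasWeakDeriv w g) (h₂ : HasWeakDeriv g h) :
    ∃ u u' : ℝ → ℂ, IsC1Rep w g u u' := by
  obtain ⟨c, hc⟩ := h₁.exists_primitive
  obtain ⟨d, hd⟩ := h₂.exists_primitive
  have hcont : Continuous fun x => d + ∫ t in (0 : ℝ)..x, h t :=
    continuous_const.add (intervalIntegral.continuous_primitive (L2_intervalIntegrable h) 0)
  refine ⟨fun x => c + ∫ s in (0 : ℝ)..x, (d + ∫ t in (0 : ℝ)..s, h t),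
    fun x => d + ∫ t in (0 : ℝ)..x, h t, fun x => ?_, hcont, ?_, ?_⟩
  · exact ((hcont.integral_hasStrictDerivAt 0 x).hasDerivAt).const_add c
  · filter_upwards [hc] with x hx
    rw [hx, intervalIntegral.integral_congr_ae (hd.mono fun t ht _ => ht)]
  · filter_upwards [hd] with x hx
    rw [hx]

theorem H2_exists_rep {w : L2} (hw : w ∈ H2) :
    ∃ u : ℝ → ℂ, Continuous u ∧ u =ᵐ[volume] w := by
  obtain ⟨g, h, h₁, h₂⟩ := hw
  obtain ⟨u, u', hu⟩ := exists_isC1Rep h₁ h₂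
  exact ⟨u, hu.continuous', hu.ae_eq⟩

theorem eq_of_continuous_rep {w : L2} {u v : ℝ → ℂ} (hu : Continuous u) (hv : Continuous v)
    (h : u =ᵐ[volume] w) (h' : v =ᵐ[volume] w) : u = v :=
  (Continuous.ae_eq_iff_eq volume hu hv).mp (h.trans h'.symm)

/-- Evaluation at the origin of the continuous representative. -/
noncomputable def evalZero : H2 →ₗ[ℂ] ℂ where
  toFun w := (H2_exists_rep w.2).choose 0
  map_add' w v := by
    have hw := (H2_exists_rep w.2).choose_spec
    have hv := (H2_exists_rep v.2).choose_spec
    have hs := (H2_exists_rep (w + v).2).choose_spec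
    refine congrFun (eq_of_continuous_rep hs.1 (hw.1.add hv.1) hs.2 ?_) 0
    filter_upwards [hw.2, hv.2, Lp.coeFn_add (w : L2) (v : L2)] with x h1 h2 h3
    rw [Submodule.coe_add, h3, Pi.add_apply, Pi.add_apply, h1, h2]
  map_smul' a w := by
    have hw := (H2_exists_rep w.2).choose_spec
    have hs := (H2_exists_rep (a • w).2).choose_spec
    refine congrFun (eq_of_continuous_rep hs.1 (hw.1.const_smul a) hs.2 ?_) 0
    filter_upwards [hw.2, Lp.coeFn_smul a (w : L2)] with x h1 h3
    rw [Submodule.coe_smul, h3, Pi.smul_apply, Pi.smul_apply, h1]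

theorem evalZero_eq {w : H2} {u : ℝ → ℂ} (hu : Continuous u) (h : u =ᵐ[volume] (w : L2)) :
    evalZero w = u 0 :=
  congrFun (eq_of_continuous_rep (H2_exists_rep w.2).choose_spec.1 hu
    (H2_exists_rep w.2).choose_spec.2 h) 0

end Representative

/-! ### The Schrödinger operator: symmetry, self-adjointness, quadratic form. -/

section Operator

open scoped InnerProductSpace

theorem exists_mul_L2 {V : ℝ → ℝ} (hV : Continuous V) {C : ℝ} (hC : ∀ x, |V x| ≤ C) (w : L2) :
    ∃ m : L2, ∀ᵐ x ∂(volume : Measure ℝ), m x = (V x : ℂ) * w x := by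
  have hm : MemLp (fun x => (V x : ℂ) * w x) 2 volume := by
    refine MemLp.of_le_mul (c := C) (Lp.memLp w) ?_ ?_
    · exact (Complex.continuous_ofReal.comp hV).aestronglyMeasurable.mul
        (Lp.memLp w).aestronglyMeasurable
    · refine Eventually.of_forall fun x => ?_
      rw [norm_mul, Complex.norm_real, Real.norm_eq_abs]
      exact mul_le_mul_of_nonneg_right (hC x) (norm_nonneg _)
  exact ⟨hm.toLp, hm.coeFn_toLp⟩

theorem inner_mul_L2 {V : ℝ → ℝ} {u v m n : L2}
    (hm : ∀ᵐ x ∂(volume : Measure ℝ), m x = (V x : ℂ) * u x)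
    (hn : ∀ᵐ x ∂(volume : Measure ℝ), n x = (V x : ℂ) * v x) : ⟪m, v⟫_ℂ = ⟪u, n⟫_ℂ := by
  rw [L2.inner_def, L2.inner_def]
  refine integral_congr_ae ?_
  filter_upwards [hm, hn] with x h1 h2
  rw [RCLike.inner_apply, RCLike.inner_apply, h1, h2, map_mul, Complex.conj_ofReal]
  ring

theorem HasWeakDeriv.inner_second {w g h v k l : L2} (h₁ : HasWeakDeriv w g)
    (h₂ : HasWeakDeriv g h) (h₃ : HasWeakDeriv v k) (h₄ : HasWeakDeriv k l) :
    ⟪h, v⟫_ℂ = ⟪w, l⟫_ℂ := by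
  rw [h₂.inner_eq h₃, h₁.inner_eq h₄, neg_neg]

/-- The content of membership in the domain of the Schrödinger operator. -/
theorem schrodinger_spec {V : ℝ → ℝ} (w : (schrodinger V).domain) :
    ∃ g h m : L2, HasWeakDeriv w g ∧ HasWeakDeriv g h ∧
      (∀ᵐ x ∂(volume : Measure ℝ), m x = (V x : ℂ) * (w : L2) x) ∧
      schrodinger V w = -(1 / 2 : ℂ) • h + m := by
  have hmem := (schrodinger V).mem_graph w
  rw [schrodinger_graph] at hmem
  obtain ⟨g, h, h₁, h₂, h₃⟩ := hmem
  refine ⟨g, h, schrodinger V w - (-(1 / 2 : ℂ) • h), h₁, h₂, ?_, by abel⟩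
  filter_upwards [h₃, Lp.coeFn_sub (schrodinger V w) (-(1 / 2 : ℂ) • h),
    Lp.coeFn_smul (-(1 / 2 : ℂ)) h] with x e₁ e₂ e₃
  rw [e₂, Pi.sub_apply, e₃, Pi.smul_apply, smul_eq_mul, e₁]
  ring

theorem schrodinger_of_graph {V : ℝ → ℝ} {w g h k : L2} (h₁ : HasWeakDeriv w g)
    (h₂ : HasWeakDeriv g h)
    (h₃ : ∀ᵐ x ∂(volume : Measure ℝ), k x = -(1 / 2 : ℂ) * h x + (V x : ℂ) * w x) :
    ∃ hw : w ∈ (schrodinger V).domain, schrodinger V ⟨w, hw⟩ = k := by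
  have hmem : (w, k) ∈ (schrodinger V).graph := by
    rw [schrodinger_graph]; exact ⟨g, h, h₁, h₂, h₃⟩
  obtain ⟨y, hy, hk⟩ := (schrodinger V).mem_graph_iff.mp hmem
  simp only at hy hk
  subst hy
  exact ⟨y.2, hk⟩

theorem schrodinger_isSymm (V : ℝ → ℝ) : IsSymm (schrodinger V) := by
  intro u v
  obtain ⟨g, h, m, h₁, h₂, hm, hu⟩ := schrodinger_spec u
  obtain ⟨k, l, n, h₃, h₄, hn, hv⟩ := schrodinger_spec v
  rw [hu, hv, inner_add_left, inner_add_right, inner_smul_left, inner_smul_right,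
    inner_mul_L2 hm hn, h₁.inner_second h₂ h₃ h₄]
  simp [Complex.conj_ofNat]

/-- Adding the bounded multiplication by ½ - V turns the operator into ½(1 - ∂²), which maps H² onto
L². So the H² solution y of ½(1 - ∂²)y = k + (½ - V)u exists, and testing against arbitrary images
shows u = y. -/
theorem schrodinger_adjointLE {V : ℝ → ℝ} (hV : Continuous V) {C : ℝ} (hC : ∀ x, |V x| ≤ C) :
    AdjointLE (schrodinger V) := by
  intro u k huk
  have hV' : Continuous fun x => 1 / 2 - V x := continuous_const.sub hV
  have hC' : ∀ x, |1 / 2 - V x| ≤ 1 / 2 + C := fun x => by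
    refine (abs_sub _ _).trans ?_
    rw [abs_of_pos (by norm_num : (0 : ℝ) < 1 / 2)]
    linarith [hC x]
  obtain ⟨m, hm⟩ := exists_mul_L2 hV' hC' u
  obtain ⟨y, g, h, hy, hg, hyh⟩ := exists_free_resolvent ((2 : ℂ) • (k + m))
  have huy : u = y := by
    rw [← sub_eq_zero]
    refine ext_inner_right ℂ fun f => ?_
    obtain ⟨θ, g', h', hθ, hg', hθh⟩ := exists_free_resolvent ((2 : ℂ) • f)
    obtain ⟨n, hn⟩ := exists_mul_L2 hV' hC' θ
    have hf : ∀ᵐ x ∂(volume : Measure ℝ),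
        (f - n) x = -(1 / 2 : ℂ) * h' x + (V x : ℂ) * θ x := by
      have e0 : f = (1 / 2 : ℂ) • (θ - h') := by rw [hθh, smul_smul]; norm_num
      filter_upwards [Lp.coeFn_sub f n, hn, Lp.coeFn_sub θ h',
        Lp.coeFn_smul (1 / 2 : ℂ) (θ - h')] with x e₁ e₂ e₃ e₄
      rw [e₁, Pi.sub_apply, e₂, e0, e₄, Pi.smul_apply, e₃, Pi.sub_apply, smul_eq_mul]
      push_cast
      ring
    obtain ⟨hθd, hAθ⟩ := schrodinger_of_graph hθ hg' hf
    have h1 := huk ⟨θ, hθd⟩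
    rw [hAθ, inner_sub_right, ← inner_mul_L2 hm hn] at h1
    have h2 : ⟪y, f⟫_ℂ = ⟪k + m, θ⟫_ℂ := by
      have e1 : ⟪y, (2 : ℂ) • f⟫_ℂ = ⟪(2 : ℂ) • (k + m), θ⟫_ℂ := by
        rw [← hθh, ← hyh, inner_sub_left, inner_sub_right, hy.inner_second hg hθ hg']
      rw [inner_smul_left, inner_smul_right, Complex.conj_ofNat] at e1
      exact mul_left_cancel₀ two_ne_zero e1
    rw [inner_sub_left, h2, inner_zero_left, inner_add_left]
    simp only at h1
    linear_combination h1
  subst huy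
  refine schrodinger_of_graph hy hg ?_
  have e0 : k = (1 / 2 : ℂ) • (u - h) - m := by
    rw [hyh, smul_smul]; norm_num
  filter_upwards [hm, Lp.coeFn_sub ((1 / 2 : ℂ) • (u - h)) m, Lp.coeFn_sub u h,
    Lp.coeFn_smul (1 / 2 : ℂ) (u - h)] with x e₁ e₂ e₃ e₄
  rw [e0, e₂, Pi.sub_apply, e₄, Pi.smul_apply, e₃, e₁, Pi.sub_apply, smul_eq_mul]
  push_cast
  ring

/-- The quadratic form of a Schrödinger operator. -/
theorem schrodinger_form {V : ℝ → ℝ} (hV : Continuous V) {C : ℝ} (hC : ∀ x, |V x| ≤ C)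
    (w : (schrodinger V).domain) {u u' : ℝ → ℂ}
    (hu : ∀ g h : L2, HasWeakDeriv w g → HasWeakDeriv g h → IsC1Rep w g u u') :
    Integrable (fun x => ‖u' x‖ ^ 2 / 2 + V x * ‖u x‖ ^ 2) ∧
    Integrable (fun x => ‖u x‖ ^ 2) ∧ Integrable (fun x => ‖u' x‖ ^ 2) ∧
    (⟪(w : L2), schrodinger V w⟫_ℂ).re = ∫ x, (‖u' x‖ ^ 2 / 2 + V x * ‖u x‖ ^ 2) ∧
    ‖(w : L2)‖ ^ 2 = ∫ x, ‖u x‖ ^ 2 := by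
  obtain ⟨g, h, m, h₁, h₂, hm, hw⟩ := schrodinger_spec w
  have hr := hu g h h₁ h₂
  have hsq : ∀ f : L2, Integrable (fun x => ‖f x‖ ^ 2) := fun f => by
    have := (Lp.memLp f).integrable_norm_pow (by norm_num)
    simpa using this
  have hnorm : ∀ f : L2, ‖f‖ ^ 2 = ∫ x, ‖f x‖ ^ 2 := fun f => by
    have h1 : ⟪f, f⟫_ℂ = ((∫ x, ‖f x‖ ^ 2 : ℝ) : ℂ) := by
      rw [L2.inner_def, ← integral_complex_ofReal]
      refine integral_congr_ae (Eventually.of_forall fun x => ?_)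
      simp only [inner_self_eq_norm_sq_to_K]
      push_cast; rfl
    rw [inner_self_eq_norm_sq_to_K] at h1
    refine Complex.ofReal_injective ?_
    rw [← h1, Complex.ofReal_pow]
    rfl
  have i1 : Integrable (fun x => ‖u x‖ ^ 2) :=
    (hsq w).congr (hr.ae_eq.mono fun x hx => by simp only [hx])
  have i2 : Integrable (fun x => ‖u' x‖ ^ 2) :=
    (hsq g).congr (hr.ae_eq'.mono fun x hx => by simp only [hx])
  have i3 : Integrable (fun x => V x * ‖u x‖ ^ 2) :=
    i1.bdd_mul (c := C) hV.aestronglyMeasurable (Eventually.of_forall fun x => hC x)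
  have n1 : ‖(w : L2)‖ ^ 2 = ∫ x, ‖u x‖ ^ 2 := by
    rw [hnorm]; exact integral_congr_ae (hr.ae_eq.mono fun x hx => by simp only [hx])
  have n2 : ‖g‖ ^ 2 = ∫ x, ‖u' x‖ ^ 2 := by
    rw [hnorm]; exact integral_congr_ae (hr.ae_eq'.mono fun x hx => by simp only [hx])
  refine ⟨(i2.div_const 2).add i3, i1, i2, ?_, n1⟩
  have e1 : ⟪(w : L2), h⟫_ℂ = -((‖g‖ ^ 2 : ℝ) : ℂ) := by
    have := h₁.inner_eq h₂
    rw [inner_self_eq_norm_sq_to_K] at this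
    push_cast
    rw [eq_comm, neg_eq_iff_eq_neg]
    exact this
  have e2 : ⟪(w : L2), m⟫_ℂ = ((∫ x, V x * ‖u x‖ ^ 2 : ℝ) : ℂ) := by
    rw [L2.inner_def, ← integral_complex_ofReal]
    refine integral_congr_ae ?_
    filter_upwards [hm, hr.ae_eq] with x hx hx'
    rw [RCLike.inner_apply, hx, ← hx', mul_assoc, Complex.mul_conj']
    push_cast; rfl
  rw [hw, inner_add_right, inner_smul_right, e1, e2, integral_add (i2.div_const 2) i3,
    integral_div, ← n2]
  have : (-(1 / 2 : ℂ)) * -((‖g‖ ^ 2 : ℝ) : ℂ) + ((∫ x, V x * ‖u x‖ ^ 2 : ℝ) : ℂ)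
      = ((‖g‖ ^ 2 / 2 + ∫ x, V x * ‖u x‖ ^ 2 : ℝ) : ℂ) := by push_cast; ring
  rw [this, Complex.ofReal_re]

theorem schrodinger_exists_rep {V : ℝ → ℝ} (w : (schrodinger V).domain) :
    ∃ u u' : ℝ → ℂ, ∀ g h : L2, HasWeakDeriv w g → HasWeakDeriv g h → IsC1Rep w g u u' := by
  obtain ⟨g, h, m, h₁, h₂, hm, hw⟩ := schrodinger_spec w
  obtain ⟨u, u', hu⟩ := exists_isC1Rep h₁ h₂
  refine ⟨u, u', fun g' h' h₃ _ => ?_⟩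
  have : g' = g := by
    have h4 := h₃.add (h₁.smul (-1))
    rw [neg_one_smul, neg_one_smul, add_neg_cancel, ← sub_eq_add_neg] at h4
    exact sub_eq_zero.mp h4.eq_zero
  rw [this]; exact hu

theorem schrodinger_bddBelow {V : ℝ → ℝ} (hV : Continuous V) {C : ℝ} (hC : ∀ x, |V x| ≤ C)
    (w : (schrodinger V).domain) :
    -C * ‖(w : L2)‖ ^ 2 ≤ (⟪(w : L2), schrodinger V w⟫_ℂ).re := by
  obtain ⟨u, u', hu⟩ := schrodinger_exists_rep w
  obtain ⟨h1, h2, -, h3, h4⟩ := schrodinger_form hV hC w hu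
  rw [h3, h4, ← integral_const_mul]
  refine integral_mono (h2.const_mul _) h1 fun x => ?_
  have := (abs_le.mp (hC x)).1
  simp only
  nlinarith [sq_nonneg ‖u x‖, sq_nonneg ‖u' x‖]

end Operator

/-! ### Preliminaries from real analysis -/

theorem hasDerivAt_of_contDiff_two {f : ℝ → ℝ} (hf : ContDiff ℝ 2 f) :
    (∀ x, HasDerivAt f (deriv f x) x) ∧ (∀ x, HasDerivAt (deriv f) (deriv (deriv f) x) x) ∧
      Continuous (deriv (deriv f)) := by
  have h2 : ContDiff ℝ (1 + 1) f := by
    rw [one_add_one_eq_two]; exact hf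
  have h1 := (contDiff_succ_iff_deriv.mp h2).2.2
  refine ⟨fun x => (hf.differentiable (by norm_num) x).hasDerivAt,
    fun x => (h1.differentiable (by norm_num) x).hasDerivAt, ?_⟩
  exact h1.continuous_deriv le_rfl

/-- A `C²` function on `[0, ∞)` extends to a `C²` function on `ℝ`. -/
theorem exists_contDiff_two_extension {f : ℝ → ℝ} (hf : ContDiffOn ℝ 2 f (Ici 0)) :
    ∃ g : ℝ → ℝ, ContDiff ℝ 2 g ∧ ∀ x, 0 ≤ x → g x = f x := by
  have hu : UniqueDiffOn ℝ (Ici (0 : ℝ)) := uniqueDiffOn_Ici 0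
  have h2 : ContDiffOn ℝ (1 + 1) f (Ici 0) := by
    rw [one_add_one_eq_two]; exact hf
  have h1 := ((contDiffOn_succ_iff_derivWithin hu).mp h2).2.2
  have h1' : ContDiffOn ℝ (0 + 1) (derivWithin f (Ici 0)) (Ici 0) := by
    rw [zero_add]; exact h1
  have h0 := ((contDiffOn_succ_iff_derivWithin hu).mp h1').2.2
  set f1 := derivWithin f (Ici 0) with hf1
  set f2 := derivWithin f1 (Ici 0) with hf2
  -- The second derivative is continued to the left by its value at 0, and the extension is
  -- recovered by integrating twice.
  have c2 : Continuous fun x => f2 (max x 0) :=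
    h0.continuousOn.comp_continuous (by fun_prop) fun x => mem_Ici.mpr (le_max_right _ _)
  let g1 : ℝ → ℝ := fun x => f1 0 + ∫ t in (0 : ℝ)..x, f2 (max t 0)
  have d1 : ∀ x, HasDerivAt g1 (f2 (max x 0)) x := fun x =>
    (intervalIntegral.integral_hasDerivAt_right (c2.intervalIntegrable _ _)
      (c2.stronglyMeasurableAtFilter _ _) c2.continuousAt).const_add _
  have c1 : Continuous g1 := continuous_iff_continuousAt.mpr fun x => (d1 x).continuousAt
  let g : ℝ → ℝ := fun x => f 0 + ∫ t in (0 : ℝ)..x, g1 t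
  have d0 : ∀ x, HasDerivAt g (g1 x) x := fun x =>
    (intervalIntegral.integral_hasDerivAt_right (c1.intervalIntegrable _ _)
      (c1.stronglyMeasurableAtFilter _ _) c1.continuousAt).const_add _
  have e1 : ∀ x, 0 ≤ x → g1 x = f1 x := by
    intro x hx
    have := intervalIntegral.integral_eq_sub_of_hasDerivAt_of_le (f := f1)
      (f' := fun t => f2 (max t 0)) hx (h1.continuousOn.mono fun t ht => ht.1) (fun t ht => by
        rw [max_eq_left ht.1.le]
        exact (h1.differentiableOn (by norm_num) t ht.1.le).hasDerivWithinAt.hasDerivAt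
          (Ici_mem_nhds ht.1)) (c2.intervalIntegrable _ _)
    simp only [g1, this]; ring
  refine ⟨g, ?_, ?_⟩
  · have hd : deriv g = g1 := funext fun x => (d0 x).deriv
    have hd1 : deriv g1 = fun x => f2 (max x 0) := funext fun x => (d1 x).deriv
    rw [← one_add_one_eq_two, contDiff_succ_iff_deriv]
    refine ⟨fun x => (d0 x).differentiableAt, by simp, ?_⟩
    rw [hd, contDiff_one_iff_deriv, hd1]
    exact ⟨fun x => (d1 x).differentiableAt, c2⟩
  · intro x hx
    have := intervalIntegral.integral_eq_sub_of_hasDerivAt_of_le (f := f)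
      (f' := g1) hx (hf.continuousOn.mono fun t ht => ht.1) (fun t ht => by
        rw [e1 t ht.1.le]
        exact (hf.differentiableOn (by norm_num) t ht.1.le).hasDerivWithinAt.hasDerivAt
          (Ici_mem_nhds ht.1)) (c1.intervalIntegrable _ _)
    simp only [g, this]; ring

/-- Uniqueness for the second order equation `y'' = N(y)`. -/
theorem eq_of_second_order_ode {N y p z r : ℝ → ℝ} (hN : ∀ x, ContDiffAt ℝ 1 N (y x))
    (hy : ∀ x, HasDerivAt y (p x) x) (hp : ∀ x, HasDerivAt p (N (y x)) x)
    (hz : ∀ x, HasDerivAt z (r x) x) (hr : ∀ x, HasDerivAt r (N (z x)) x) {x₀ : ℝ}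
    (h₀ : y x₀ = z x₀) (h₁ : p x₀ = r x₀) : y = z := by
  have cy : Continuous fun x => (y x, p x) := continuous_iff_continuousAt.mpr fun x =>
    (hy x).continuousAt.prodMk (hp x).continuousAt
  have cz : Continuous fun x => (z x, r x) := continuous_iff_continuousAt.mpr fun x =>
    (hz x).continuousAt.prodMk (hr x).continuousAt
  have hclosed : IsClosed {x | (y x, p x) = (z x, r x)} := isClosed_eq cy cz
  -- Local Lipschitz uniqueness makes the coincidence set of the phase-space curves open; being
  -- closed and non-empty, it is the whole line.
  have hopen : IsOpen {x | (y x, p x) = (z x, r x)} := by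
    rw [isOpen_iff_mem_nhds]
    intro x hx
    have hx' : (y x, p x) = (z x, r x) := hx
    let W : ℝ → ℝ × ℝ → ℝ × ℝ := fun _ a => (a.2, N a.1)
    have hW : ContDiffAt ℝ 1 (W 0) (y x, p x) :=
      contDiffAt_snd.prodMk (ContDiffAt.comp (y x, p x) (g := N) (f := Prod.fst) (hN x)
        contDiffAt_fst)
    obtain ⟨K, t, ht, hK⟩ := hW.exists_lipschitzOnWith
    have ht' : t ∈ 𝓝 (z x, r x) := by rw [← hx']; exact ht
    have := ODE_solution_unique_of_eventually (v := W) (s := fun _ => t) (K := K)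
      (f := fun x => (y x, p x)) (g := fun x => (z x, r x)) (t₀ := x)
      (Eventually.of_forall fun _ => hK)
      ((cy.continuousAt.eventually ht).mono fun s hs => ⟨(hy s).prodMk (hp s), hs⟩)
      ((cz.continuousAt.eventually ht').mono fun s hs => ⟨(hz s).prodMk (hr s), hs⟩) hx'
    exact this
  have hall := IsClopen.eq_univ ⟨hclosed, hopen⟩ ⟨x₀, by simp [h₀, h₁]⟩
  funext x
  have : x ∈ {x | (y x, p x) = (z x, r x)} := hall ▸ mem_univ x
  exact congrArg Prod.fst this

/-- A convergent function has derivative tending to zero along a sequence. -/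
theorem exists_seq_deriv_tendsto_zero {y p : ℝ → ℝ} {a : ℝ} (hy : ∀ x, HasDerivAt y (p x) x)
    (h : Tendsto y atTop (𝓝 a)) :
    ∃ ξ : ℕ → ℝ, Tendsto ξ atTop atTop ∧ Tendsto (fun n => p (ξ n)) atTop (𝓝 0) := by
  have hex : ∀ n : ℕ, ∃ ξ : ℝ, (n : ℝ) ≤ ξ ∧ p ξ = y (n + 1) - y n := by
    intro n
    obtain ⟨c, hc, h⟩ := exists_hasDerivAt_eq_slope y p (show (n : ℝ) < n + 1 by linarith)
      (continuous_iff_continuousAt.mpr fun x => (hy x).continuousAt).continuousOn fun x _ => hy x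
    exact ⟨c, hc.1.le, by rw [h]; simp⟩
  choose ξ h1 h2 using hex
  refine ⟨ξ, tendsto_atTop_mono h1 tendsto_natCast_atTop_atTop, ?_⟩
  have t0 := h.comp (tendsto_natCast_atTop_atTop (R := ℝ))
  have t1 := h.comp (tendsto_atTop_add_const_right atTop (1 : ℝ)
    (tendsto_natCast_atTop_atTop (R := ℝ)))
  have := t1.sub t0
  rw [sub_self] at this
  exact this.congr fun n => (h2 n).symm

theorem tendsto_of_abs_sub_le_exp {y : ℝ → ℝ} {a C κ : ℝ} (hκ : 0 < κ)
    (h : ∀ x, 0 ≤ x → |y x - a| ≤ C * Real.exp (-κ * |x|)) : Tendsto y atTop (𝓝 a) := by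
  rw [tendsto_iff_norm_sub_tendsto_zero]
  have h1 : Tendsto (fun x : ℝ => C * Real.exp (-κ * x)) atTop (𝓝 (C * 0)) :=
    (Real.tendsto_exp_atBot.comp
      (tendsto_id.const_mul_atTop_of_neg (by linarith : -κ < 0))).const_mul C
  rw [mul_zero] at h1
  refine squeeze_zero' (Eventually.of_forall fun x => norm_nonneg _) ?_ h1
  filter_upwards [eventually_ge_atTop 0] with x hx
  simpa [abs_of_nonneg hx] using h x hx

/-! ### The potential energy -/

section potential

variable (f : ℝ → ℝ) (q₀ : ℝ)

/-- The function `G` with `∫_{q₀}^q (f - f(q₀)) = (q - q₀)² G(q)`. -/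
noncomputable def energyQuot (q : ℝ) : ℝ :=
  ∫ t in (0 : ℝ)..1, (1 - t) * deriv f (q₀ + t * (q - q₀))

/-- The derivative of `energyQuot`. -/
noncomputable def energyQuotDeriv (q : ℝ) : ℝ :=
  ∫ t in (0 : ℝ)..1, (1 - t) * (deriv (deriv f) (q₀ + t * (q - q₀)) * t)

end potential

/-- Differentiation under the integral sign over a compact interval. -/
theorem hasDerivAt_integral_of_continuousOn {I : Set ℝ} (hI : IsOpen I) {a b : ℝ}
    {H H' : ℝ → ℝ → ℝ}
    (hH : ContinuousOn (Function.uncurry H) (I ×ˢ uIcc a b))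
    (hH' : ContinuousOn (Function.uncurry H') (I ×ˢ uIcc a b))
    (hd : ∀ v ∈ I, ∀ t ∈ uIcc a b, HasDerivAt (fun v => H v t) (H' v t) v) {v : ℝ} (hv : v ∈ I) :
    HasDerivAt (fun v => ∫ t in a..b, H v t) (∫ t in a..b, H' v t) v ∧
      ContinuousAt (fun v => ∫ t in a..b, H' v t) v := by
  obtain ⟨ε, hε, hεI⟩ := Metric.nhds_basis_closedBall.mem_iff.mp (hI.mem_nhds hv)
  have hcomp : IsCompact (Metric.closedBall v ε ×ˢ uIcc a b) :=
    (isCompact_closedBall v ε).prod isCompact_uIcc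
  obtain ⟨M, hM⟩ := hcomp.exists_bound_of_continuousOn
    (hH'.mono (prod_mono hεI Subset.rfl))
  have sec : ∀ {K : ℝ → ℝ → ℝ}, ContinuousOn (Function.uncurry K) (I ×ˢ uIcc a b) →
      ∀ w ∈ I, ContinuousOn (K w) (uIcc a b) := fun hK w hw =>
    hK.comp (f := fun t => (w, t)) (by fun_prop) fun t ht => ⟨hw, ht⟩
  have hmeas : ∀ {K : ℝ → ℝ → ℝ}, ContinuousOn (Function.uncurry K) (I ×ˢ uIcc a b) →
      ∀ w ∈ I, AEStronglyMeasurable (K w) (volume.restrict (uIoc a b)) := fun hK w hw =>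
    ((sec hK w hw).mono uIoc_subset_uIcc).aestronglyMeasurable measurableSet_uIoc
  have hball : Metric.closedBall v ε ∈ 𝓝 v := Metric.closedBall_mem_nhds v hε
  constructor
  · refine (intervalIntegral.hasDerivAt_integral_of_dominated_loc_of_deriv_le (bound := fun _ => M)
      hball ?_ (sec hH v hv).intervalIntegrable (hmeas hH' v hv) ?_ ?_ ?_).2
    · filter_upwards [hI.mem_nhds hv] with w hw using hmeas hH w hw
    · exact Eventually.of_forall fun t ht w hw => hM (w, t) ⟨hw, uIoc_subset_uIcc ht⟩
    · exact intervalIntegrable_const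
    · exact Eventually.of_forall fun t ht w hw => hd w (hεI hw) t (uIoc_subset_uIcc ht)
  · refine intervalIntegral.continuousAt_of_dominated_interval (bound := fun _ => M) ?_ ?_ ?_ ?_
    · filter_upwards [hI.mem_nhds hv] with w hw using hmeas hH' w hw
    · filter_upwards [hball] with w hw
      exact Eventually.of_forall fun t ht => hM (w, t) ⟨hw, uIoc_subset_uIcc ht⟩
    · exact intervalIntegrable_const
    · refine Eventually.of_forall fun t ht => ?_
      have : ContinuousOn (fun w => H' w t) I :=
        hH'.comp (f := fun w => (w, t)) (by fun_prop) fun w hw => ⟨hw, uIoc_subset_uIcc ht⟩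
      exact this.continuousAt (hI.mem_nhds hv)

variable {f : ℝ → ℝ} {q₀ : ℝ}

theorem hasDerivAt_energyQuot_aux (hf : ContDiff ℝ 2 f) (q : ℝ) :
    HasDerivAt (energyQuot f q₀) (energyQuotDeriv f q₀ q) q ∧
      ContinuousAt (energyQuotDeriv f q₀) q := by
  obtain ⟨h0, h1, h2⟩ := hasDerivAt_of_contDiff_two hf
  have c1 : Continuous (deriv f) := continuous_iff_continuousAt.mpr fun x => (h1 x).continuousAt
  refine hasDerivAt_integral_of_continuousOn isOpen_univ
    (H := fun q t => (1 - t) * deriv f (q₀ + t * (q - q₀)))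
    (H' := fun q t => (1 - t) * (deriv (deriv f) (q₀ + t * (q - q₀)) * t)) ?_ ?_ ?_ (mem_univ q)
  · apply Continuous.continuousOn
    have : Continuous fun p : ℝ × ℝ => (1 - p.2) * deriv f (q₀ + p.2 * (p.1 - q₀)) := by fun_prop
    exact this
  · apply Continuous.continuousOn
    have : Continuous fun p : ℝ × ℝ =>
      (1 - p.2) * (deriv (deriv f) (q₀ + p.2 * (p.1 - q₀)) * p.2) := by fun_prop
    exact this
  · intro v _ t _
    have hl : HasDerivAt (fun v => q₀ + t * (v - q₀)) t v := by
      simpa using (((hasDerivAt_id v).sub_const q₀).const_mul t).const_add q₀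
    exact ((h1 _).comp v hl).const_mul _

theorem hasDerivAt_energyQuot (hf : ContDiff ℝ 2 f) (q : ℝ) :
    HasDerivAt (energyQuot f q₀) (energyQuotDeriv f q₀ q) q :=
  (hasDerivAt_energyQuot_aux hf q).1

theorem continuous_energyQuotDeriv (hf : ContDiff ℝ 2 f) : Continuous (energyQuotDeriv f q₀) :=
  continuous_iff_continuousAt.mpr fun q => (hasDerivAt_energyQuot_aux hf q).2

theorem continuous_energyQuot (hf : ContDiff ℝ 2 f) : Continuous (energyQuot f q₀) :=
  continuous_iff_continuousAt.mpr fun q => (hasDerivAt_energyQuot hf q).continuousAt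

theorem energyQuot_self : energyQuot f q₀ q₀ = deriv f q₀ / 2 := by
  simp only [energyQuot, sub_self, mul_zero, add_zero, intervalIntegral.integral_mul_const]
  rw [intervalIntegral.integral_sub (by simp) (by simp)]
  norm_num
  ring

/-- The function t ↦ f(q₀ + td) + (1 - t)t f'(q₀ + td)d has derivative the sum of the two
integrands, and its increment over [0,1] is f(q) - f(q₀). The right-hand side is the derivative of
(q - q₀)²G(q). -/
theorem sub_eq_energyQuot (hf : ContDiff ℝ 2 f) (q : ℝ) :
    f q - f q₀ = 2 * (q - q₀) * energyQuot f q₀ q + (q - q₀) ^ 2 * energyQuotDeriv f q₀ q := by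
  obtain ⟨h0, h1, h2⟩ := hasDerivAt_of_contDiff_two hf
  have c1 : Continuous (deriv f) := continuous_iff_continuousAt.mpr fun x => (h1 x).continuousAt
  set d := q - q₀ with hd
  let g : ℝ → ℝ := fun t => f (q₀ + t * d) + (1 - t) * t * (deriv f (q₀ + t * d) * d)
  have hg : ∀ t, HasDerivAt g (2 * d * ((1 - t) * deriv f (q₀ + t * d)) +
      d ^ 2 * ((1 - t) * (deriv (deriv f) (q₀ + t * d) * t))) t := by
    intro t
    have hl : HasDerivAt (fun t => q₀ + t * d) d t := by
      simpa using ((hasDerivAt_id t).mul_const d).const_add q₀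
    have a0 := (h0 _).comp t hl
    have a1 := ((h1 _).comp t hl).mul_const d
    have a2 : HasDerivAt (fun t : ℝ => (1 - t) * t) (-1 * t + (1 - t) * 1) t :=
      ((hasDerivAt_id t).const_sub 1).mul (hasDerivAt_id t)
    refine (a0.add (a2.mul a1)).congr_deriv ?_
    simp only [Function.comp]
    ring
  have i1 : IntervalIntegrable (fun t => (1 - t) * deriv f (q₀ + t * d)) volume 0 1 :=
    Continuous.intervalIntegrable (by fun_prop) _ _
  have i2 : IntervalIntegrable (fun t => (1 - t) * (deriv (deriv f) (q₀ + t * d) * t)) volume 0 1 :=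
    Continuous.intervalIntegrable (by fun_prop) _ _
  have := intervalIntegral.integral_eq_sub_of_hasDerivAt (a := 0) (b := 1) (fun t _ => hg t)
    ((i1.const_mul _).add (i2.const_mul _))
  rw [intervalIntegral.integral_add (i1.const_mul _) (i2.const_mul _),
    intervalIntegral.integral_const_mul, intervalIntegral.integral_const_mul] at this
  simp only [g] at this
  rw [energyQuot, energyQuotDeriv, ← hd, this]
  simp [hd]

/-- The antiderivative of `f - f(q₀)`. -/
theorem hasDerivAt_energy (hf : ContDiff ℝ 2 f) (q : ℝ) :
    HasDerivAt (fun q => (q - q₀) ^ 2 * energyQuot f q₀ q) (f q - f q₀) q := by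
  have h : HasDerivAt (fun q => (q - q₀) ^ 2) (2 * (q - q₀)) q := by
    simpa using ((hasDerivAt_id q).sub_const q₀).fun_pow 2
  rw [sub_eq_energyQuot hf q]
  exact h.mul (hasDerivAt_energyQuot hf q)

/-- Away from `q₀` the function `energyQuot` is of class `C²`. -/
theorem contDiffAt_energyQuotDeriv (hf : ContDiff ℝ 2 f) {q : ℝ} (hq : q ≠ q₀) :
    ContDiffAt ℝ 1 (energyQuotDeriv f q₀) q := by
  have hG : ContDiff ℝ 1 (energyQuot f q₀) := by
    rw [contDiff_one_iff_deriv]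
    have : deriv (energyQuot f q₀) = energyQuotDeriv f q₀ :=
      funext fun q => (hasDerivAt_energyQuot hf q).deriv
    rw [this]
    exact ⟨fun q => (hasDerivAt_energyQuot hf q).differentiableAt, continuous_energyQuotDeriv hf⟩
  have hf1 : ContDiff ℝ 1 f := hf.of_le (by norm_num)
  -- Solving `sub_eq_energyQuot` for the derivative term gives a quotient of C¹ functions wherever q
  -- ≠ q₀, one order better than differentiating under the integral.
  have h : ContDiffAt ℝ 1
      (fun q => (f q - f q₀ - 2 * (q - q₀) * energyQuot f q₀ q) / (q - q₀) ^ 2) q := by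
    refine ContDiffAt.div ?_ ?_ (pow_ne_zero 2 (sub_ne_zero.mpr hq))
    · exact ContDiff.contDiffAt (by fun_prop)
    · exact ContDiff.contDiffAt (by fun_prop)
  refine h.congr_of_eventuallyEq ?_
  filter_upwards [isOpen_ne.mem_nhds hq] with x hx
  have hx' : x - q₀ ≠ 0 := sub_ne_zero.mpr hx
  rw [eq_div_iff (pow_ne_zero 2 hx'), sub_eq_energyQuot hf x]
  ring

variable {f : ℝ → ℝ} {q₀ v : ℝ}

/-! ### Dark solitons -/

theorem eq_const_of_hasDerivAt_zero {y : ℝ → ℝ} (hy : ∀ x, HasDerivAt y 0 x) (x x' : ℝ) :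
    y x = y x' :=
  is_const_of_deriv_eq_zero (fun x => (hy x).differentiableAt) (fun x => (hy x).deriv) x x'

/-- The polar form of a function and its first two derivatives. -/
theorem hasDerivAt_polar {U : ℝ → ℂ} {Φ Θ : ℝ → ℝ} (hΦ : ContDiff ℝ 2 Φ) (hΘ : ContDiff ℝ 2 Θ)
    (hU : ∀ z, U z = (Φ z : ℂ) * Complex.exp (Complex.I * (Θ z : ℂ))) :
    (∀ z, HasDerivAt U ((((deriv Φ z : ℝ) : ℂ) + Complex.I * ((Φ z * deriv Θ z : ℝ) : ℂ)) *
      Complex.exp (Complex.I * (Θ z : ℂ))) z) ∧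
    (∀ z, HasDerivAt (deriv U)
      ((((deriv (deriv Φ) z - Φ z * deriv Θ z ^ 2 : ℝ) : ℂ) + Complex.I *
        ((2 * deriv Φ z * deriv Θ z + Φ z * deriv (deriv Θ) z : ℝ) : ℂ)) *
      Complex.exp (Complex.I * (Θ z : ℂ))) z) := by
  obtain ⟨p0, p1, -⟩ := hasDerivAt_of_contDiff_two hΦ
  obtain ⟨t0, t1, -⟩ := hasDerivAt_of_contDiff_two hΘ
  have e0 : ∀ z, HasDerivAt (fun z => Complex.exp (Complex.I * (Θ z : ℂ)))
      (Complex.exp (Complex.I * (Θ z : ℂ)) * (Complex.I * ((deriv Θ z : ℝ) : ℂ))) z := fun z =>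
    ((t0 z).ofReal_comp.const_mul Complex.I).cexp
  have h1 : ∀ z, HasDerivAt U ((((deriv Φ z : ℝ) : ℂ) + Complex.I *
      ((Φ z * deriv Θ z : ℝ) : ℂ)) * Complex.exp (Complex.I * (Θ z : ℂ))) z := by
    intro z
    rw [show U = fun z => (Φ z : ℂ) * Complex.exp (Complex.I * (Θ z : ℂ)) from funext hU]
    refine ((p0 z).ofReal_comp.fun_mul (e0 z)).congr_deriv ?_
    push_cast; ring
  refine ⟨h1, fun z => ?_⟩
  rw [show deriv U = _ from funext fun z => (h1 z).deriv]
  have b : HasDerivAt (fun z => (((deriv Φ z : ℝ) : ℂ) + Complex.I *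
      ((Φ z * deriv Θ z : ℝ) : ℂ))) (((deriv (deriv Φ) z : ℝ) : ℂ) + Complex.I *
      ((deriv Φ z * deriv Θ z + Φ z * deriv (deriv Θ) z : ℝ) : ℂ)) z :=
    (p1 z).ofReal_comp.fun_add ((((p0 z).fun_mul (t1 z)).ofReal_comp).const_mul Complex.I)
  refine (b.fun_mul (e0 z)).congr_deriv ?_
  push_cast
  linear_combination (Φ z : ℂ) * ((deriv Θ z : ℝ) : ℂ) ^ 2 * Complex.exp (Complex.I * (Θ z : ℂ)) *
    Complex.I_sq

/-- The travelling wave equation in polar form. -/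
theorem polar_equations {U : ℝ → ℂ} {Φ Θ : ℝ → ℝ} (hΦ : ContDiff ℝ 2 Φ) (hΘ : ContDiff ℝ 2 Θ)
    (hU : ∀ z, U z = (Φ z : ℂ) * Complex.exp (Complex.I * (Θ z : ℂ)))
    (heq : ∀ z : ℝ, -Complex.I * (v : ℂ) * deriv U z + (1 / 2 : ℂ) * deriv (deriv U) z
      + ((f q₀ - f (‖U z‖ ^ 2) : ℝ) : ℂ) * U z = 0) (z : ℝ) :
    ‖U z‖ ^ 2 = Φ z ^ 2 ∧
    v * (Φ z * deriv Θ z) + (deriv (deriv Φ) z - Φ z * deriv Θ z ^ 2) / 2 +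
      (f q₀ - f (Φ z ^ 2)) * Φ z = 0 ∧
    -v * deriv Φ z + deriv Φ z * deriv Θ z + Φ z * deriv (deriv Θ) z / 2 = 0 := by
  obtain ⟨h1, h2⟩ := hasDerivAt_polar hΦ hΘ hU
  have hn : ‖U z‖ ^ 2 = Φ z ^ 2 := by
    rw [hU, norm_mul, mul_comm Complex.I, Complex.norm_exp_ofReal_mul_I, mul_one,
      Complex.norm_real, Real.norm_eq_abs, sq_abs]
  have h := heq z
  rw [(h1 z).deriv, (h2 z).deriv, hn, hU] at h
  have hE : Complex.exp (Complex.I * (Θ z : ℂ)) ≠ 0 := Complex.exp_ne_zero _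
  have h' : -Complex.I * (v : ℂ) * (((deriv Φ z : ℝ) : ℂ) + Complex.I * ((Φ z * deriv Θ z : ℝ) : ℂ)) +
      (1 / 2 : ℂ) * (((deriv (deriv Φ) z - Φ z * deriv Θ z ^ 2 : ℝ) : ℂ) + Complex.I *
        ((2 * deriv Φ z * deriv Θ z + Φ z * deriv (deriv Θ) z : ℝ) : ℂ)) +
      ((f q₀ - f (Φ z ^ 2) : ℝ) : ℂ) * (Φ z : ℂ) = 0 := by
    apply mul_right_cancel₀ hE
    rw [zero_mul, ← h]; ring
  have h'' : ((v * (Φ z * deriv Θ z) + (deriv (deriv Φ) z - Φ z * deriv Θ z ^ 2) / 2 +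
      (f q₀ - f (Φ z ^ 2)) * Φ z : ℝ) : ℂ) + ((-v * deriv Φ z + deriv Φ z * deriv Θ z +
        Φ z * deriv (deriv Θ) z / 2 : ℝ) : ℂ) * Complex.I = 0 := by
    rw [← h']; push_cast
    linear_combination (v : ℂ) * (Φ z : ℂ) * ((deriv Θ z : ℝ) : ℂ) * Complex.I_sq
  have hre := congrArg Complex.re h''
  have him := congrArg Complex.im h''
  refine ⟨hn, ?_, ?_⟩
  · simpa only [Complex.add_re, Complex.ofReal_re, Complex.re_ofReal_mul, Complex.I_re, mul_zero,
      add_zero, Complex.zero_re] using hre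
  · simpa only [Complex.add_im, Complex.ofReal_im, Complex.im_ofReal_mul, Complex.I_im, mul_one,
      zero_add, Complex.zero_im] using him

/-- The phase of a dark soliton is determined by its amplitude. -/
theorem deriv_phase {Φ Θ : ℝ → ℝ} (hq₀ : 0 < q₀) (hΦ : ContDiff ℝ 2 Φ) (hΘ : ContDiff ℝ 2 Θ)
    (hpos : ∀ z, 0 < Φ z) (hlim : Tendsto Φ atTop (𝓝 √q₀)) (hΘlim : Tendsto Θ atTop (𝓝 0))
    (him : ∀ z, -v * deriv Φ z + deriv Φ z * deriv Θ z + Φ z * deriv (deriv Θ) z / 2 = 0) (z : ℝ) :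
    Φ z ^ 2 * deriv Θ z = v * (Φ z ^ 2 - q₀) := by
  obtain ⟨p0, p1, -⟩ := hasDerivAt_of_contDiff_two hΦ
  obtain ⟨t0, t1, -⟩ := hasDerivAt_of_contDiff_two hΘ
  have hd : ∀ z, HasDerivAt (fun z => Φ z ^ 2 * deriv Θ z - v * Φ z ^ 2) 0 z := by
    intro z
    have hsq : HasDerivAt (fun z => Φ z ^ 2) (2 * Φ z * deriv Φ z) z := by
      simpa using (p0 z).fun_pow 2
    refine ((hsq.mul (t1 z)).sub (hsq.const_mul v)).congr_deriv ?_
    linear_combination 2 * Φ z * him z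
  -- The imaginary equation conserves Φ²(Θ' - v). Its value is read off at infinity, along a
  -- sequence on which Θ' → 0.
  set c := Φ z ^ 2 * deriv Θ z - v * Φ z ^ 2 with hc
  have hall : ∀ x, deriv Θ x = v + c / Φ x ^ 2 := by
    intro x
    have hx : Φ x ^ 2 * deriv Θ x - v * Φ x ^ 2 = c := eq_const_of_hasDerivAt_zero hd x z
    have := (hpos x).ne'
    rw [← hx]; field_simp; ring
  obtain ⟨ξ, hξ, hξ0⟩ := exists_seq_deriv_tendsto_zero t0 hΘlim
  have hs : √q₀ ^ 2 = q₀ := Real.sq_sqrt hq₀.le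
  have l1 : Tendsto (fun x => v + c / Φ x ^ 2) atTop (𝓝 (v + c / q₀)) := by
    have := (hlim.pow 2)
    rw [hs] at this
    exact (tendsto_const_nhds.div this hq₀.ne').const_add v
  have := tendsto_nhds_unique hξ0 ((l1.comp hξ).congr fun n => (hall _).symm)
  have hc' : c = -v * q₀ := by field_simp at this; linarith
  linarith [hc, hc']

/-- Reflection symmetry about a critical point, for the equation `y'' = N(y)`. -/
theorem reflection_of_ode {N y p : ℝ → ℝ} (hN : ∀ x, ContDiffAt ℝ 1 N (y x))
    (hy : ∀ x, HasDerivAt y (p x) x) (hp : ∀ x, HasDerivAt p (N (y x)) x) {a : ℝ} (ha : p a = 0)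
    (x : ℝ) : y (2 * a - x) = y x := by
  have hl : ∀ x, HasDerivAt (fun x => 2 * a - x) (-1) x := fun x => (hasDerivAt_id x).const_sub _
  have := eq_of_second_order_ode (z := fun x => y (2 * a - x)) (r := fun x => -p (2 * a - x))
    (x₀ := a) hN hy hp
    (fun x => ((hy _).comp x (hl x)).congr_deriv (by ring))
    (fun x => ((hp _).comp x (hl x)).neg.congr_deriv (by ring))
    (by ring_nf) (by ring_nf; rw [ha]; simp)
  exact (congrFun this x).symm

/-- A nonconstant solution of `y'' = N(y)` which increases to a limit has only one critical
point. -/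
theorem pos_deriv_of_ode {N y p : ℝ → ℝ} (hN : ∀ x, ContDiffAt ℝ 1 N (y x))
    (hy : ∀ x, HasDerivAt y (p x) x) (hp : ∀ x, HasDerivAt p (N (y x)) x) (h0 : p 0 = 0)
    {a : ℝ} (hlim : Tendsto y atTop (𝓝 a)) (ha : y 0 < a) {x : ℝ} (hx : 0 < x) : 0 < p x := by
  -- Reflections about the critical points 0 and b compose to a translation by 2b. A second critical
  -- point would make y periodic, against convergence to a limit above y 0.
  have hne : ∀ b, 0 < b → p b ≠ 0 := by
    intro b hb hpb
    have hper : ∀ n : ℕ, y (2 * b * n) = y 0 := by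
      intro n
      induction n with
      | zero => simp
      | succ n ih =>
        rw [← ih, ← reflection_of_ode hN hy hp hpb, ← reflection_of_ode hN hy hp h0]
        congr 1; push_cast; ring
    have ht : Tendsto (fun n : ℕ => 2 * b * (n : ℝ)) atTop atTop :=
      tendsto_natCast_atTop_atTop.const_mul_atTop (by linarith)
    have := tendsto_nhds_unique (hlim.comp ht) (tendsto_const_nhds.congr fun n => (hper n).symm)
    exact ha.ne this.symm
  have cy : Continuous y := continuous_iff_continuousAt.mpr fun x => (hy x).continuousAt
  have cp : Continuous p := continuous_iff_continuousAt.mpr fun x => (hp x).continuousAt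
  by_contra hcon
  have hneg : ∀ b, 0 < b → p b ≤ 0 := by
    intro b hb
    by_contra hb'
    have := isPreconnected_Ioi.intermediate_value (s := Ioi (0 : ℝ)) (a := x) (b := b) hx hb
      cp.continuousOn ⟨not_lt.mp hcon, (not_le.mp hb').le⟩
    obtain ⟨t, ht, ht0⟩ := this
    exact hne t ht ht0
  have hanti : AntitoneOn y (Ici 0) := by
    refine antitoneOn_of_deriv_nonpos (convex_Ici 0) cy.continuousOn
      (fun x _ => (hy x).differentiableAt.differentiableWithinAt) fun x hx => ?_
    rw [interior_Ici] at hx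
    rw [(hy x).deriv]; exact hneg x hx
  have : a ≤ y 0 := le_of_tendsto hlim (by
    filter_upwards [eventually_ge_atTop 0] with t ht using hanti self_mem_Ici ht ht)
  linarith

/-- Density `q` and slope `s` of a travelling wave with speed `v`, in first order form. -/
structure IsProfile (f : ℝ → ℝ) (q₀ v : ℝ) (q s : ℝ → ℝ) : Prop where
  hasDerivAt_density : ∀ x, HasDerivAt q (2 * (q₀ - q x) * s x) x
  hasDerivAt_slope : ∀ x, HasDerivAt s
    ((2 * energyQuot f q₀ (q x) + 2 * q x * energyQuotDeriv f q₀ (q x)) * (q₀ - q x)) x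
  slope_sq : ∀ x, s x ^ 2 = 2 * q x * energyQuot f q₀ (q x) - v ^ 2
  slope_zero : s 0 = 0
  slope_pos : ∀ x, 0 < x → 0 < s x
  nonneg : ∀ x, 0 ≤ q x
  lt : ∀ x, q x < q₀
  even : ∀ x, q (-x) = q x
  decay : ∃ C κ : ℝ, 0 < κ ∧ ∀ x, q₀ - q x ≤ C * Real.exp (-κ * |x|)

/-- Eliminating the phase leaves an autonomous equation for Φ. The slope is ΦΦ'/(q₀ - Φ²): dividing
by q₀ - Φ² removes the degeneracy at infinity, and the energy identity becomes s² = 2qG(q) - v²,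
which has a limit as v ↓ 0. -/
theorem IsDarkSoliton.exists_profile {U : ℝ → ℂ} (hq₀ : 0 < q₀) (hf : ContDiff ℝ 2 f)
    (h : IsDarkSoliton f q₀ v U) :
    ∃ q s : ℝ → ℝ, IsProfile f q₀ v q s ∧ (∀ x, ‖U x‖ ^ 2 = q x) ∧ (∀ x, 0 < q x) ∧
      ∀ x, (conj (U x) * deriv U x).im = v * (q x - q₀) := by
  obtain ⟨heq, Φ, Θ, hΦ, hΘ, hU, hb, h0, Θm, C, κ, hκ, hl, hlΘ, -⟩ := h
  obtain ⟨p0, p1, -⟩ := hasDerivAt_of_contDiff_two hΦ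
  obtain ⟨h1, h2⟩ := hasDerivAt_polar hΦ hΘ hU
  have hpol := polar_equations hΦ hΘ hU heq
  have hs : √q₀ ^ 2 = q₀ := Real.sq_sqrt hq₀.le
  have hs0 : 0 < √q₀ := Real.sqrt_pos.mpr hq₀
  have hlim : Tendsto Φ atTop (𝓝 √q₀) := tendsto_of_abs_sub_le_exp hκ fun x _ => hl x
  have hpos : ∀ z, 0 < Φ z := fun z => (hb z).1
  have hph := deriv_phase hq₀ hΦ hΘ hpos hlim
    (tendsto_of_abs_sub_le_exp hκ fun x hx => by simpa using hlΘ x hx) (fun z => (hpol z).2.2)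
  have hlt : ∀ z, Φ z ^ 2 < q₀ := fun z => by nlinarith [hb z]
  have hΘ' : ∀ z, deriv Θ z = v * (Φ z ^ 2 - q₀) / Φ z ^ 2 := fun z => by
    rw [eq_div_iff (pow_ne_zero 2 (hpos z).ne'), ← hph]; ring
  -- The force left in the real equation after substituting Θ' = v(Φ² - q₀)/Φ². It is singular only
  -- at y = 0, which Φ avoids.
  let N : ℝ → ℝ := fun y => -v ^ 2 * y + v ^ 2 * q₀ ^ 2 / y ^ 3 + 2 * (f (y ^ 2) - f q₀) * y
  have hN : ∀ x, ContDiffAt ℝ 1 N (Φ x) := by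
    intro x
    have hf1 : ContDiff ℝ 1 f := hf.of_le (by norm_num)
    have c1 : ContDiffAt ℝ 1 (fun y : ℝ => -v ^ 2 * y) (Φ x) := by fun_prop
    have c2 : ContDiffAt ℝ 1 (fun y : ℝ => v ^ 2 * q₀ ^ 2 / y ^ 3) (Φ x) :=
      contDiffAt_const.div (by fun_prop) (pow_ne_zero 3 (hpos x).ne')
    have c3 : ContDiffAt ℝ 1 (fun y : ℝ => 2 * (f (y ^ 2) - f q₀) * y) (Φ x) :=
      ContDiff.contDiffAt (by fun_prop)
    exact (c1.add c2).add c3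
  have hamp : ∀ x, deriv (deriv Φ) x = N (Φ x) := by
    intro x
    have e := (hpol x).2.1
    rw [hΘ'] at e
    have := (hpos x).ne'
    simp only [N]
    field_simp at e ⊢
    linear_combination e
  have p1' : ∀ x, HasDerivAt (deriv Φ) (N (Φ x)) x := fun x => hamp x ▸ p1 x
  have hsq : ∀ z, HasDerivAt (fun z => Φ z ^ 2) (2 * Φ z * deriv Φ z) z := fun z => by
    simpa using (p0 z).fun_pow 2
  have heven : ∀ x, Φ (-x) = Φ x := fun x => by
    simpa using reflection_of_ode hN p0 p1' h0 x
  have hderiv : ∀ x, 0 < x → 0 < deriv Φ x := fun x hx =>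
    pos_deriv_of_ode hN p0 p1' h0 hlim (hb 0).2 hx
  have hsqlim : Tendsto (fun z => Φ z ^ 2) atTop (𝓝 q₀) := hs ▸ hlim.pow 2
  -- energy identity
  have hen : ∀ z, deriv Φ z ^ 2 = (q₀ - Φ z ^ 2) ^ 2 *
      (2 * energyQuot f q₀ (Φ z ^ 2) - v ^ 2 / Φ z ^ 2) := by
    intro z
    -- The energy of the amplitude equation. It is constant, and it is 0 because Φ' → 0 along a
    -- sequence while the other terms vanish at infinity.
    let e : ℝ → ℝ := fun z => deriv Φ z ^ 2 + v ^ 2 * (Φ z ^ 2 - q₀) ^ 2 / Φ z ^ 2 -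
      2 * ((Φ z ^ 2 - q₀) ^ 2 * energyQuot f q₀ (Φ z ^ 2))
    have he : ∀ z, HasDerivAt e 0 z := by
      intro z
      have a1 : HasDerivAt (fun z => deriv Φ z ^ 2) (2 * deriv Φ z * N (Φ z)) z := by
        simpa using (p1' z).fun_pow 2
      have a2 : HasDerivAt (fun z => v ^ 2 * (Φ z ^ 2 - q₀) ^ 2)
          (v ^ 2 * (2 * (Φ z ^ 2 - q₀) * (2 * Φ z * deriv Φ z))) z := by
        simpa using (((hsq z).sub_const q₀).fun_pow 2).const_mul (v ^ 2)
      have a3 := a2.div (hsq z) (pow_ne_zero 2 (hpos z).ne')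
      have a4 := ((hasDerivAt_energy (q₀ := q₀) hf (Φ z ^ 2)).comp z (hsq z)).const_mul 2
      refine ((a1.add a3).sub a4).congr_deriv ?_
      have := (hpos z).ne'
      simp only [N]
      field_simp
      ring
    have hec : ∀ x, e x = e z := fun x => eq_const_of_hasDerivAt_zero he x z
    have hl2 : Tendsto (fun x => deriv Φ x ^ 2) atTop (𝓝 (e z)) := by
      have b1 : Tendsto (fun x => v ^ 2 * (Φ x ^ 2 - q₀) ^ 2 / Φ x ^ 2) atTop
          (𝓝 (v ^ 2 * (q₀ - q₀) ^ 2 / q₀)) :=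
        (((hsqlim.sub_const q₀).pow 2).const_mul _).div hsqlim hq₀.ne'
      have b2 : Tendsto (fun x => 2 * ((Φ x ^ 2 - q₀) ^ 2 * energyQuot f q₀ (Φ x ^ 2))) atTop
          (𝓝 (2 * ((q₀ - q₀) ^ 2 * energyQuot f q₀ q₀))) :=
        (((hsqlim.sub_const q₀).pow 2).mul
          (((continuous_energyQuot hf).tendsto q₀).comp hsqlim)).const_mul 2
      have b3 := ((tendsto_const_nhds (x := e z)).sub b1).add b2
      simp only [sub_self, ne_eq, OfNat.ofNat_ne_zero, not_false_eq_true, zero_pow, mul_zero,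
        zero_div, sub_zero, zero_mul, add_zero] at b3
      refine b3.congr fun x => ?_
      rw [← hec x]; simp only [e]; ring
    obtain ⟨ξ, hξ, hξ0⟩ := exists_seq_deriv_tendsto_zero p0 hlim
    have hz : e z = 0 := by
      have := tendsto_nhds_unique (hl2.comp hξ) (hξ0.pow 2)
      simpa using this
    simp only [e] at hz
    have := (hpos z).ne'
    field_simp at hz ⊢
    linear_combination hz
  have hne : ∀ x, q₀ - Φ x ^ 2 ≠ 0 := fun x => (sub_pos.mpr (hlt x)).ne'
  refine ⟨fun x => Φ x ^ 2, fun x => Φ x * deriv Φ x / (q₀ - Φ x ^ 2), ⟨?_, ?_, ?_, ?_, ?_, ?_,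
    hlt, ?_, ?_⟩, fun x => (hpol x).1, fun x => by have := hpos x; positivity, ?_⟩
  · intro x
    refine (hsq x).congr_deriv ?_
    have := hne x
    field_simp
  · intro x
    have a := ((p0 x).fun_mul (p1' x)).fun_div ((hsq x).const_sub q₀) (hne x)
    refine a.congr_deriv ?_
    have e1 := hen x
    have e2 := sub_eq_energyQuot (q₀ := q₀) hf (Φ x ^ 2)
    simp only [N, e2]
    have h3 := hne x
    have h4 := (hpos x).ne'
    rw [div_eq_iff (pow_ne_zero 2 h3)]
    have e1' : deriv Φ x * deriv Φ x = (q₀ - Φ x ^ 2) ^ 2 *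
      (2 * energyQuot f q₀ (Φ x ^ 2) - v ^ 2 / Φ x ^ 2) := by rw [← hen x]; ring
    have e3 : Φ x * deriv Φ x * -(2 * Φ x * deriv Φ x) = -(2 * Φ x ^ 2 * ((q₀ - Φ x ^ 2) ^ 2 *
      (2 * energyQuot f q₀ (Φ x ^ 2) - v ^ 2 / Φ x ^ 2))) := by rw [← e1']; ring
    rw [e3, e1']
    field_simp
    ring
  · intro x
    have h3 := hne x
    have h4 := (hpos x).ne'
    rw [div_pow, mul_pow, hen x]
    field_simp
  · simp [h0]
  · intro x hx
    have := hpos x; have := hderiv x hx; have := sub_pos.mpr (hlt x)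
    positivity
  · intro x; positivity
  · intro x; simp only [heven]
  · refine ⟨C * (2 * √q₀), κ, hκ, fun x => ?_⟩
    have := hl x
    rw [abs_sub_comm, abs_of_pos (sub_pos.mpr (hb x).2)] at this
    have h5 : q₀ - Φ x ^ 2 = (√q₀ - Φ x) * (√q₀ + Φ x) := by linear_combination -hs
    rw [h5]
    calc (√q₀ - Φ x) * (√q₀ + Φ x) ≤ (√q₀ - Φ x) * (2 * √q₀) :=
          mul_le_mul_of_nonneg_left (by linarith [(hb x).2]) (by linarith [(hb x).2])
      _ ≤ C * Real.exp (-κ * |x|) * (2 * √q₀) := by gcongr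
      _ = _ := by ring
  · intro x
    rw [(h1 x).deriv, hU x]
    have : conj ((Φ x : ℂ) * Complex.exp (Complex.I * (Θ x : ℂ))) *
        ((((deriv Φ x : ℝ) : ℂ) + Complex.I * ((Φ x * deriv Θ x : ℝ) : ℂ)) *
          Complex.exp (Complex.I * (Θ x : ℂ))) =
        ((Φ x * deriv Φ x : ℝ) : ℂ) + ((Φ x ^ 2 * deriv Θ x : ℝ) : ℂ) * Complex.I := by
      rw [map_mul, Complex.conj_ofReal, ← Complex.exp_conj, map_mul, Complex.conj_I,
        Complex.conj_ofReal]
      have : Complex.exp (-Complex.I * (Θ x : ℂ)) * Complex.exp (Complex.I * (Θ x : ℂ)) = 1 := by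
        rw [← Complex.exp_add]; simp
      push_cast
      linear_combination ((Φ x : ℂ) * (((deriv Φ x : ℝ) : ℂ) +
        Complex.I * ((Φ x : ℂ) * ((deriv Θ x : ℝ) : ℂ)))) * this
    rw [this, hph x, Complex.add_im, Complex.ofReal_im, Complex.im_ofReal_mul, Complex.I_im, zero_add,
      mul_one]

variable {f : ℝ → ℝ} {q₀ v : ℝ}

/-! ### Black solitons -/

/-- The real part of the travelling wave equation, integrated twice. -/
theorem IsDarkSoliton.re_eq {U : ℝ → ℂ} (hf : ContDiff ℝ 2 f) (h : IsDarkSoliton f q₀ v U)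
    (x : ℝ) : Continuous U ∧
    x * ((deriv U 0).re + 2 * v * (U 0).im) = (U x).re - (U 0).re +
      2 * v * (∫ t in (0 : ℝ)..x, (U t).im) -
      2 * ∫ t in (0 : ℝ)..x, ∫ r in (0 : ℝ)..t, (f (‖U r‖ ^ 2) - f q₀) * (U r).re := by
  obtain ⟨heq, Φ, Θ, hΦ, hΘ, hU, -⟩ := h
  obtain ⟨h1, h2⟩ := hasDerivAt_polar hΦ hΘ hU
  have d1 : ∀ x, HasDerivAt U (deriv U x) x := fun x => (h1 x).differentiableAt.hasDerivAt
  have d2 : ∀ x, HasDerivAt (deriv U) (deriv (deriv U) x) x := fun x =>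
    (h2 x).differentiableAt.hasDerivAt
  have cU : Continuous U := continuous_iff_continuousAt.mpr fun x => (h1 x).continuousAt
  have cf : Continuous f := hf.continuous
  refine ⟨cU, ?_⟩
  have dre : ∀ x, HasDerivAt (fun x => (U x).re) (deriv U x).re x := fun x =>
    (Complex.reCLM.hasFDerivAt.comp_hasDerivAt x (d1 x))
  have dim : ∀ x, HasDerivAt (fun x => (U x).im) (deriv U x).im x := fun x =>
    (Complex.imCLM.hasFDerivAt.comp_hasDerivAt x (d1 x))
  have dre2 : ∀ x, HasDerivAt (fun x => (deriv U x).re) (deriv (deriv U) x).re x := fun x =>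
    (Complex.reCLM.hasFDerivAt.comp_hasDerivAt x (d2 x))
  have hre : ∀ x, v * (deriv U x).im + (deriv (deriv U) x).re / 2 +
      (f q₀ - f (‖U x‖ ^ 2)) * (U x).re = 0 := by
    intro x
    have := congrArg Complex.re (heq x)
    rw [Complex.add_re, Complex.add_re, Complex.re_ofReal_mul, Complex.zero_re] at this
    have e1 : (-Complex.I * (v : ℂ) * deriv U x).re = v * (deriv U x).im := by simp
    have e2 : ((1 / 2 : ℂ) * deriv (deriv U) x).re = (deriv (deriv U) x).re / 2 := by
      rw [show (1 / 2 : ℂ) = ((1 / 2 : ℝ) : ℂ) by norm_num, Complex.re_ofReal_mul]; ring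
    rwa [e1, e2] at this
  set K : ℝ → ℝ := fun r => (f (‖U r‖ ^ 2) - f q₀) * (U r).re with hK
  have cK : Continuous K := by fun_prop
  have dK : ∀ x, HasDerivAt (fun x => ∫ r in (0 : ℝ)..x, K r) (K x) x := fun x =>
    intervalIntegral.integral_hasDerivAt_right (cK.intervalIntegrable _ _)
      (cK.stronglyMeasurableAtFilter _ _) cK.continuousAt
  have cJ : Continuous fun x => ∫ r in (0 : ℝ)..x, K r :=
    continuous_iff_continuousAt.mpr fun x => (dK x).continuousAt
  have hc1 : ∀ x, HasDerivAt (fun x => (deriv U x).re + 2 * v * (U x).im -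
      2 * ∫ r in (0 : ℝ)..x, K r) 0 x := by
    intro x
    refine (((dre2 x).add ((dim x).const_mul (2 * v))).sub ((dK x).const_mul 2)).congr_deriv ?_
    simp only [hK]
    linear_combination 2 * hre x
  have e1 : ∀ x, (deriv U x).re + 2 * v * (U x).im - 2 * ∫ r in (0 : ℝ)..x, K r =
      (deriv U 0).re + 2 * v * (U 0).im := by
    intro x
    have := eq_const_of_hasDerivAt_zero hc1 x 0
    simpa using this
  have cim : Continuous fun x => (U x).im := by fun_prop
  have hc2 : ∀ x, HasDerivAt (fun x => (U x).re - x * ((deriv U 0).re + 2 * v * (U 0).im) +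
      2 * v * (∫ t in (0 : ℝ)..x, (U t).im) - 2 * ∫ t in (0 : ℝ)..x, ∫ r in (0 : ℝ)..t, K r)
      0 x := by
    intro x
    have a1 : HasDerivAt (fun x => ∫ t in (0 : ℝ)..x, (U t).im) (U x).im x :=
      intervalIntegral.integral_hasDerivAt_right (cim.intervalIntegrable _ _)
        (cim.stronglyMeasurableAtFilter _ _) cim.continuousAt
    have a2 : HasDerivAt (fun x => ∫ t in (0 : ℝ)..x, ∫ r in (0 : ℝ)..t, K r)
        (∫ r in (0 : ℝ)..x, K r) x :=
      intervalIntegral.integral_hasDerivAt_right (cJ.intervalIntegrable _ _)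
        (cJ.stronglyMeasurableAtFilter _ _) cJ.continuousAt
    refine ((((dre x).sub ((hasDerivAt_id x).mul_const _)).add (a1.const_mul (2 * v))).sub
      (a2.const_mul 2)).congr_deriv ?_
    linear_combination e1 x
  have := eq_const_of_hasDerivAt_zero hc2 x 0
  simp only [intervalIntegral.integral_same, zero_mul, mul_zero, sub_zero, add_zero] at this
  linear_combination -this

/-- A black soliton satisfies the standing wave equation. -/
theorem IsBlackSoliton.ode {U : ℝ → ℝ → ℂ} {φ₀ : ℝ → ℝ} (hq₀ : 0 < q₀) (hf : ContDiff ℝ 2 f)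
    (h : IsBlackSoliton f q₀ U φ₀) (x : ℝ) :
    HasDerivAt (deriv φ₀) (2 * (f (φ₀ x ^ 2) - f q₀) * φ₀ x) x := by
  obtain ⟨hU, hφ, hlim⟩ := h
  have cφ : Continuous φ₀ := hφ.continuous
  have cf : Continuous f := hf.continuous
  have hs : √q₀ ^ 2 = q₀ := Real.sq_sqrt hq₀.le
  have hbd : ∀ᶠ v in 𝓝[>] (0 : ℝ), Continuous (U v) ∧ ∀ x, ‖U v x‖ ^ 2 ≤ q₀ := by
    filter_upwards [hU] with v hv
    obtain ⟨q, s, hp, hq, -⟩ := hv.exists_profile hq₀ hf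
    exact ⟨(hv.re_eq hf 0).1, fun x => (hq x).trans_le (hp.lt x).le⟩
  have hbd' : ∀ᶠ v in 𝓝[>] (0 : ℝ), ∀ x, ‖U v x‖ ≤ √q₀ := by
    filter_upwards [hbd] with v hv x
    exact Real.le_sqrt_of_sq_le (hv.2 x)
  obtain ⟨M, hM⟩ := (isCompact_Icc (a := (0 : ℝ)) (b := q₀)).exists_bound_of_continuousOn
    (f := fun q => f q - f q₀) (by fun_prop)
  have hM0 : 0 ≤ M := (norm_nonneg _).trans (hM 0 ⟨le_rfl, hq₀.le⟩)
  let K : ℝ → ℝ → ℝ := fun v r => (f (‖U v r‖ ^ 2) - f q₀) * (U v r).re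
  let K0 : ℝ → ℝ := fun r => (f (φ₀ r ^ 2) - f q₀) * φ₀ r
  have cK : ∀ᶠ v in 𝓝[>] (0 : ℝ), Continuous (K v) := by
    filter_upwards [hbd] with v hv
    have := hv.1
    fun_prop
  have hKb : ∀ᶠ v in 𝓝[>] (0 : ℝ), ∀ r, ‖K v r‖ ≤ M * √q₀ := by
    filter_upwards [hbd, hbd'] with v hv hv' r
    rw [norm_mul]
    exact mul_le_mul (hM _ ⟨by positivity, hv.2 r⟩) ((Complex.abs_re_le_norm _).trans (hv' r))
      (norm_nonneg _) hM0
  have hKlim : ∀ r, Tendsto (fun v => K v r) (𝓝[>] 0) (𝓝 (K0 r)) := by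
    intro r
    have c : Continuous fun z : ℂ => (f (‖z‖ ^ 2) - f q₀) * z.re := by fun_prop
    have := (c.tendsto _).comp (hlim r)
    simpa [K0, Function.comp_def] using this
  have hJlim : ∀ t, Tendsto (fun v => ∫ r in (0 : ℝ)..t, K v r) (𝓝[>] 0)
      (𝓝 (∫ r in (0 : ℝ)..t, K0 r)) := fun t =>
    intervalIntegral.tendsto_integral_filter_of_dominated_convergence (fun _ => M * √q₀)
      (cK.mono fun v hv => hv.aestronglyMeasurable)
      (hKb.mono fun v hv => Eventually.of_forall fun r _ => hv r) intervalIntegrable_const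
      (Eventually.of_forall fun r _ => hKlim r)
  have hIlim : ∀ t, Tendsto (fun v => ∫ s in (0 : ℝ)..t, ∫ r in (0 : ℝ)..s, K v r) (𝓝[>] 0)
      (𝓝 (∫ s in (0 : ℝ)..t, ∫ r in (0 : ℝ)..s, K0 r)) := fun t =>
    intervalIntegral.tendsto_integral_filter_of_dominated_convergence
      (fun s => M * √q₀ * |s|)
      (cK.mono fun v hv => (intervalIntegral.continuous_primitive
        (fun a b => hv.intervalIntegrable a b) 0).aestronglyMeasurable)
      (hKb.mono fun v hv => Eventually.of_forall fun s _ => by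
        simpa using intervalIntegral.norm_integral_le_of_norm_le_const
          (a := 0) (b := s) (f := K v) (C := M * √q₀) fun r _ => hv r)
      (Continuous.intervalIntegrable (by fun_prop) _ _)
      (Eventually.of_forall fun s _ => hJlim s)
  have himlim : ∀ t, Tendsto (fun v => 2 * v * ∫ s in (0 : ℝ)..t, (U v s).im) (𝓝[>] 0)
      (𝓝 0) := by
    intro t
    have h0 : Tendsto (fun v : ℝ => 2 * |v| * (√q₀ * |t|)) (𝓝[>] 0) (𝓝 0) := by
      have : Continuous fun v : ℝ => 2 * |v| * (√q₀ * |t|) := by fun_prop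
      simpa using (this.tendsto 0).mono_left nhdsWithin_le_nhds
    refine squeeze_zero_norm' ?_ h0
    filter_upwards [hbd'] with v hv
    rw [norm_mul, norm_mul]
    have : ‖∫ s in (0 : ℝ)..t, (U v s).im‖ ≤ √q₀ * |t| := by
      simpa using intervalIntegral.norm_integral_le_of_norm_le_const
          (a := 0) (b := t) (f := fun s => (U v s).im) (C := √q₀) fun r _ =>
            (Complex.abs_im_le_norm _).trans (hv r)
    simpa using mul_le_mul_of_nonneg_left this (by positivity : 0 ≤ 2 * |v|)
  have hrelim : ∀ t, Tendsto (fun v => (U v t).re) (𝓝[>] 0) (𝓝 (φ₀ t)) := fun t => by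
    simpa [Function.comp_def] using (Complex.continuous_re.tendsto _).comp (hlim t)
  -- Pointwise convergence gives no information on U'(0), but the equation integrated twice
  -- expresses t times this slope through quantities that do converge. The case t = 1 yields the
  -- limiting slope β.
  have hB : ∀ t, Tendsto (fun v => t * ((deriv (U v) 0).re + 2 * v * (U v 0).im)) (𝓝[>] 0)
      (𝓝 (φ₀ t - φ₀ 0 + 0 - 2 * ∫ s in (0 : ℝ)..t, ∫ r in (0 : ℝ)..s, K0 r)) := by
    intro t
    refine ((((hrelim t).sub (hrelim 0)).add (himlim t)).sub ((hIlim t).const_mul 2)).congr' ?_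
    filter_upwards [hU] with v hv
    exact (hv.re_eq hf t).2.symm
  set β := φ₀ 1 - φ₀ 0 + 0 - 2 * ∫ s in (0 : ℝ)..1, ∫ r in (0 : ℝ)..s, K0 r
  have hφeq : ∀ t, φ₀ t = φ₀ 0 + t * β + 2 * ∫ s in (0 : ℝ)..t, ∫ r in (0 : ℝ)..s, K0 r := by
    intro t
    have h1 := (hB 1).const_mul t
    simp only [one_mul] at h1
    have := tendsto_nhds_unique h1 (hB t)
    linear_combination -this
  have cK0 : Continuous K0 := by fun_prop
  have dK : ∀ x, HasDerivAt (fun x => ∫ r in (0 : ℝ)..x, K0 r) (K0 x) x := fun x =>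
    intervalIntegral.integral_hasDerivAt_right (cK0.intervalIntegrable _ _)
      (cK0.stronglyMeasurableAtFilter _ _) cK0.continuousAt
  have cJ : Continuous fun x => ∫ r in (0 : ℝ)..x, K0 r :=
    continuous_iff_continuousAt.mpr fun x => (dK x).continuousAt
  have d1 : ∀ x, HasDerivAt φ₀ (β + 2 * ∫ r in (0 : ℝ)..x, K0 r) x := by
    intro x
    rw [show φ₀ = _ from funext hφeq]
    have a2 : HasDerivAt (fun x => ∫ t in (0 : ℝ)..x, ∫ r in (0 : ℝ)..t, K0 r)
        (∫ r in (0 : ℝ)..x, K0 r) x :=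
      intervalIntegral.integral_hasDerivAt_right (cJ.intervalIntegrable _ _)
        (cJ.stronglyMeasurableAtFilter _ _) cJ.continuousAt
    have a1 : HasDerivAt (fun x => φ₀ 0 + x * β) β x := by
      simpa using ((hasDerivAt_id x).mul_const β).const_add (φ₀ 0)
    exact a1.add (a2.const_mul 2)
  rw [show deriv φ₀ = _ from funext fun x => (d1 x).deriv]
  refine (((dK x).const_mul 2).const_add β).congr_deriv ?_
  simp only [K0]; ring

theorem contDiff_standing_wave_force (hf : ContDiff ℝ 2 f) :
    ContDiff ℝ 1 fun y => 2 * (f (y ^ 2) - f q₀) * y := by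
  have hf1 : ContDiff ℝ 1 f := hf.of_le (by norm_num)
  fun_prop

theorem IsBlackSoliton.sq_le {U : ℝ → ℝ → ℂ} {φ₀ : ℝ → ℝ} (hq₀ : 0 < q₀) (hf : ContDiff ℝ 2 f)
    (h : IsBlackSoliton f q₀ U φ₀) (x : ℝ) : φ₀ x ^ 2 ≤ q₀ := by
  have h1 : Tendsto (fun v => ‖U v x‖ ^ 2) (𝓝[>] 0) (𝓝 (φ₀ x ^ 2)) := by
    simpa using ((h.2.2 x).norm).pow 2
  refine le_of_tendsto h1 ?_
  filter_upwards [h.1] with v hv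
  obtain ⟨q, s, hp, hq, -⟩ := hv.exists_profile hq₀ hf
  exact (hq x).trans_le (hp.lt x).le

/-- Where φ₀² reaches q₀ it is maximal, so φ₀' = 0 there. The constant ±√q₀ solves the same equation
with the same data, so φ₀ would be constant, contrary to its value at 0. -/
theorem IsBlackSoliton.sq_lt {U : ℝ → ℝ → ℂ} {φ₀ : ℝ → ℝ} (hq₀ : 0 < q₀) (hf : ContDiff ℝ 2 f)
    (h : IsBlackSoliton f q₀ U φ₀) (h0 : φ₀ 0 ^ 2 < q₀) (x : ℝ) : φ₀ x ^ 2 < q₀ := by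
  refine lt_of_le_of_ne (h.sq_le hq₀ hf x) fun hx => ?_
  obtain ⟨d0, -, -⟩ := hasDerivAt_of_contDiff_two h.2.1
  have dsq : HasDerivAt (fun x => φ₀ x ^ 2) (2 * φ₀ x * deriv φ₀ x) x := by
    simpa using (d0 x).fun_pow 2
  have hmax : IsLocalMax (fun x => φ₀ x ^ 2) x := Eventually.of_forall fun y =>
    (h.sq_le hq₀ hf y).trans_eq hx.symm
  have hz := hmax.hasDerivAt_eq_zero dsq
  have hne : φ₀ x ≠ 0 := by rintro h0; rw [h0] at hx; simp at hx; exact hq₀.ne hx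
  have hd : deriv φ₀ x = 0 := by
    rcases mul_eq_zero.mp hz with h1 | h1
    · exact absurd (by linarith) hne
    · exact h1
  have := eq_of_second_order_ode (N := fun y => 2 * (f (y ^ 2) - f q₀) * y) (y := φ₀)
    (p := deriv φ₀) (z := fun _ => φ₀ x) (r := fun _ => 0) (x₀ := x)
    (fun x => (contDiff_standing_wave_force hf).contDiffAt) d0 (h.ode hq₀ hf)
    (fun y => hasDerivAt_const y _) (fun y => by simpa [hx] using hasDerivAt_const y (0 : ℝ)) rfl hd
  have h2 := congrFun this 0
  rw [h2, hx] at h0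
  exact lt_irrefl _ h0

/-- The first integral of the standing wave equation. -/
theorem IsBlackSoliton.first_integral {U : ℝ → ℝ → ℂ} {φ₀ : ℝ → ℝ} (hq₀ : 0 < q₀)
    (hf : ContDiff ℝ 2 f) (h : IsBlackSoliton f q₀ U φ₀) (hlim : Tendsto φ₀ atTop (𝓝 √q₀))
    (x : ℝ) : deriv φ₀ x ^ 2 = 2 * (q₀ - φ₀ x ^ 2) ^ 2 * energyQuot f q₀ (φ₀ x ^ 2) := by
  obtain ⟨d0, -, -⟩ := hasDerivAt_of_contDiff_two h.2.1
  have hs : √q₀ ^ 2 = q₀ := Real.sq_sqrt hq₀.le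
  have dsq : ∀ x, HasDerivAt (fun x => φ₀ x ^ 2) (2 * φ₀ x * deriv φ₀ x) x := fun x => by
    simpa using (d0 x).fun_pow 2
  have hsqlim : Tendsto (fun z => φ₀ z ^ 2) atTop (𝓝 q₀) := hs ▸ hlim.pow 2
  let e : ℝ → ℝ := fun z => deriv φ₀ z ^ 2 -
      2 * ((φ₀ z ^ 2 - q₀) ^ 2 * energyQuot f q₀ (φ₀ z ^ 2))
  have he : ∀ z, HasDerivAt e 0 z := by
    intro z
    have a1 : HasDerivAt (fun z => deriv φ₀ z ^ 2)
        (2 * deriv φ₀ z * (2 * (f (φ₀ z ^ 2) - f q₀) * φ₀ z)) z := by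
      simpa using (h.ode hq₀ hf z).fun_pow 2
    have a4 := ((hasDerivAt_energy (q₀ := q₀) hf (φ₀ z ^ 2)).comp z (dsq z)).const_mul 2
    refine (a1.sub a4).congr_deriv ?_
    ring
  have hec : ∀ z, e z = e x := fun z => eq_const_of_hasDerivAt_zero he z x
  have hl2 : Tendsto (fun z => deriv φ₀ z ^ 2) atTop (𝓝 (e x)) := by
    have b2 : Tendsto (fun x => 2 * ((φ₀ x ^ 2 - q₀) ^ 2 * energyQuot f q₀ (φ₀ x ^ 2))) atTop
        (𝓝 (2 * ((q₀ - q₀) ^ 2 * energyQuot f q₀ q₀))) :=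
      (((hsqlim.sub_const q₀).pow 2).mul
        (((continuous_energyQuot hf).tendsto q₀).comp hsqlim)).const_mul 2
    have b3 := (tendsto_const_nhds (x := e x)).add b2
    simp only [sub_self, ne_eq, OfNat.ofNat_ne_zero, not_false_eq_true, zero_pow, mul_zero,
      zero_mul, add_zero] at b3
    refine b3.congr fun z => ?_
    rw [← hec z]; simp only [e]; ring
  obtain ⟨ξ, hξ, hξ0⟩ := exists_seq_deriv_tendsto_zero d0 hlim
  have hz : e x = 0 := by
    have := tendsto_nhds_unique (hl2.comp hξ) (hξ0.pow 2)
    simpa using this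
  simp only [e] at hz
  linear_combination hz

theorem energyQuot_self_pos (hf' : 0 < deriv f q₀) : 0 < energyQuot f q₀ q₀ := by
  rw [energyQuot_self]; linarith

theorem IsKink.tendsto {φ₀ : ℝ → ℝ} (h : IsKink q₀ φ₀) : Tendsto φ₀ atTop (𝓝 √q₀) := by
  obtain ⟨-, -, C, κ, hκ, h1, -⟩ := h
  exact tendsto_of_abs_sub_le_exp hκ h1

theorem IsBubble.tendsto {φ₀ : ℝ → ℝ} (h : IsBubble q₀ φ₀) : Tendsto φ₀ atTop (𝓝 √q₀) := by
  obtain ⟨-, -, -, C, κ, hκ, h1⟩ := h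
  exact tendsto_of_abs_sub_le_exp hκ fun x _ => h1 x

/-- If a kink exists then the energy is positive on `[0, q₀)`, to second order at `q₀`. -/
theorem IsKink.energyQuot_pos {U : ℝ → ℝ → ℂ} {φ₀ : ℝ → ℝ} (hq₀ : 0 < q₀) (hf : ContDiff ℝ 2 f)
    (hf' : 0 < deriv f q₀) (h : IsBlackSoliton f q₀ U φ₀) (hk : IsKink q₀ φ₀) {q : ℝ}
    (hq : q ∈ Icc 0 q₀) : 0 < energyQuot f q₀ q := by
  -- As v ↓ 0 the central density of U v tends to 0, so for some v > 0 the profile crosses the value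
  -- q. At the crossing 2qG(q) = s² + v² > 0.
  have hpos : ∀ q, 0 < q → q < q₀ → 0 < energyQuot f q₀ q := by
    intro q hq hqq
    have h1 : Tendsto (fun v => ‖U v 0‖ ^ 2) (𝓝[>] 0) (𝓝 0) := by
      simpa [hk.2.1] using ((h.2.2 0).norm).pow 2
    obtain ⟨v, ⟨hv, hv0⟩, hvq⟩ := ((h.1.and self_mem_nhdsWithin).and
      (h1.eventually_lt_const hq)).exists
    obtain ⟨r, s, hp, hr, -⟩ := hv.exists_profile hq₀ hf
    have cr : Continuous r := continuous_iff_continuousAt.mpr fun x =>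
      (hp.hasDerivAt_density x).continuousAt
    obtain ⟨C, κ, hκ, hd⟩ := hp.decay
    have hl : Tendsto r atTop (𝓝 q₀) := tendsto_of_abs_sub_le_exp hκ fun x _ => by
      rw [abs_sub_comm, abs_of_pos (sub_pos.mpr (hp.lt x))]; exact hd x
    obtain ⟨x, hx⟩ := (hl.eventually_const_lt hqq).exists
    obtain ⟨t, ht⟩ := mem_range_of_exists_le_of_exists_ge cr ⟨0, (by
      rw [hr] at hvq; exact hvq.le)⟩ ⟨x, hx.le⟩
    have h2 := hp.slope_sq t
    rw [ht] at h2
    have hv0' : 0 < v := hv0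
    have h3 : 0 < 2 * q * energyQuot f q₀ q := by nlinarith [sq_nonneg (s t), pow_pos hv0' 2]
    exact (pos_iff_pos_of_mul_pos h3).mp (by linarith)
  rcases hq.1.eq_or_lt with h0 | h0
  · subst h0
    have hge : 0 ≤ energyQuot f q₀ 0 := by
      have : Tendsto (energyQuot f q₀) (𝓝[>] 0) (𝓝 (energyQuot f q₀ 0)) :=
        ((continuous_energyQuot hf).tendsto 0).mono_left nhdsWithin_le_nhds
      refine ge_of_tendsto this ?_
      filter_upwards [Ioo_mem_nhdsGT hq₀] with q hq using (hpos q hq.1 hq.2).le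
    -- If G(0) = 0, the first integral gives φ₀'(0) = 0 along with φ₀(0) = 0, and uniqueness makes
    -- φ₀ vanish identically.
    refine lt_of_le_of_ne hge fun hz => ?_
    have hfi := h.first_integral hq₀ hf hk.tendsto 0
    rw [hk.2.1] at hfi
    simp only [ne_eq, OfNat.ofNat_ne_zero, not_false_eq_true, zero_pow, ← hz, mul_zero,
      pow_eq_zero_iff] at hfi
    obtain ⟨d0, -, -⟩ := hasDerivAt_of_contDiff_two h.2.1
    have := eq_of_second_order_ode (N := fun y => 2 * (f (y ^ 2) - f q₀) * y) (y := φ₀)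
      (p := deriv φ₀) (z := fun _ => 0) (r := fun _ => 0) (x₀ := 0)
      (fun x => (contDiff_standing_wave_force hf).contDiffAt) d0 (h.ode hq₀ hf)
      (fun y => hasDerivAt_const y _) (fun y => by simpa using hasDerivAt_const y (0 : ℝ))
      hk.2.1 hfi
    have hl := hk.tendsto
    rw [this] at hl
    exact (Real.sqrt_pos.mpr hq₀).ne (tendsto_nhds_unique tendsto_const_nhds hl)
  · rcases hq.2.eq_or_lt with h1 | h1
    · rw [h1]; exact energyQuot_self_pos hf'
    · exact hpos q h0 h1

/-- By the first integral and positivity of G, φ₀' never vanishes, so it keeps one sign; this is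
positive because φ₀ goes from 0 to √q₀ on the right. -/
theorem IsKink.deriv_pos {U : ℝ → ℝ → ℂ} {φ₀ : ℝ → ℝ} (hq₀ : 0 < q₀) (hf : ContDiff ℝ 2 f)
    (hf' : 0 < deriv f q₀) (h : IsBlackSoliton f q₀ U φ₀) (hk : IsKink q₀ φ₀) (x : ℝ) :
    0 < deriv φ₀ x := by
  obtain ⟨d0, d1, -⟩ := hasDerivAt_of_contDiff_two h.2.1
  have hlt := h.sq_lt hq₀ hf (by rw [hk.2.1]; simpa using hq₀)
  have hne : ∀ x, deriv φ₀ x ≠ 0 := by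
    intro x hx
    have := h.first_integral hq₀ hf hk.tendsto x
    have h1 := sub_pos.mpr (hlt x)
    have h2 := hk.energyQuot_pos hq₀ hf hf' h ⟨sq_nonneg (φ₀ x), (hlt x).le⟩
    rw [hx] at this
    have h3 : 0 < 2 * (q₀ - φ₀ x ^ 2) ^ 2 * energyQuot f q₀ (φ₀ x ^ 2) := by positivity
    rw [← this] at h3; simp at h3
  have cd : Continuous (deriv φ₀) := continuous_iff_continuousAt.mpr fun x => (d1 x).continuousAt
  have hlim := hk.tendsto
  obtain ⟨b, hb0, hb⟩ : ∃ b : ℝ, 0 < b ∧ 0 < φ₀ b :=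
    ((eventually_gt_atTop 0).and
      (hlim.eventually_const_lt (Real.sqrt_pos.mpr hq₀))).exists
  obtain ⟨c, hc, hc'⟩ := exists_hasDerivAt_eq_slope φ₀ (deriv φ₀) hb0
    h.2.1.continuous.continuousOn fun x _ => d0 x
  have hcpos : 0 < deriv φ₀ c := by
    rw [hc', hk.2.1]; simp only [sub_zero]; positivity
  by_contra hcon
  obtain ⟨t, ht⟩ := mem_range_of_exists_le_of_exists_ge cd ⟨x, not_lt.mp hcon⟩ ⟨c, hcpos.le⟩
  exact hne t ht

theorem IsKink.deriv_eq {U : ℝ → ℝ → ℂ} {φ₀ : ℝ → ℝ} (hq₀ : 0 < q₀) (hf : ContDiff ℝ 2 f)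
    (hf' : 0 < deriv f q₀) (h : IsBlackSoliton f q₀ U φ₀) (hk : IsKink q₀ φ₀) (x : ℝ) :
    deriv φ₀ x = (q₀ - φ₀ x ^ 2) * √(2 * energyQuot f q₀ (φ₀ x ^ 2)) := by
  have hlt := h.sq_lt hq₀ hf (by rw [hk.2.1]; simpa using hq₀)
  have h1 := sub_pos.mpr (hlt x)
  have h2 := hk.energyQuot_pos hq₀ hf hf' h ⟨sq_nonneg (φ₀ x), (hlt x).le⟩
  refine (pow_left_inj₀ (hk.deriv_pos hq₀ hf hf' h x).le (by positivity) two_ne_zero).mp ?_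
  rw [h.first_integral hq₀ hf hk.tendsto x, mul_pow, Real.sq_sqrt (by positivity)]
  ring

/-- A kink is a profile with zero speed. -/
theorem IsKink.profile {U : ℝ → ℝ → ℂ} {φ₀ : ℝ → ℝ} (hq₀ : 0 < q₀) (hf : ContDiff ℝ 2 f)
    (hf' : 0 < deriv f q₀) (h : IsBlackSoliton f q₀ U φ₀) (hk : IsKink q₀ φ₀) :
    IsProfile f q₀ 0 (fun x => φ₀ x ^ 2)
      (fun x => φ₀ x * √(2 * energyQuot f q₀ (φ₀ x ^ 2))) := by
  obtain ⟨d0, -, -⟩ := hasDerivAt_of_contDiff_two h.2.1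
  have hlt := h.sq_lt hq₀ hf (by rw [hk.2.1]; simpa using hq₀)
  have hG : ∀ x, 0 < energyQuot f q₀ (φ₀ x ^ 2) := fun x =>
    hk.energyQuot_pos hq₀ hf hf' h ⟨sq_nonneg (φ₀ x), (hlt x).le⟩
  have hd := hk.deriv_eq hq₀ hf hf' h
  have dsq : ∀ x, HasDerivAt (fun x => φ₀ x ^ 2) (2 * φ₀ x * deriv φ₀ x) x := fun x => by
    simpa using (d0 x).fun_pow 2
  have hmono : StrictMono φ₀ := strictMono_of_deriv_pos (hk.deriv_pos hq₀ hf hf' h)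
  refine ⟨?_, ?_, ?_, ?_, ?_, ?_, hlt, ?_, ?_⟩
  · intro x
    refine (dsq x).congr_deriv ?_
    rw [hd]; ring
  · intro x
    have a := (((hasDerivAt_energyQuot (q₀ := q₀) hf _).comp x (dsq x)).const_mul 2).sqrt
      (by have := hG x; simp only [Function.comp]; positivity)
    refine ((d0 x).fun_mul a).congr_deriv ?_
    have hr : 0 < √(2 * energyQuot f q₀ (φ₀ x ^ 2)) := Real.sqrt_pos.mpr (by have := hG x; positivity)
    have hr2 : √(2 * energyQuot f q₀ (φ₀ x ^ 2)) ^ 2 = 2 * energyQuot f q₀ (φ₀ x ^ 2) :=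
      Real.sq_sqrt (by have := hG x; positivity)
    simp only [Function.comp]
    rw [hd]
    field_simp
    linear_combination (q₀ - φ₀ x ^ 2) * hr2
  · intro x
    rw [mul_pow, Real.sq_sqrt (by have := hG x; positivity)]; ring
  · simp [hk.2.1]
  · intro x hx
    have h1 : 0 < φ₀ x := by have := hmono hx; rwa [hk.2.1] at this
    have := hG x
    positivity
  · intro x; positivity
  · intro x; simp only [hk.1, neg_sq]
  · obtain ⟨hodd, -, C, κ, hκ, hC, -⟩ := hk
    have hs : √q₀ ^ 2 = q₀ := Real.sq_sqrt hq₀.le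
    have hev : ∀ x, q₀ - φ₀ x ^ 2 = q₀ - φ₀ |x| ^ 2 := by
      intro x
      rcases abs_choice x with h | h <;> rw [h]
      rw [hodd, neg_sq]
    refine ⟨C * (2 * √q₀), κ, hκ, fun x => ?_⟩
    rw [hev]
    have h1 := hC |x| (abs_nonneg x)
    rw [abs_abs, abs_sub_comm] at h1
    have h2 : |φ₀ (|x|)| ≤ √q₀ := Real.abs_le_sqrt (hlt _).le
    have h3 := abs_le.mp h2
    rw [abs_of_nonneg (by linarith)] at h1
    have h5 : q₀ - φ₀ |x| ^ 2 = (√q₀ - φ₀ |x|) * (√q₀ + φ₀ |x|) := by linear_combination -hs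
    rw [h5]
    calc (√q₀ - φ₀ |x|) * (√q₀ + φ₀ |x|) ≤ (√q₀ - φ₀ |x|) * (2 * √q₀) :=
          mul_le_mul_of_nonneg_left (by linarith) (by linarith)
      _ ≤ C * Real.exp (-κ * |x|) * (2 * √q₀) := by gcongr
      _ = _ := by ring

/-- A bubble is positive, and increasing on the right half-line. -/
theorem IsBubble.pos {U : ℝ → ℝ → ℂ} {φ₀ : ℝ → ℝ} (hq₀ : 0 < q₀) (hf : ContDiff ℝ 2 f)
    (h : IsBlackSoliton f q₀ U φ₀) (hb : IsBubble q₀ φ₀) :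
    deriv φ₀ 0 = 0 ∧ (∀ x, 0 < x → 0 < deriv φ₀ x) ∧ ∀ x, 0 ≤ x → 0 < φ₀ x := by
  obtain ⟨d0, -, -⟩ := hasDerivAt_of_contDiff_two h.2.1
  have hd0 : deriv φ₀ 0 = 0 := by
    have h1 : HasDerivAt (fun x => φ₀ (-x)) (-deriv φ₀ 0) 0 := by
      simpa [Function.comp_def] using (d0 (-0)).comp (0 : ℝ) (hasDerivAt_neg (0 : ℝ))
    rw [show (fun x => φ₀ (-x)) = φ₀ from funext hb.1] at h1
    have := h1.unique (d0 0)
    linarith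
  have hN := fun x : ℝ => (contDiff_standing_wave_force (q₀ := q₀) hf).contDiffAt (x := φ₀ x)
  have hd : ∀ x, 0 < x → 0 < deriv φ₀ x := fun x hx =>
    pos_deriv_of_ode hN d0 (h.ode hq₀ hf) hd0 hb.tendsto hb.2.2.1 hx
  -- The value 0 allowed by the definition is excluded: with φ₀'(0) = 0 it would force φ₀ = 0
  -- everywhere.
  have h00 : φ₀ 0 ≠ 0 := by
    intro hz
    have := eq_of_second_order_ode (N := fun y => 2 * (f (y ^ 2) - f q₀) * y) (y := φ₀)
      (p := deriv φ₀) (z := fun _ => 0) (r := fun _ => 0) (x₀ := 0) hN d0 (h.ode hq₀ hf)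
      (fun y => hasDerivAt_const y _) (fun y => by simpa using hasDerivAt_const y (0 : ℝ))
      hz hd0
    have hl := hb.tendsto
    rw [this] at hl
    exact (Real.sqrt_pos.mpr hq₀).ne (tendsto_nhds_unique tendsto_const_nhds hl)
  have hp0 : 0 < φ₀ 0 := lt_of_le_of_ne hb.2.1 (Ne.symm h00)
  have hmono : StrictMonoOn φ₀ (Ici 0) :=
    strictMonoOn_of_deriv_pos (convex_Ici 0) h.2.1.continuous.continuousOn fun x hx => by
      rw [interior_Ici] at hx; exact hd x hx
  exact ⟨hd0, hd, fun x hx => hp0.trans_le (hmono.monotoneOn self_mem_Ici hx hx)⟩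

variable {f : ℝ → ℝ} {q₀ v : ℝ}

/-! ### The renormalized momentum -/

/-- Exponential decay is traded for a rational weight that is easy to integrate and still integrable
after multiplication by |x|. The constant 48 is 2·4!, from y⁴/4! ≤ exp y and (1 + x²)² ≤ 2 + 2x⁴. -/
theorem exp_neg_mul_abs_le {κ : ℝ} (hκ : 0 < κ) (x : ℝ) :
    Real.exp (-κ * |x|) ≤ (2 + 48 / κ ^ 4) * ((1 + x ^ 2) ^ 2)⁻¹ := by
  have h1 := Real.pow_div_factorial_le_exp (κ * |x|) (by positivity) 4
  have h2 : (1 : ℝ) ≤ Real.exp (κ * |x|) := Real.one_le_exp (by positivity)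
  rw [neg_mul, Real.exp_neg, ← div_eq_mul_inv, inv_eq_one_div,
    div_le_div_iff₀ (Real.exp_pos _) (by positivity), one_mul]
  have h3 : (κ * |x|) ^ 4 = κ ^ 4 * x ^ 4 := by
    rw [mul_pow, show |x| ^ 4 = (|x| ^ 2) ^ 2 by ring, sq_abs]; ring
  have h4 : x ^ 4 ≤ 24 / κ ^ 4 * Real.exp (κ * |x|) := by
    rw [h3, show ((Nat.factorial 4 : ℕ) : ℝ) = 24 by norm_num [Nat.factorial]] at h1
    have : 0 < κ ^ 4 := by positivity
    rw [div_mul_eq_mul_div, le_div_iff₀ this]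
    rw [div_le_iff₀ (by norm_num)] at h1
    linarith
  have h5 : 48 / κ ^ 4 = 2 * (24 / κ ^ 4) := by ring
  rw [h5]
  nlinarith [sq_nonneg (x ^ 2 - 1)]

theorem integrable_inv_one_add_sq_sq : Integrable fun x : ℝ => ((1 + x ^ 2) ^ 2)⁻¹ := by
  refine integrable_inv_one_add_sq.mono' (by
    apply Continuous.aestronglyMeasurable
    exact Continuous.inv₀ (by fun_prop) fun x => by positivity) (Eventually.of_forall fun x => ?_)
  rw [Real.norm_of_nonneg (by positivity)]
  exact inv_anti₀ (by positivity) (by nlinarith [sq_nonneg x, sq_nonneg (x ^ 2)])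

/-- The function `h` with `s² = h(q) - v²` for the slope `s` of a profile with speed `v`. -/
noncomputable def slopeSq (f : ℝ → ℝ) (q₀ q : ℝ) : ℝ := 2 * q * energyQuot f q₀ q

/-- The derivative of `slopeSq`. -/
noncomputable def slopeSqDeriv (f : ℝ → ℝ) (q₀ q : ℝ) : ℝ :=
  2 * energyQuot f q₀ q + 2 * q * energyQuotDeriv f q₀ q

/-- The density of the regular part of the momentum. -/
noncomputable def momentumWeight (f : ℝ → ℝ) (q₀ q : ℝ) : ℝ :=
  1 + q₀ * energyQuotDeriv f q₀ q / energyQuot f q₀ q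

theorem hasDerivAt_slopeSq (hf : ContDiff ℝ 2 f) (q : ℝ) :
    HasDerivAt (slopeSq f q₀) (slopeSqDeriv f q₀ q) q := by
  have : HasDerivAt (fun q : ℝ => 2 * q) 2 q := by simpa using (hasDerivAt_id q).const_mul 2
  exact this.fun_mul (hasDerivAt_energyQuot hf q)

theorem continuous_slopeSqDeriv (hf : ContDiff ℝ 2 f) : Continuous (slopeSqDeriv f q₀) := by
  have h1 := continuous_energyQuotDeriv (q₀ := q₀) hf
  have h2 := continuous_energyQuot (q₀ := q₀) hf
  unfold slopeSqDeriv
  fun_prop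

theorem continuous_slopeSq (hf : ContDiff ℝ 2 f) : Continuous (slopeSq f q₀) :=
  continuous_iff_continuousAt.mpr fun q => (hasDerivAt_slopeSq hf q).continuousAt

theorem continuousOn_momentumWeight (hf : ContDiff ℝ 2 f)
    (hG : ∀ q ∈ Icc 0 q₀, 0 < energyQuot f q₀ q) : ContinuousOn (momentumWeight f q₀) (Icc 0 q₀) := by
  have h1 := continuous_energyQuotDeriv (q₀ := q₀) hf
  have h2 := continuous_energyQuot (q₀ := q₀) hf
  unfold momentumWeight
  exact continuousOn_const.add (ContinuousOn.div (by fun_prop) h2.continuousOn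
    fun q hq => (hG q hq).ne')

namespace IsProfile

variable {q s : ℝ → ℝ}

theorem mem_Icc (h : IsProfile f q₀ v q s) (x : ℝ) : q x ∈ Icc 0 q₀ := ⟨h.nonneg x, (h.lt x).le⟩

theorem slope_sq' (h : IsProfile f q₀ v q s) (x : ℝ) : s x ^ 2 = slopeSq f q₀ (q x) - v ^ 2 :=
  h.slope_sq x

theorem hasDerivAt_slope' (h : IsProfile f q₀ v q s) (x : ℝ) :
    HasDerivAt s (slopeSqDeriv f q₀ (q x) * (q₀ - q x)) x := h.hasDerivAt_slope x

theorem continuous_density (h : IsProfile f q₀ v q s) : Continuous q :=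
  continuous_iff_continuousAt.mpr fun x => (h.hasDerivAt_density x).continuousAt

theorem continuous_slope (h : IsProfile f q₀ v q s) : Continuous s :=
  continuous_iff_continuousAt.mpr fun x => (h.hasDerivAt_slope x).continuousAt

theorem exists_decay (h : IsProfile f q₀ v q s) :
    ∃ D : ℝ, 0 ≤ D ∧ ∀ x, q₀ - q x ≤ D * ((1 + x ^ 2) ^ 2)⁻¹ := by
  obtain ⟨C, κ, hκ, hC⟩ := h.decay
  have hC0 : 0 ≤ C := by
    have h1 := hC 0
    have h2 := h.lt 0
    simp only [abs_zero, mul_zero, Real.exp_zero, mul_one] at h1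
    linarith
  refine ⟨C * (2 + 48 / κ ^ 4), by positivity, fun x => (hC x).trans ?_⟩
  rw [mul_assoc]
  exact mul_le_mul_of_nonneg_left (exp_neg_mul_abs_le hκ x) hC0

theorem tendsto_density (h : IsProfile f q₀ v q s) : Tendsto q atTop (𝓝 q₀) := by
  obtain ⟨C, κ, hκ, hd⟩ := h.decay
  exact tendsto_of_abs_sub_le_exp hκ fun x _ => by
    rw [abs_sub_comm, abs_of_pos (sub_pos.mpr (h.lt x))]; exact hd x

theorem integrable (h : IsProfile f q₀ v q s) : Integrable fun x => q₀ - q x := by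
  obtain ⟨D, hD0, hD⟩ := h.exists_decay
  refine (integrable_inv_one_add_sq_sq.const_mul D).mono'
    (continuous_const.sub h.continuous_density).aestronglyMeasurable
    (Eventually.of_forall fun x => ?_)
  rw [Real.norm_of_nonneg (sub_pos.mpr (h.lt x)).le]
  exact hD x

theorem integrable_comp_mul (h : IsProfile f q₀ v q s) {g : ℝ → ℝ}
    (hg : ContinuousOn g (Icc 0 q₀)) : Integrable fun x => g (q x) * (q₀ - q x) := by
  obtain ⟨M, hM⟩ := isCompact_Icc.exists_bound_of_continuousOn hg
  exact h.integrable.bdd_mul (c := M)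
    (hg.comp_continuous h.continuous_density h.mem_Icc).aestronglyMeasurable
    (Eventually.of_forall fun x => hM _ (h.mem_Icc x))

theorem slope_eq (h : IsProfile f q₀ v q s) {x : ℝ} (hx : 0 ≤ x) :
    s x = √(slopeSq f q₀ (q x) - v ^ 2) := by
  rw [← h.slope_sq' x, Real.sqrt_sq]
  rcases hx.eq_or_lt with rfl | hx
  · exact h.slope_zero.ge
  · exact (h.slope_pos x hx).le

theorem strictMonoOn (h : IsProfile f q₀ v q s) : StrictMonoOn q (Ici 0) := by
  refine strictMonoOn_of_deriv_pos (convex_Ici 0) h.continuous_density.continuousOn fun x hx => ?_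
  rw [interior_Ici] at hx
  rw [(h.hasDerivAt_density x).deriv]
  have := h.slope_pos x hx
  have := sub_pos.mpr (h.lt x)
  positivity

theorem tendsto_slope (h : IsProfile f q₀ v q s) (hf : ContDiff ℝ 2 f) :
    Tendsto s atTop (𝓝 √(slopeSq f q₀ q₀ - v ^ 2)) := by
  have : Tendsto (fun x => √(slopeSq f q₀ (q x) - v ^ 2)) atTop
      (𝓝 √(slopeSq f q₀ q₀ - v ^ 2)) :=
    ((((continuous_slopeSq hf).tendsto q₀).comp h.tendsto_density).sub_const _).sqrt
  refine this.congr' ?_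
  filter_upwards [eventually_ge_atTop 0] with x hx using (h.slope_eq hx).symm

/-- The momentum integral of a profile. -/
theorem integral_momentum (h : IsProfile f q₀ v q s) (hf : ContDiff ℝ 2 f) (hv : 0 < v)
    (hG : ∀ q ∈ Icc 0 q₀, 0 < energyQuot f q₀ q) (hpos : ∀ x, 0 < q x) :
    v * ∫ x in Ioi (0 : ℝ), (q x - q₀) ^ 2 / q x =
      q₀ * Real.arctan (√(slopeSq f q₀ q₀ - v ^ 2) / v) -
        v * ∫ x in Ioi (0 : ℝ), momentumWeight f q₀ (q x) * (q₀ - q x) := by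
  have hi : Integrable fun x => v / (v ^ 2 + s x ^ 2) * (slopeSqDeriv f q₀ (q x) * (q₀ - q x)) := by
    have cs := h.continuous_slope
    refine (h.integrable_comp_mul (continuous_slopeSqDeriv hf).continuousOn).bdd_mul
      (c := v / v ^ 2) ?_ (Eventually.of_forall fun x => ?_)
    · refine (Continuous.div (by fun_prop) (by fun_prop) fun x => ?_).aestronglyMeasurable
      positivity
    · rw [Real.norm_of_nonneg (by positivity)]
      gcongr
      nlinarith [sq_nonneg (s x)]
  -- Since v² + s² = h(q), the derivative of arctan(s/v) is v(q₀ - q)(1/q + G'/G). Its 1/q part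
  -- carries the singularity at small density, and the rest goes into `momentumWeight`.
  have h1 : ∫ x in Ioi (0 : ℝ), v / (v ^ 2 + s x ^ 2) * (slopeSqDeriv f q₀ (q x) * (q₀ - q x)) =
      Real.arctan (√(slopeSq f q₀ q₀ - v ^ 2) / v) - Real.arctan (s 0 / v) := by
    refine integral_Ioi_of_hasDerivAt_of_tendsto' (fun x _ => ?_) hi.integrableOn
      ((Real.continuous_arctan.tendsto _).comp ((h.tendsto_slope hf).div_const v))
    refine ((h.hasDerivAt_slope' x).div_const v).arctan.congr_deriv ?_
    have : v ^ 2 + s x ^ 2 ≠ 0 := by positivity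
    field_simp
  rw [h.slope_zero, zero_div, Real.arctan_zero, sub_zero] at h1
  have hk := h.integrable_comp_mul (continuousOn_momentumWeight hf hG)
  rw [← h1, ← integral_const_mul, ← integral_const_mul, ← integral_const_mul,
    ← integral_sub (hi.const_mul q₀).integrableOn (hk.const_mul v).integrableOn]
  refine integral_congr_ae (Eventually.of_forall fun x => ?_)
  have e : v ^ 2 + s x ^ 2 = 2 * q x * energyQuot f q₀ (q x) := by rw [h.slope_sq x]; ring
  have g1 := (hG _ (h.mem_Icc x)).ne'
  have g2 := (hpos x).ne'
  simp only [e, momentumWeight, slopeSqDeriv]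
  field_simp
  ring

end IsProfile

/-- The momentum of a dark soliton in terms of its profile. -/
theorem momentum_eq {U : ℝ → ℂ} {q s : ℝ → ℝ} (h : IsProfile f q₀ v q s)
    (hU : ∀ x, ‖U x‖ ^ 2 = q x) (hpos : ∀ x, 0 < q x)
    (hcur : ∀ x, (conj (U x) * deriv U x).im = v * (q x - q₀)) :
    momentum q₀ U = -2 * (v * ∫ x in Ioi (0 : ℝ), (q x - q₀) ^ 2 / q x) := by
  have h1 : ∀ x, (conj (U x) * deriv U x - U x * conj (deriv U x)) *
      (1 - (q₀ : ℂ) / ((‖U x‖ ^ 2 : ℝ) : ℂ)) =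
      ((v * ((q x - q₀) ^ 2 / q x) : ℝ) : ℂ) * (2 * Complex.I) := by
    intro x
    have h2 : conj (U x) * deriv U x - U x * conj (deriv U x) =
        ((2 * (v * (q x - q₀)) : ℝ) : ℂ) * Complex.I := by
      rw [← hcur x, ← Complex.sub_conj]
      simp
    rw [h2, hU x]
    have : ((q x : ℝ) : ℂ) ≠ 0 := by exact_mod_cast (hpos x).ne'
    push_cast
    field_simp
  have h3 : ∫ x, (q x - q₀) ^ 2 / q x = 2 * ∫ x in Ioi (0 : ℝ), (q x - q₀) ^ 2 / q x := by
    rw [← integral_comp_abs (f := fun x => (q x - q₀) ^ 2 / q x)]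
    refine integral_congr_ae (Eventually.of_forall fun x => ?_)
    have : q |x| = q x := by rcases abs_choice x with h' | h' <;> rw [h']; rw [h.even]
    simp only [this]
  rw [momentum]
  simp_rw [h1]
  rw [integral_mul_const, integral_complex_ofReal, integral_const_mul, h3]
  rw [show Complex.I / 2 * (((v * (2 * ∫ x in Ioi (0 : ℝ), (q x - q₀) ^ 2 / q x) : ℝ) : ℂ) *
    (2 * Complex.I)) = ((-2 * (v * ∫ x in Ioi (0 : ℝ), (q x - q₀) ^ 2 / q x) : ℝ) : ℂ) by
      push_cast
      linear_combination (2 * (v : ℂ) * ((∫ x in Ioi (0 : ℝ), (q x - q₀) ^ 2 / q x : ℝ) : ℂ)) *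
        Complex.I_sq]
  exact Complex.ofReal_re _

variable {f : ℝ → ℝ} {q₀ v : ℝ}

/-- Near zero density the momentum weight is a `C¹` function of `slopeSq`. -/
theorem exists_inverse_weight (hf : ContDiff ℝ 2 f) (hq₀ : 0 < q₀)
    (hG : ∀ q ∈ Icc 0 q₀, 0 < energyQuot f q₀ q) :
    ∃ qs ∈ Ioo 0 q₀, ∃ m : ℝ → ℝ, ∃ J : Set ℝ, IsOpen J ∧ Icc 0 (slopeSq f q₀ qs) ⊆ J ∧
      (∀ y ∈ J, ContDiffAt ℝ 1 m y) ∧ ∀ q ∈ Icc 0 qs, slopeSq f q₀ q ∈ J ∧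
        m (slopeSq f q₀ q) * slopeSqDeriv f q₀ q = momentumWeight f q₀ q := by
  have hG0 := hG 0 ⟨le_rfl, hq₀.le⟩
  have h0 : slopeSq f q₀ 0 = 0 := by simp [slopeSq]
  have hd0 : 0 < slopeSqDeriv f q₀ 0 := by simpa [slopeSqDeriv] using hG0
  have hG1 : ContDiff ℝ 1 (energyQuot f q₀) := by
    rw [contDiff_one_iff_deriv, show deriv (energyQuot f q₀) = energyQuotDeriv f q₀ from
      funext fun q => (hasDerivAt_energyQuot hf q).deriv]
    exact ⟨fun q => (hasDerivAt_energyQuot hf q).differentiableAt, continuous_energyQuotDeriv hf⟩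
  have hc : ContDiffAt ℝ 1 (slopeSq f q₀) 0 := by
    unfold slopeSq
    exact ContDiff.contDiffAt (by fun_prop)
  have hG2 := contDiffAt_energyQuotDeriv (q₀ := q₀) hf hq₀.ne
  have hs : HasStrictDerivAt (slopeSq f q₀) (slopeSqDeriv f q₀ 0) 0 :=
    hasStrictDerivAt_of_hasDerivAt_of_continuousAt
      (Eventually.of_forall fun q => hasDerivAt_slopeSq hf q)
      (continuous_slopeSqDeriv hf).continuousAt
  have hs' := hs.hasStrictFDerivAt_equiv hd0.ne'
  -- The function h vanishes at 0 with slope 2G(0) > 0, so it is invertible there. `momentumWeight`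
  -- is C¹ near 0 because 0 ≠ q₀.
  set Q := hc.localInverse hs'.hasFDerivAt one_ne_zero with hQ
  have hQc : ContDiffAt ℝ 1 Q 0 := by
    have := hc.to_localInverse hs'.hasFDerivAt one_ne_zero
    rwa [h0] at this
  have hQ0 : Q 0 = 0 := by
    have := hc.localInverse_apply_image hs'.hasFDerivAt one_ne_zero
    rwa [h0] at this
  have hinv : ∀ᶠ q in 𝓝 (0 : ℝ), Q (slopeSq f q₀ q) = q :=
    (hc.hasStrictFDerivAt' hs'.hasFDerivAt one_ne_zero).eventually_left_inverse
  let m : ℝ → ℝ := fun y => momentumWeight f q₀ (Q y) / slopeSqDeriv f q₀ (Q y)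
  have hm : ContDiffAt ℝ 1 m 0 := by
    have hw : ContDiffAt ℝ 1 (momentumWeight f q₀) (Q 0) := by
      rw [hQ0]
      exact contDiffAt_const.add ((contDiffAt_const.mul hG2).div hG1.contDiffAt hG0.ne')
    have hsd : ContDiffAt ℝ 1 (slopeSqDeriv f q₀) (Q 0) := by
      rw [hQ0]
      exact (contDiffAt_const.mul hG1.contDiffAt).add
        ((contDiffAt_const.mul contDiffAt_id).mul hG2)
    exact (hw.comp (0 : ℝ) hQc).div (hsd.comp (0 : ℝ) hQc) (by
      simp only [hQ0]; exact hd0.ne')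
  obtain ⟨ε, hε, hεm⟩ := Metric.eventually_nhds_iff_ball.mp (hm.eventually (by simp))
  have e1 : ∀ᶠ q in 𝓝 (0 : ℝ), 0 < slopeSqDeriv f q₀ q :=
    (continuous_slopeSqDeriv hf).continuousAt.eventually_const_lt hd0
  have e2 : ∀ᶠ q in 𝓝 (0 : ℝ), slopeSq f q₀ q ∈ Metric.ball (0 : ℝ) ε := by
    have := (continuous_slopeSq (q₀ := q₀) hf).continuousAt (x := 0)
    exact this.eventually (by rw [h0]; exact Metric.ball_mem_nhds _ hε)
  obtain ⟨δ, hδ, hδq⟩ := Metric.eventually_nhds_iff_ball.mp (hinv.and (e1.and e2))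
  have hmem : ∀ q ∈ Icc 0 (min (δ / 2) (q₀ / 2)), q ∈ Metric.ball (0 : ℝ) δ := by
    intro q hq
    rw [Metric.mem_ball, Real.dist_0_eq_abs, abs_of_nonneg hq.1]
    have := hq.2.trans (min_le_left _ _)
    linarith
  have hqs : 0 < min (δ / 2) (q₀ / 2) := lt_min (by linarith) (by linarith)
  refine ⟨min (δ / 2) (q₀ / 2), ⟨hqs, (min_le_right _ _).trans_lt (by linarith)⟩, m,
    Metric.ball 0 ε, Metric.isOpen_ball, fun y hy => ?_, hεm, fun q hq => ?_⟩
  · have := (hδq _ (hmem _ ⟨hqs.le, le_rfl⟩)).2.2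
    rw [Metric.mem_ball, Real.dist_0_eq_abs] at this ⊢
    rw [abs_of_nonneg hy.1]
    exact (hy.2.trans (le_abs_self _)).trans_lt this
  · obtain ⟨a1, a2, a3⟩ := hδq q (hmem q hq)
    refine ⟨a3, ?_⟩
    simp only [m, a1]
    exact div_mul_cancel₀ _ a2.ne'

/-- The regular part of the momentum, as an explicit function of the speed. -/
noncomputable def weightIntegral (f : ℝ → ℝ) (q₀ qs : ℝ) (m : ℝ → ℝ) (v : ℝ) : ℝ :=
  √(slopeSq f q₀ qs - v ^ 2) *
      (∫ t in (0 : ℝ)..1, m (v ^ 2 + (slopeSq f q₀ qs - v ^ 2) * t ^ 2)) +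
    ∫ r in qs..q₀, momentumWeight f q₀ r / (2 * √(slopeSq f q₀ r - v ^ 2))

/-- Two changes of variable, split at density qs. Below qs the slope s is the variable, which avoids
the singular factor 1/√(h - v²); above qs the density is, which avoids dividing by h'. The result
involves only v, and it also covers the kink, v = 0. -/
theorem IsProfile.integral_weight {q s : ℝ → ℝ} (h : IsProfile f q₀ v q s) (hf : ContDiff ℝ 2 f)
    (hG : ∀ q ∈ Icc 0 q₀, 0 < energyQuot f q₀ q) {qs : ℝ} (hqs : qs ∈ Ioo 0 q₀)
    {m : ℝ → ℝ} {J : Set ℝ} (hm : ∀ y ∈ J, ContDiffAt ℝ 1 m y)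
    (hmw : ∀ q ∈ Icc 0 qs, slopeSq f q₀ q ∈ J ∧
        m (slopeSq f q₀ q) * slopeSqDeriv f q₀ q = momentumWeight f q₀ q)
    (h0 : q 0 ≤ qs) (hv : ∀ q ∈ Icc qs q₀, v ^ 2 < slopeSq f q₀ q) :
    ∫ x in Ioi (0 : ℝ), momentumWeight f q₀ (q x) * (q₀ - q x) =
      weightIntegral f q₀ qs m v := by
  have cq := h.continuous_density
  have hi := h.integrable_comp_mul (continuousOn_momentumWeight hf hG)
  obtain ⟨X, hX0, hX⟩ : ∃ X : ℝ, 0 < X ∧ qs < q X :=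
    ((eventually_gt_atTop 0).and (h.tendsto_density.eventually_const_lt hqs.2)).exists
  obtain ⟨xs, ⟨hxs0, -⟩, hxs⟩ := intermediate_value_Icc hX0.le cq.continuousOn ⟨h0, hX.le⟩
  rw [← intervalIntegral.integral_interval_add_Ioi (b := xs) hi.integrableOn hi.integrableOn]
  have hss : s xs = √(slopeSq f q₀ qs - v ^ 2) := by rw [h.slope_eq hxs0, hxs]
  have hlow : ∀ x ∈ Icc 0 xs, q x ∈ Icc 0 qs := fun x hx =>
    ⟨h.nonneg x, by rw [← hxs]; exact h.strictMonoOn.monotoneOn hx.1 hxs0 hx.2⟩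
  have hhigh : ∀ x, xs ≤ x → q x ∈ Icc qs q₀ := fun x hx =>
    ⟨by rw [← hxs]; exact h.strictMonoOn.monotoneOn hxs0 (hxs0.trans hx) hx, (h.lt x).le⟩
  unfold weightIntegral
  congr 1
  · have e1 : ∫ x in (0 : ℝ)..xs, momentumWeight f q₀ (q x) * (q₀ - q x) =
        ∫ x in (0 : ℝ)..xs, ((fun t => m (v ^ 2 + t ^ 2)) ∘ s) x *
          (slopeSqDeriv f q₀ (q x) * (q₀ - q x)) := by
      refine intervalIntegral.integral_congr fun x hx => ?_
      rw [uIcc_of_le hxs0] at hx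
      have := (hmw _ (hlow x hx)).2
      have e : v ^ 2 + s x ^ 2 = slopeSq f q₀ (q x) := by rw [h.slope_sq']; ring
      simp only [Function.comp, e, ← this]
      ring
    rw [e1, intervalIntegral.integral_comp_mul_deriv'' h.continuous_slope.continuousOn
      (fun x _ => (h.hasDerivAt_slope' x).hasDerivWithinAt), h.slope_zero, hss]
    -- Rescaling s to t in [0,1] removes v from the limits of integration.
    · have := intervalIntegral.mul_integral_comp_mul_left (a := 0) (b := 1)
        (f := fun t => m (v ^ 2 + t ^ 2)) (√(slopeSq f q₀ qs - v ^ 2))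
      rw [mul_zero, mul_one] at this
      rw [← this]
      congr 2 with t
      rw [mul_pow, Real.sq_sqrt (sub_nonneg.mpr (hv qs ⟨le_rfl, hqs.2.le⟩).le)]
    · have := continuous_slopeSqDeriv (q₀ := q₀) hf
      exact Continuous.continuousOn (by fun_prop)
    · rintro _ ⟨x, hx, rfl⟩
      rw [uIcc_of_le hxs0] at hx
      have e : v ^ 2 + s x ^ 2 = slopeSq f q₀ (q x) := by rw [h.slope_sq']; ring
      have c := (hm _ (e ▸ (hmw _ (hlow x hx)).1)).continuousAt
      have c2 : ContinuousAt (fun t : ℝ => v ^ 2 + t ^ 2) (s x) := by fun_prop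
      exact (ContinuousAt.comp (f := fun t : ℝ => v ^ 2 + t ^ 2) c c2).continuousWithinAt
  · set κ : ℝ → ℝ := fun r => momentumWeight f q₀ r / (2 * √(slopeSq f q₀ r - v ^ 2)) with hκ
    have cκ : ContinuousOn κ (Icc qs q₀) := by
      have c1 := continuous_slopeSq (q₀ := q₀) hf
      refine ((continuousOn_momentumWeight hf hG).mono (Icc_subset_Icc_left hqs.1.le)).div
        (Continuous.continuousOn (by fun_prop)) fun r hr => ?_
      have := Real.sqrt_pos.mpr (sub_pos.mpr (hv r hr))
      positivity
    let F : ℝ → ℝ := fun y => ∫ r in qs..y, κ r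
    have cF : ContinuousOn F (Icc qs q₀) := by
      have := intervalIntegral.continuousOn_primitive_interval (f := κ) (a := qs) (b := q₀)
        (μ := volume) (by rw [uIcc_of_le hqs.2.le]; exact cκ.integrableOn_Icc)
      rwa [uIcc_of_le hqs.2.le] at this
    have hFq : ∫ x in Ioi xs, momentumWeight f q₀ (q x) * (q₀ - q x) = F q₀ - (F ∘ q) xs := by
      refine integral_Ioi_of_hasDerivAt_of_tendsto ?_ (fun x hx => ?_) hi.integrableOn ?_
      · exact (cF _ (hhigh xs le_rfl)).comp cq.continuousWithinAt fun x hx => hhigh x hx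
      · have hx0 : 0 < x := hxs0.trans_lt hx
        have hx1 : qs < q x := by
          rw [← hxs]; exact h.strictMonoOn hxs0 hx0.le hx
        have dF : HasDerivAt F (κ (q x)) (q x) := by
          refine intervalIntegral.integral_hasDerivAt_right ?_ ?_ ?_
          · refine (cκ.mono ?_).intervalIntegrable
            rw [uIcc_of_le hx1.le]
            exact Icc_subset_Icc_right (h.lt x).le
          · exact (cκ.mono Ioo_subset_Icc_self).stronglyMeasurableAtFilter isOpen_Ioo _
              ⟨hx1, h.lt x⟩
          · exact cκ.continuousAt (Icc_mem_nhds hx1 (h.lt x))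
        refine (dF.comp x (h.hasDerivAt_density x)).congr_deriv ?_
        have hs := h.slope_pos x hx0
        simp only [hκ, ← h.slope_eq hx0.le]
        field_simp
      · have : Tendsto q atTop (𝓝[Icc qs q₀] q₀) := by
          refine tendsto_nhdsWithin_iff.mpr ⟨h.tendsto_density, ?_⟩
          filter_upwards [eventually_ge_atTop xs] with x hx using hhigh x hx
        exact (cF q₀ ⟨hqs.2.le, le_rfl⟩).tendsto.comp this
    rw [hFq]
    simp [F, hxs]

/-- Both integrals have fixed limits and can be differentiated under the sign. The condition v² < r
keeps h - v² away from 0 on [qs, q₀], so nothing degenerates at v = 0. -/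
theorem hasDerivAt_weightIntegral (hf : ContDiff ℝ 2 f)
    (hG : ∀ q ∈ Icc 0 q₀, 0 < energyQuot f q₀ q) {qs : ℝ} (hqs : qs ∈ Ioo 0 q₀)
    {m : ℝ → ℝ} {J : Set ℝ} (hJ : IsOpen J) (hsub : Icc 0 (slopeSq f q₀ qs) ⊆ J)
    (hm : ∀ y ∈ J, ContDiffAt ℝ 1 m y)
    {r : ℝ} (hr : 0 < r) (hrq : ∀ q ∈ Icc qs q₀, r ≤ slopeSq f q₀ q) :
    ∃ K : ℝ → ℝ, (∀ v, v ^ 2 < r → HasDerivAt (weightIntegral f q₀ qs m) (K v) v) ∧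
      ContinuousAt K 0 := by
  set I : Set ℝ := {v | v ^ 2 < r} with hI
  have hIo : IsOpen I := isOpen_lt (by fun_prop) continuous_const
  set ys := slopeSq f q₀ qs with hys
  have hry : r ≤ ys := hrq qs ⟨le_rfl, hqs.2.le⟩
  have cw := (continuousOn_momentumWeight hf hG).mono (Icc_subset_Icc_left (b := q₀) hqs.1.le)
  have cs := continuous_slopeSq (q₀ := q₀) hf
  have dm : ∀ y ∈ J, HasDerivAt m (deriv m y) y := fun y hy =>
    ((hm y hy).differentiableAt (by norm_num)).hasDerivAt
  have cm : ContinuousOn m J := fun y hy => (hm y hy).continuousAt.continuousWithinAt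
  have cdm : ContinuousOn (deriv m) J := by
    refine ContDiffOn.continuousOn_deriv_of_isOpen (n := 1) ?_ hJ (le_refl _)
    exact fun y hy => (hm y hy).contDiffWithinAt
  have hmap : ∀ v ∈ I, ∀ t ∈ uIcc (0 : ℝ) 1, v ^ 2 + (ys - v ^ 2) * t ^ 2 ∈ J := by
    intro v hv t ht
    rw [uIcc_of_le zero_le_one] at ht
    have hv' : v ^ 2 < r := hv
    have ht2 : t ^ 2 ≤ 1 := by nlinarith [ht.1, ht.2]
    refine hsub ⟨?_, ?_⟩
    · have : 0 ≤ (ys - v ^ 2) * t ^ 2 := mul_nonneg (by linarith) (sq_nonneg t)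
      nlinarith [sq_nonneg v]
    · nlinarith
  have hA1 : ContinuousOn (fun p : ℝ × ℝ => deriv m (p.1 ^ 2 + (ys - p.1 ^ 2) * p.2 ^ 2) *
      (2 * p.1 + -(2 * p.1) * p.2 ^ 2)) (I ×ˢ uIcc 0 1) :=
    (cdm.comp (f := fun p : ℝ × ℝ => p.1 ^ 2 + (ys - p.1 ^ 2) * p.2 ^ 2) (by fun_prop)
      fun p hp => hmap p.1 hp.1 p.2 hp.2).fun_mul (by fun_prop)
  have hA := fun v hv => hasDerivAt_integral_of_continuousOn hIo (a := 0) (b := 1)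
    (H := fun v t => m (v ^ 2 + (ys - v ^ 2) * t ^ 2))
    (H' := fun v t => deriv m (v ^ 2 + (ys - v ^ 2) * t ^ 2) * (2 * v + -(2 * v) * t ^ 2))
    (cm.comp (f := fun p : ℝ × ℝ => p.1 ^ 2 + (ys - p.1 ^ 2) * p.2 ^ 2) (by fun_prop)
      fun p hp => hmap p.1 hp.1 p.2 hp.2)
    hA1
    (fun v hv t ht => by
      have hsq : HasDerivAt (fun v : ℝ => v ^ 2) (2 * v) v := by
        simpa using (hasDerivAt_id v).fun_pow 2
      exact (dm _ (hmap v hv t ht)).comp v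
        (hsq.fun_add ((hsq.const_sub ys).mul_const (t ^ 2)))) (v := v) hv
  have hgap : ∀ v ∈ I, ∀ q ∈ uIcc qs q₀, 0 < slopeSq f q₀ q - v ^ 2 := by
    intro v hv q hq
    rw [uIcc_of_le hqs.2.le] at hq
    have hv' : v ^ 2 < r := hv
    linarith [hrq q hq]
  have cw' : ContinuousOn (fun p : ℝ × ℝ => momentumWeight f q₀ p.2) (I ×ˢ uIcc qs q₀) := by
    refine cw.comp continuousOn_snd fun p hp => ?_
    have := hp.2
    rwa [uIcc_of_le hqs.2.le] at this
  have hB1 : ContinuousOn (fun p : ℝ × ℝ => momentumWeight f q₀ p.2 * p.1 /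
      (2 * √(slopeSq f q₀ p.2 - p.1 ^ 2) ^ 3)) (I ×ˢ uIcc qs q₀) :=
    ContinuousOn.div (cw'.fun_mul continuousOn_fst) (Continuous.continuousOn (by fun_prop)) fun p hp => by
      have := Real.sqrt_pos.mpr (hgap p.1 hp.1 p.2 hp.2)
      positivity
  have hB := fun v hv => hasDerivAt_integral_of_continuousOn hIo (a := qs) (b := q₀)
    (H := fun v q => momentumWeight f q₀ q / (2 * √(slopeSq f q₀ q - v ^ 2)))
    (H' := fun v q => momentumWeight f q₀ q * v / (2 * √(slopeSq f q₀ q - v ^ 2) ^ 3))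
    (cw'.div (g := fun p : ℝ × ℝ => 2 * √(slopeSq f q₀ p.2 - p.1 ^ 2))
      (Continuous.continuousOn (by fun_prop)) fun p hp => by
        have := Real.sqrt_pos.mpr (hgap p.1 hp.1 p.2 hp.2)
        positivity)
    hB1
    (fun v hv q hq => by
      have hsq : HasDerivAt (fun v : ℝ => v ^ 2) (2 * v) v := by
        simpa using (hasDerivAt_id v).fun_pow 2
      have hg := hgap v hv q hq
      have hs := Real.sqrt_pos.mpr hg
      have := ((((hsq.const_sub (slopeSq f q₀ q)).sqrt hg.ne').const_mul 2).fun_inv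
        (by positivity)).const_mul (momentumWeight f q₀ q)
      simp only [← div_eq_mul_inv] at this
      refine this.congr_deriv ?_
      field_simp) (v := v) hv
  let b' : ℝ → ℝ := fun v => -(2 * v) / (2 * √(ys - v ^ 2))
  have hb : ∀ v ∈ I, HasDerivAt (fun v => √(ys - v ^ 2)) (b' v) v := by
    intro v hv
    have hsq : HasDerivAt (fun v : ℝ => v ^ 2) (2 * v) v := by
      simpa using (hasDerivAt_id v).fun_pow 2
    exact (hsq.const_sub ys).sqrt (hgap v hv qs left_mem_uIcc).ne'
  have h0I : (0 : ℝ) ∈ I := by simpa [hI] using hr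
  refine ⟨_, fun v hv => ((hb v hv).fun_mul (hA v hv).1).fun_add (hB v hv).1, ?_⟩
  have hb'c : ContinuousAt b' 0 := by
    have := Real.sqrt_pos.mpr (hgap 0 h0I qs left_mem_uIcc)
    refine ContinuousAt.div (by fun_prop) (by fun_prop) (by positivity)
  exact ((hb'c.mul (hA 0 h0I).1.continuousAt).add
    ((hb 0 h0I).continuousAt.mul (hA 0 h0I).2)).add (hB 0 h0I).2

/-- The one-sided limit of the derivative of the renormalized momentum at a kink. -/
theorem IsKink.momentum_deriv {U : ℝ → ℝ → ℂ} {φ₀ : ℝ → ℝ} (hq₀ : 0 < q₀) (hf : ContDiff ℝ 2 f)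
    (hf' : 0 < deriv f q₀) (h : IsBlackSoliton f q₀ U φ₀) (hk : IsKink q₀ φ₀) :
    (∀ᶠ v in 𝓝[>] (0 : ℝ), DifferentiableAt ℝ (fun s => momentum q₀ (U s)) v) ∧
    Tendsto (deriv fun s => momentum q₀ (U s)) (𝓝[>] (0 : ℝ))
      (𝓝 (2 * q₀ / √(slopeSq f q₀ q₀) +
        2 * ∫ x in Ioi (0 : ℝ), momentumWeight f q₀ (φ₀ x ^ 2) * (q₀ - φ₀ x ^ 2))) := by
  have hG := fun q (hq : q ∈ Icc 0 q₀) => hk.energyQuot_pos hq₀ hf hf' h hq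
  obtain ⟨qs, hqs, m, J, hJ, hsub, hm, hmw⟩ := exists_inverse_weight hf hq₀ hG
  have hslope : ∀ q, 0 < q → q ≤ q₀ → 0 < slopeSq f q₀ q := fun q h1 h2 => by
    have := hG q ⟨h1.le, h2⟩
    unfold slopeSq; positivity
  obtain ⟨qm, hqm, hmin⟩ := (isCompact_Icc (a := qs) (b := q₀)).exists_isMinOn
    (nonempty_Icc.mpr hqs.2.le) (continuous_slopeSq (q₀ := q₀) hf).continuousOn
  set r := slopeSq f q₀ qm with hr
  have hr0 : 0 < r := hslope qm (hqs.1.trans_le hqm.1) hqm.2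
  have hrq : ∀ q ∈ Icc qs q₀, r ≤ slopeSq f q₀ q := fun q hq => hmin hq
  obtain ⟨K, hK, hKc⟩ := hasDerivAt_weightIntegral hf hG hqs hJ hsub hm hr0 hrq
  set c := √(slopeSq f q₀ q₀) with hc
  have hc0 : 0 < c := Real.sqrt_pos.mpr (hslope q₀ hq₀ le_rfl)
  have hc2 : c ^ 2 = slopeSq f q₀ q₀ := Real.sq_sqrt (hslope q₀ hq₀ le_rfl).le
  have hK0 : ∫ x in Ioi (0 : ℝ), momentumWeight f q₀ (φ₀ x ^ 2) * (q₀ - φ₀ x ^ 2) =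
      weightIntegral f q₀ qs m 0 :=
    (hk.profile hq₀ hf hf' h).integral_weight hf hG hqs hm hmw (by simpa [hk.2.1] using hqs.1.le)
      fun q hq => by
        rw [zero_pow two_ne_zero]; exact hslope q (hqs.1.trans_le hq.1) hq.2
  -- A closed formula that is differentiable on a full neighbourhood of 0. It agrees with the
  -- momentum only for small v > 0, which suffices for one-sided limits.
  let P : ℝ → ℝ := fun v => -2 * (q₀ * Real.arccos (v / c) - v * weightIntegral f q₀ qs m v)
  let P' : ℝ → ℝ := fun v => -2 * (q₀ * (-(1 / √(1 - (v / c) ^ 2)) * (1 / c)) -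
    (1 * weightIntegral f q₀ qs m v + v * K v))
  have hsmall : ∀ᶠ v in 𝓝 (0 : ℝ), v ^ 2 < r := by
    have : Continuous fun v : ℝ => v ^ 2 := by fun_prop
    exact this.continuousAt.eventually_lt_const (by simpa using hr0)
  have hrc : r ≤ c ^ 2 := by rw [hc2]; exact hrq q₀ ⟨hqs.2.le, le_rfl⟩
  have hP : ∀ v, v ^ 2 < r → HasDerivAt P (P' v) v := by
    intro v hv
    have hlt : (v / c) ^ 2 < 1 := by
      rw [div_pow, div_lt_one (by positivity)]; linarith
    have h1 : v / c ≠ -1 := fun h => by rw [h] at hlt; norm_num at hlt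
    have h2 : v / c ≠ 1 := fun h => by rw [h] at hlt; norm_num at hlt
    have d1 := (Real.hasDerivAt_arccos h1 h2).comp v ((hasDerivAt_id v).div_const c)
    exact ((d1.const_mul q₀).sub ((hasDerivAt_id v).fun_mul (hK v hv))).const_mul (-2)
  have hP0 : Tendsto P' (𝓝[>] 0) (𝓝 (2 * q₀ / c + 2 * weightIntegral f q₀ qs m 0)) := by
    have c1 : ContinuousAt (fun v : ℝ => 1 / √(1 - (v / c) ^ 2)) 0 :=
      ContinuousAt.div (by fun_prop) (by fun_prop) (by simp)
    have c2 := (hK 0 (by simpa using hr0)).continuousAt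
    have c3 : ContinuousAt P' 0 := by
      simp only [P']
      fun_prop
    have := c3.tendsto.mono_left (nhdsWithin_le_nhds (s := Ioi 0))
    convert this using 2
    simp [P']
    ring
  have hsmall' := (eventually_nhdsWithin_of_eventually_nhds (s := Ioi 0) hsmall)
  have hq0 : Tendsto (fun v => ‖U v 0‖ ^ 2) (𝓝[>] 0) (𝓝 0) := by
    simpa [hk.2.1] using ((h.2.2 0).norm).pow 2
  have heq : ∀ᶠ v in 𝓝[>] (0 : ℝ), momentum q₀ (U v) = P v := by
    filter_upwards [h.1, hsmall', hq0.eventually_lt_const hqs.1, self_mem_nhdsWithin]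
      with v hv hvr hvq hv0
    have hv0' : 0 < v := hv0
    obtain ⟨q, s, hp, hUq, hpos, hcur⟩ := hv.exists_profile hq₀ hf
    rw [momentum_eq hp hUq hpos hcur, hp.integral_momentum hf hv0' hG hpos,
      hp.integral_weight hf hG hqs hm hmw (by rw [← hUq]; exact hvq.le)
        fun q hq => hvr.trans_le (hrq q hq)]
    -- The arctangent formula is singular at v = 0, while arccos(v/c) is smooth there.
    have : Real.arctan (√(slopeSq f q₀ q₀ - v ^ 2) / v) = Real.arccos (v / c) := by
      rw [Real.arccos_eq_arctan (by positivity)]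
      congr 1
      have : 1 - (v / c) ^ 2 = (slopeSq f q₀ q₀ - v ^ 2) / c ^ 2 := by
        rw [← hc2]; field_simp
      rw [this, Real.sqrt_div' _ (by positivity), Real.sqrt_sq hc0.le]
      field_simp
    rw [this]
  have heq2 : ∀ᶠ v in 𝓝[>] (0 : ℝ), HasDerivAt (fun s => momentum q₀ (U s)) (P' v) v := by
    have := eventually_eventually_nhdsWithin.mpr heq
    filter_upwards [this, hsmall', self_mem_nhdsWithin] with v hv hvr hv0
    rw [IsOpen.nhdsWithin_eq isOpen_Ioi hv0] at hv
    exact (hP v hvr).congr_of_eventuallyEq hv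
  refine ⟨heq2.mono fun v hv => hv.differentiableAt, ?_⟩
  rw [hK0]
  exact hP0.congr' (heq2.mono fun v hv => hv.deriv.symm)

/-! ### Positivity of the quadratic form -/

/-- Jacobi's argument: a positive increasing solution of `φ'' = 2Vφ` makes the quadratic form
non-negative on the half-line. -/
theorem halfline_form_nonneg {V φ φ' : ℝ → ℝ} (hV : Continuous V)
    (hφ : ∀ x, HasDerivAt φ (φ' x) x) (hφ' : ∀ x, HasDerivAt φ' (2 * V x * φ x) x)
    (hpos : ∀ x, 0 < x → 0 < φ x) (hmono : ∀ x, 0 < x → 0 ≤ φ' x)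
    {u u' : ℝ → ℂ} (hu : ∀ x, HasDerivAt u (u' x) x) (hu' : Continuous u')
    (hb : Tendsto (fun x => φ' x / φ x * ‖u x‖ ^ 2) (𝓝[>] 0) (𝓝 0))
    (hi : Integrable fun x => ‖u' x‖ ^ 2 / 2 + V x * ‖u x‖ ^ 2) :
    0 ≤ ∫ x in Ioi (0 : ℝ), (‖u' x‖ ^ 2 / 2 + V x * ‖u x‖ ^ 2) := by
  have cu : Continuous u := continuous_iff_continuousAt.mpr fun x => (hu x).continuousAt
  set e : ℝ → ℝ := fun x => ‖u' x‖ ^ 2 / 2 + V x * ‖u x‖ ^ 2 with he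
  have ce : Continuous e := by fun_prop
  have dI : ∀ x, HasDerivAt (fun x => ∫ t in (0 : ℝ)..x, e t) (e x) x := fun x =>
    intervalIntegral.integral_hasDerivAt_right (ce.intervalIntegrable _ _)
      (ce.stronglyMeasurableAtFilter _ _) ce.continuousAt
  -- Twice the form over [0, x] minus the boundary term. Its derivative is the square |u' -
  -- (φ'/φ)u|² and it starts from 0; dropping the non-negative boundary term at x gives the claim.
  let J : ℝ → ℝ := fun x => 2 * (∫ t in (0 : ℝ)..x, e t) - φ' x / φ x * ‖u x‖ ^ 2
  have dJ : ∀ x, 0 < x → HasDerivAt J (‖u' x - (φ' x / φ x) • u x‖ ^ 2) x := by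
    intro x hx
    have hp := hpos x hx
    refine (((dI x).const_mul 2).sub
      (((hφ' x).fun_div (hφ x) hp.ne').fun_mul (hu x).norm_sq)).congr_deriv ?_
    rw [norm_sub_sq_real, norm_smul, mul_pow, Real.norm_eq_abs, sq_abs, inner_smul_right,
      real_inner_comm (u x) (u' x)]
    simp only [he]
    field_simp
    ring
  have hJmono : MonotoneOn J (Ioi 0) := by
    refine monotoneOn_of_deriv_nonneg (convex_Ioi 0)
      (fun x hx => (dJ x hx).continuousAt.continuousWithinAt)
      (fun x hx => ?_) fun x hx => ?_
    · rw [interior_Ioi] at hx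
      exact (dJ x hx).differentiableAt.differentiableWithinAt
    · rw [interior_Ioi] at hx
      rw [(dJ x hx).deriv]; positivity
  have hJ0 : Tendsto J (𝓝[>] 0) (𝓝 0) := by
    have h1 : Tendsto (fun x => 2 * ∫ t in (0 : ℝ)..x, e t) (𝓝[>] 0) (𝓝 0) := by
      have := ((dI 0).continuousAt.tendsto.const_mul 2).mono_left
        (nhdsWithin_le_nhds (s := Ioi 0))
      simpa using this
    simpa using h1.sub hb
  have hJnn : ∀ x, 0 < x → 0 ≤ J x := by
    intro x hx
    refine le_of_tendsto hJ0 ?_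
    filter_upwards [Ioo_mem_nhdsGT hx] with y hy using hJmono hy.1 hx hy.2.le
  refine ge_of_tendsto (intervalIntegral_tendsto_integral_Ioi 0 hi.integrableOn tendsto_id) ?_
  filter_upwards [eventually_gt_atTop 0] with x hx
  have h1 := hJnn x hx
  have h2 : 0 ≤ φ' x / φ x * ‖u x‖ ^ 2 :=
    mul_nonneg (div_nonneg (hmono x hx) (hpos x hx).le) (sq_nonneg _)
  simp only [J] at h1
  simp only [id]
  linarith

/-- The quadratic form is non-negative on functions satisfying the boundary condition at zero,
for even potentials. -/
theorem form_nonneg {V φ φ' : ℝ → ℝ} (hV : Continuous V) (hVe : ∀ x, V (-x) = V x)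
    (hφ : ∀ x, HasDerivAt φ (φ' x) x) (hφ' : ∀ x, HasDerivAt φ' (2 * V x * φ x) x)
    (hpos : ∀ x, 0 < x → 0 < φ x) (hmono : ∀ x, 0 < x → 0 ≤ φ' x)
    {u u' : ℝ → ℂ} (hu : ∀ x, HasDerivAt u (u' x) x) (hu' : Continuous u')
    (hb : Tendsto (fun x => φ' x / φ x * ‖u x‖ ^ 2) (𝓝[>] 0) (𝓝 0))
    (hb' : Tendsto (fun x => φ' x / φ x * ‖u (-x)‖ ^ 2) (𝓝[>] 0) (𝓝 0))
    (hi : Integrable fun x => ‖u' x‖ ^ 2 / 2 + V x * ‖u x‖ ^ 2) :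
    0 ≤ ∫ x, (‖u' x‖ ^ 2 / 2 + V x * ‖u x‖ ^ 2) := by
  rw [← intervalIntegral.integral_Iic_add_Ioi (b := 0) hi.integrableOn hi.integrableOn]
  refine add_nonneg ?_ (halfline_form_nonneg hV hφ hφ' hpos hmono hu hu' hb hi)
  have hi' := hi.comp_neg
  have h := halfline_form_nonneg (u := fun x => u (-x)) (u' := fun x => -u' (-x)) hV hφ hφ' hpos
    hmono (fun x => by
      simpa [Function.comp_def] using (hu (-x)).scomp x (hasDerivAt_neg x)) (by fun_prop) hb'
    (by simpa only [norm_neg, hVe] using hi')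
  have := integral_comp_neg_Ioi (0 : ℝ) (fun x => ‖u' x‖ ^ 2 / 2 + V x * ‖u x‖ ^ 2)
  rw [neg_zero] at this
  rw [← this]
  simpa only [norm_neg, hVe] using h

/-- The boundary term at a simple zero of `φ`. -/
theorem tendsto_boundary_term {φ φ' : ℝ → ℝ} (hφ : HasDerivAt φ (φ' 0) 0) (h0 : φ 0 = 0)
    (h1 : φ' 0 ≠ 0) (hc : ContinuousAt φ' 0) {u : ℝ → ℂ} {d : ℂ} (hu : HasDerivAt u d 0)
    (hu0 : u 0 = 0) : Tendsto (fun x => φ' x / φ x * ‖u x‖ ^ 2) (𝓝[>] 0) (𝓝 0) := by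
  have hle : 𝓝[>] (0 : ℝ) ≤ 𝓝[≠] 0 := nhdsWithin_mono _ fun x hx => (ne_of_gt hx)
  have a1 := (hasDerivAt_iff_tendsto_slope.mp hφ).mono_left hle
  have a2 := (hasDerivAt_iff_tendsto_slope.mp hu).mono_left hle
  have a3 := hc.tendsto.mono_left (nhdsWithin_le_nhds (s := Ioi 0))
  have a4 : Tendsto (fun x : ℝ => x) (𝓝[>] 0) (𝓝 0) := nhdsWithin_le_nhds
  -- Both u and φ vanish linearly, so the product is φ'(x) divided by the slope of φ, times the
  -- squared slope of u, times x.
  have := ((a3.div a1 h1).mul (a2.norm.pow 2)).mul a4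
  rw [mul_zero] at this
  refine this.congr' ?_
  filter_upwards [self_mem_nhdsWithin] with x hx
  have hx' : (0 : ℝ) < x := hx
  simp only [Pi.div_apply, slope_def_field, slope_def_module, h0, hu0, sub_zero, norm_smul, norm_inv,
    Real.norm_of_nonneg hx'.le]
  field_simp

open scoped InnerProductSpace

/-! ### Cut-offs of bounded generalized solutions -/

theorem integrable_inv_one_add_mul_sq {T : ℝ} (hT : 0 < T) :
    Integrable (fun x : ℝ => (1 + T * x ^ 2)⁻¹) ∧ ∫ x : ℝ, (1 + T * x ^ 2)⁻¹ = Real.pi / √T := by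
  have hs : 0 < √T := Real.sqrt_pos.mpr hT
  have e : (fun x : ℝ => (1 + T * x ^ 2)⁻¹) = fun x => (1 + (√T * x) ^ 2)⁻¹ := by
    funext x; rw [mul_pow, Real.sq_sqrt hT.le]
  rw [e]
  refine ⟨integrable_inv_one_add_sq.comp_mul_left' hs.ne', ?_⟩
  rw [Measure.integral_comp_mul_left (fun x => (1 + x ^ 2)⁻¹), integral_univ_inv_one_add_sq,
    abs_of_pos (inv_pos.mpr hs), smul_eq_mul]
  field_simp

/-- Pointwise bounds for the cut-off function and its derivatives. -/
theorem cutoff_bounds {T : ℝ} (hT : 0 < T) (x : ℝ) :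
    0 < (1 + T * x ^ 2)⁻¹ ∧ (1 + T * x ^ 2)⁻¹ ≤ 1 ∧
    1 - (1 + T * x ^ 2)⁻¹ ≤ √T * |x| ∧
    |-(2 * T * x) * (1 + T * x ^ 2)⁻¹ ^ 2| ≤ √T * (1 + T * x ^ 2)⁻¹ ∧
    |-(2 * T) * (1 + T * x ^ 2)⁻¹ ^ 2 + 8 * T ^ 2 * x ^ 2 * (1 + T * x ^ 2)⁻¹ ^ 3| ≤
      10 * T * (1 + T * x ^ 2)⁻¹ := by
  set E := (1 + T * x ^ 2)⁻¹ with hE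
  have hpos : 0 < 1 + T * x ^ 2 := by positivity
  have hE0 : 0 < E := inv_pos.mpr hpos
  have hE1 : E ≤ 1 := inv_le_one_of_one_le₀ (by nlinarith [sq_nonneg x])
  have hmul : E * (1 + T * x ^ 2) = 1 := inv_mul_cancel₀ hpos.ne'
  have hTx : T * x ^ 2 * E ≤ 1 := by nlinarith
  have hs : √T ^ 2 = T := Real.sq_sqrt hT.le
  have hs0 : 0 < √T := Real.sqrt_pos.mpr hT
  have hxx : |x| ^ 2 = x ^ 2 := sq_abs x
  have h2 : 2 * (√T * |x|) ≤ 1 + T * x ^ 2 := by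
    nlinarith [sq_nonneg (√T * |x| - 1), mul_pow √T |x| 2]
  have h3 : 2 * (√T * |x|) * E ≤ 1 := by
    calc 2 * (√T * |x|) * E ≤ (1 + T * x ^ 2) * E := by gcongr
      _ = 1 := by rw [mul_comm, hmul]
  refine ⟨hE0, hE1, ?_, ?_, ?_⟩
  · have h4 : 1 - E = T * x ^ 2 * E := by linear_combination -hmul
    rw [h4]
    calc T * x ^ 2 * E = √T * |x| * (√T * |x| * E) := by rw [← hxx]; nth_rw 1 [← hs]; ring
      _ ≤ √T * |x| * 1 := by gcongr; linarith [mul_nonneg (mul_nonneg hs0.le (abs_nonneg x)) hE0.le]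
      _ = _ := mul_one _
  · rw [abs_mul, abs_neg, abs_mul, abs_of_pos (by positivity : 0 < 2 * T),
      abs_of_pos (pow_pos hE0 2)]
    calc 2 * T * |x| * E ^ 2 = √T * (2 * (√T * |x|) * E) * E := by nth_rw 1 [← hs]; ring
      _ ≤ √T * 1 * E := by gcongr
      _ = _ := by ring
  · have hE2 : E ^ 2 ≤ E := by nlinarith
    have hE3 : T * x ^ 2 * E * E ^ 2 ≤ 1 * E := by gcongr
    have hE30 : 0 ≤ T * x ^ 2 * E * E ^ 2 := by positivity
    rw [abs_le]
    constructor <;> nlinarith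

theorem hasDerivAt_cutoff {T : ℝ} (hT : 0 < T) (x : ℝ) :
    HasDerivAt (fun x : ℝ => (1 + T * x ^ 2)⁻¹) (-(2 * T * x) * (1 + T * x ^ 2)⁻¹ ^ 2) x ∧
    HasDerivAt (fun x : ℝ => -(2 * T * x) * (1 + T * x ^ 2)⁻¹ ^ 2)
      (-(2 * T) * (1 + T * x ^ 2)⁻¹ ^ 2 + 8 * T ^ 2 * x ^ 2 * (1 + T * x ^ 2)⁻¹ ^ 3) x := by
  have hpos : 0 < 1 + T * x ^ 2 := by positivity
  have h0 : HasDerivAt (fun x : ℝ => 1 + T * x ^ 2) (T * (2 * x)) x := by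
    simpa using (((hasDerivAt_id x).fun_pow 2).const_mul T).const_add 1
  have h1 : HasDerivAt (fun x : ℝ => (1 + T * x ^ 2)⁻¹) (-(2 * T * x) * (1 + T * x ^ 2)⁻¹ ^ 2) x :=
    (h0.fun_inv hpos.ne').congr_deriv (by field_simp)
  refine ⟨h1, ?_⟩
  have h2 : HasDerivAt (fun x : ℝ => -(2 * T * x)) (-(2 * T)) x := by
    simpa using ((hasDerivAt_id x).const_mul (2 * T)).fun_neg
  refine (h2.fun_mul (h1.fun_pow 2)).congr_deriv ?_
  simp only [Nat.cast_ofNat, Nat.add_one_sub_one, pow_one]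
  ring

theorem inner_ofReal_L2 {a b : L2} {α β : ℝ → ℝ} (ha : a =ᵐ[volume] fun x => (α x : ℂ))
    (hb : b =ᵐ[volume] fun x => (β x : ℂ)) : ⟪a, b⟫_ℂ = ((∫ x, α x * β x : ℝ) : ℂ) := by
  rw [L2.inner_def, ← integral_complex_ofReal]
  refine integral_congr_ae ?_
  filter_upwards [ha, hb] with x h1 h2
  rw [h1, h2, RCLike.inner_apply, Complex.conj_ofReal]
  push_cast; ring

theorem norm_sq_ofReal_L2 {a : L2} {α : ℝ → ℝ} (ha : a =ᵐ[volume] fun x => (α x : ℂ)) :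
    ‖a‖ ^ 2 = ∫ x, α x ^ 2 := by
  have h := inner_ofReal_L2 ha ha
  rw [inner_self_eq_norm_sq_to_K] at h
  have h' : ((‖a‖ ^ 2 : ℝ) : ℂ) = ((∫ x, α x * α x : ℝ) : ℂ) := by
    rw [← h]; push_cast; rfl
  rw [Complex.ofReal_inj.mp h']
  simp only [sq]

theorem memLp_two_of_bound {u b : ℝ → ℝ} (hu : Continuous u) (hb : Integrable b)
    (h : ∀ x, u x ^ 2 ≤ b x) : MemLp (fun x => (u x : ℂ)) 2 (volume : Measure ℝ) := by
  have cu : Continuous fun x => (u x : ℂ) := by fun_prop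
  rw [memLp_two_iff_integrable_sq_norm cu.aestronglyMeasurable]
  refine hb.mono' (by fun_prop) (Eventually.of_forall fun x => ?_)
  simpa using h x

theorem exists_schrodinger_ofReal {V y y' y'' : ℝ → ℝ} (hV : Continuous V)
    (hy : ∀ x, HasDerivAt y (y' x) x) (hy' : ∀ x, HasDerivAt y' (y'' x) x) (hc : Continuous y'')
    {b : ℝ → ℝ} (hb : Integrable b) (h0 : ∀ x, y x ^ 2 ≤ b x) (h1 : ∀ x, y' x ^ 2 ≤ b x)
    (h2 : ∀ x, y'' x ^ 2 ≤ b x) (h3 : ∀ x, (-(1 / 2) * y'' x + V x * y x) ^ 2 ≤ b x) :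
    ∃ w : (schrodinger V).domain, (w : L2) =ᵐ[volume] (fun x => (y x : ℂ)) ∧
      schrodinger V w =ᵐ[volume] fun x => ((-(1 / 2) * y'' x + V x * y x : ℝ) : ℂ) := by
  have cy : Continuous y := continuous_iff_continuousAt.mpr fun x => (hy x).continuousAt
  have cy' : Continuous y' := continuous_iff_continuousAt.mpr fun x => (hy' x).continuousAt
  have m0 := memLp_two_of_bound cy hb h0
  have m1 := memLp_two_of_bound cy' hb h1
  have m2 := memLp_two_of_bound hc hb h2
  have m3 := memLp_two_of_bound (u := fun x => -(1 / 2) * y'' x + V x * y x) (by fun_prop) hb h3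
  obtain ⟨hw, hk⟩ := schrodinger_of_graph (V := V) (k := m3.toLp)
    (hasWeakDeriv_toLp (fun x => (hy x).ofReal_comp) m0 m1)
    (hasWeakDeriv_toLp (fun x => (hy' x).ofReal_comp) m1 m2) (by
      filter_upwards [m0.coeFn_toLp, m2.coeFn_toLp, m3.coeFn_toLp] with x e0 e2 e3
      rw [e0, e2, e3]; push_cast; ring)
  refine ⟨⟨_, hw⟩, m0.coeFn_toLp, ?_⟩
  rw [hk]
  exact m3.coeFn_toLp

/-- The cut-off function, with its first two derivatives. -/
noncomputable def cutoff (T x : ℝ) : ℝ := (1 + T * x ^ 2)⁻¹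

noncomputable def cutoffDeriv (T x : ℝ) : ℝ := -(2 * T * x) * cutoff T x ^ 2

noncomputable def cutoffDeriv₂ (T x : ℝ) : ℝ :=
  -(2 * T) * cutoff T x ^ 2 + 8 * T ^ 2 * x ^ 2 * cutoff T x ^ 3

theorem abs_mul_le_mul_cutoff {p q P Q E : ℝ} (hp : |p| ≤ P) (hq : |q| ≤ Q * E) (hP : 0 ≤ P) :
    |p * q| ≤ P * Q * E := by
  rw [abs_mul, mul_assoc]
  exact mul_le_mul hp hq (abs_nonneg _) hP

/-- The expression is the defect k - (A + T)(g E) for E = 1/(1 + Tx²). Decay of k and g' pays for 1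
- E ≤ √T|x|, giving a square of order T. The bounded factor g meets only terms of size T E, whose
squared integral is of order T^(3/2). -/
theorem cutoff_remainder_sq_le {T : ℝ} (hT : 0 < T) {B D a b c x : ℝ}
    (hB : |a| ≤ B) (hb : |b| ≤ D * ((1 + x ^ 2) ^ 2)⁻¹) (hc : |c| ≤ D * ((1 + x ^ 2) ^ 2)⁻¹) :
    (c * (1 - cutoff T x) + b * cutoffDeriv T x +
        a * (1 / 2 * cutoffDeriv₂ T x - T * cutoff T x)) ^ 2 ≤
      8 * D ^ 2 * T * (1 + x ^ 2)⁻¹ + 72 * B ^ 2 * T ^ 2 * cutoff T x := by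
  have hB0 : 0 ≤ B := (abs_nonneg _).trans hB
  have hD0 : 0 ≤ D := by
    have := (abs_nonneg _).trans hb
    exact nonneg_of_mul_nonneg_left this (by positivity)
  have hsT : √T ^ 2 = T := Real.sq_sqrt hT.le
  have hsT0 : 0 < √T := Real.sqrt_pos.mpr hT
  obtain ⟨h0, h1, h2, h3, h4⟩ := cutoff_bounds hT x
  change |cutoffDeriv T x| ≤ √T * cutoff T x at h3
  change |cutoffDeriv₂ T x| ≤ 10 * T * cutoff T x at h4
  change 1 - cutoff T x ≤ _ at h2
  change 0 < cutoff T x at h0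
  change cutoff T x ≤ 1 at h1
  generalize cutoff T x = E at *
  generalize cutoffDeriv T x = E' at *
  generalize cutoffDeriv₂ T x = E'' at *
  have hx1 : |x| * ((1 + x ^ 2) ^ 2)⁻¹ ≤ (1 + x ^ 2)⁻¹ := by
    rw [sq (1 + x ^ 2), mul_inv, ← mul_assoc]
    refine mul_le_of_le_one_left (by positivity) ?_
    rw [← div_eq_mul_inv, div_le_one (by positivity)]
    nlinarith [sq_nonneg (|x| - 1), sq_abs x]
  have hw2 : ((1 + x ^ 2) ^ 2)⁻¹ ≤ (1 + x ^ 2)⁻¹ :=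
    inv_anti₀ (by positivity) (by nlinarith [sq_nonneg x, sq_nonneg (x ^ 2)])
  have a1 : |c * (1 - E)| ≤ D * √T * (1 + x ^ 2)⁻¹ := by
    rw [abs_mul, abs_of_nonneg (by linarith : 0 ≤ 1 - E)]
    calc |c| * (1 - E) ≤ D * ((1 + x ^ 2) ^ 2)⁻¹ * (√T * |x|) :=
          mul_le_mul hc h2 (by linarith) (by positivity)
      _ = D * √T * (|x| * ((1 + x ^ 2) ^ 2)⁻¹) := by ring
      _ ≤ _ := by gcongr
  have a2 : |b * E'| ≤ D * √T * (1 + x ^ 2)⁻¹ := by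
    rw [abs_mul]
    calc |b| * |E'| ≤ D * ((1 + x ^ 2) ^ 2)⁻¹ * (√T * E) :=
          mul_le_mul hb h3 (abs_nonneg _) (by positivity)
      _ ≤ D * (1 + x ^ 2)⁻¹ * (√T * 1) := by gcongr
      _ = _ := by ring
  have a3 : |1 / 2 * E'' - T * E| ≤ 6 * T * E := by
    have a1 := abs_sub (1 / 2 * E'') (T * E)
    rw [abs_mul, abs_of_pos (by norm_num : (0 : ℝ) < 1 / 2),
      abs_of_pos (by positivity : 0 < T * E)] at a1
    linarith
  have a4 := abs_mul_le_mul_cutoff hB a3 hB0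
  have hp : |c * (1 - E) + b * E'| ≤ 2 * D * √T * (1 + x ^ 2)⁻¹ := by
    have := abs_add_le (c * (1 - E)) (b * E')
    linarith
  generalize c * (1 - E) + b * E' = p at *
  generalize a * (1 / 2 * E'' - T * E) = r at *
  have hp2 : p ^ 2 ≤ 4 * D ^ 2 * T * (1 + x ^ 2)⁻¹ := by
    calc p ^ 2 = |p| ^ 2 := (sq_abs p).symm
      _ ≤ (2 * D * √T * (1 + x ^ 2)⁻¹) ^ 2 := pow_le_pow_left₀ (abs_nonneg _) hp 2
      _ = 4 * D ^ 2 * √T ^ 2 * ((1 + x ^ 2)⁻¹ * (1 + x ^ 2)⁻¹) := by ring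
      _ ≤ 4 * D ^ 2 * √T ^ 2 * ((1 + x ^ 2)⁻¹ * 1) := by
        gcongr
        exact inv_le_one_of_one_le₀ (by nlinarith [sq_nonneg x])
      _ = _ := by rw [hsT]; ring
  have hr2 : r ^ 2 ≤ 36 * B ^ 2 * T ^ 2 * E := by
    calc r ^ 2 = |r| ^ 2 := (sq_abs r).symm
      _ ≤ (B * (6 * T) * E) ^ 2 := pow_le_pow_left₀ (abs_nonneg _) a4 2
      _ = 36 * B ^ 2 * T ^ 2 * (E * E) := by ring
      _ ≤ 36 * B ^ 2 * T ^ 2 * (E * 1) := by gcongr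
      _ = _ := by ring
  have := sq_nonneg (p - r)
  nlinarith

/-- Every derivative of E is bounded by a multiple of E, so all functions involved have squares
dominated by a multiple of the integrable E. Boundedness of g, g' and k is enough for membership in
the domain. -/
theorem exists_cutoff {V g g' g'' k : ℝ → ℝ} (hV : Continuous V) {C : ℝ}
    (hC : ∀ x, |V x| ≤ C) (hg : ∀ x, HasDerivAt g (g' x) x) (hg' : ∀ x, HasDerivAt g' (g'' x) x)
    (hk : ∀ x, -(1 / 2) * g'' x + V x * g x = k x) (ck : Continuous k) {B D : ℝ}
    (hB : ∀ x, |g x| ≤ B) (hD : ∀ x, |g' x| ≤ D) (hkD : ∀ x, |k x| ≤ D) {T : ℝ} (hT : 0 < T) :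
    ∃ X : (schrodinger V).domain,
      (X : L2) =ᵐ[volume] (fun x => ((g x * cutoff T x : ℝ) : ℂ)) ∧
      schrodinger V X =ᵐ[volume] (fun x => ((k x * cutoff T x - g' x * cutoffDeriv T x -
        1 / 2 * (g x * cutoffDeriv₂ T x) : ℝ) : ℂ)) := by
  have hB0 : 0 ≤ B := (abs_nonneg _).trans (hB 0)
  have hD0 : 0 ≤ D := (abs_nonneg _).trans (hD 0)
  have hC0 : 0 ≤ C := (abs_nonneg _).trans (hC 0)
  have cg : Continuous g := continuous_iff_continuousAt.mpr fun x => (hg x).continuousAt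
  have cg' : Continuous g' := continuous_iff_continuousAt.mpr fun x => (hg' x).continuousAt
  have hg2 : ∀ x, g'' x = 2 * (V x * g x - k x) := fun x => by rw [← hk]; ring
  have cg'' : Continuous g'' := by rw [show g'' = _ from funext hg2]; fun_prop
  have hg2b : ∀ x, |g'' x| ≤ 2 * (C * B + D) := by
    intro x
    rw [hg2, abs_mul, abs_two]
    have hVg : |V x * g x| ≤ C * B := by
      rw [abs_mul]; exact mul_le_mul (hC x) (hB x) (abs_nonneg _) hC0
    have := abs_sub (V x * g x) (k x)
    linarith [hkD x]
  have dE : ∀ x, HasDerivAt (cutoff T) (cutoffDeriv T x) x := fun x => (hasDerivAt_cutoff hT x).1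
  have dE' : ∀ x, HasDerivAt (cutoffDeriv T) (cutoffDeriv₂ T x) x := fun x =>
    (hasDerivAt_cutoff hT x).2
  have cE : Continuous (cutoff T) := continuous_iff_continuousAt.mpr fun x => (dE x).continuousAt
  have cE' : Continuous (cutoffDeriv T) :=
    continuous_iff_continuousAt.mpr fun x => (dE' x).continuousAt
  have cE'' : Continuous (cutoffDeriv₂ T) := by unfold cutoffDeriv₂; fun_prop
  obtain ⟨iE, -⟩ := integrable_inv_one_add_mul_sq hT
  change Integrable (cutoff T) at iE
  have bE : ∀ x, 0 < cutoff T x ∧ cutoff T x ≤ 1 ∧ |cutoffDeriv T x| ≤ √T * cutoff T x ∧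
      |cutoffDeriv₂ T x| ≤ 10 * T * cutoff T x := fun x => by
    obtain ⟨h0, h1, -, h3, h4⟩ := cutoff_bounds hT x
    exact ⟨h0, h1, h3, h4⟩
  generalize cutoff T = E at *
  generalize cutoffDeriv T = E' at *
  generalize cutoffDeriv₂ T = E'' at *
  have bEE : ∀ x, |E x| ≤ 1 * E x := fun x => by rw [abs_of_pos (bE x).1, one_mul]
  set K := B + (D + B * √T) + (2 * (C * B + D) + 2 * (D * √T) + B * (10 * T)) +
    (D + D * √T + B * (10 * T)) with hK
  have hsq : ∀ {z L : ℝ} {x : ℝ}, |z| ≤ L * E x → L ≤ K → z ^ 2 ≤ K ^ 2 * E x := by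
    intro z L x hz hLK
    obtain ⟨hE0, hE1, -, -⟩ := bE x
    have hzK : |z| ≤ K * E x := hz.trans (mul_le_mul_of_nonneg_right hLK hE0.le)
    calc z ^ 2 = |z| ^ 2 := (sq_abs z).symm
      _ ≤ (K * E x) ^ 2 := pow_le_pow_left₀ (abs_nonneg _) hzK 2
      _ = K ^ 2 * (E x * E x) := by ring
      _ ≤ K ^ 2 * (E x * 1) := by gcongr
      _ = _ := by ring
  have n1 : 0 ≤ D * √T := by positivity
  have n2 : 0 ≤ B * √T := by positivity
  have n3 : 0 ≤ C * B := by positivity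
  have n4 : 0 ≤ B * (10 * T) := by positivity
  have by0 : ∀ x, |g x * E x| ≤ B * E x := fun x => by
    simpa using abs_mul_le_mul_cutoff (hB x) (bEE x) hB0
  have by1 : ∀ x, |g' x * E x + g x * E' x| ≤ (D + B * √T) * E x := by
    intro x
    have h1 := abs_mul_le_mul_cutoff (hD x) (bEE x) hD0
    have h2 := abs_mul_le_mul_cutoff (hB x) (bE x).2.2.1 hB0
    have h3 := abs_add_le (g' x * E x) (g x * E' x)
    linarith
  have by2 : ∀ x, |g'' x * E x + 2 * (g' x * E' x) + g x * E'' x| ≤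
      (2 * (C * B + D) + 2 * (D * √T) + B * (10 * T)) * E x := by
    intro x
    have h1 := abs_mul_le_mul_cutoff (hg2b x) (bEE x) (by positivity)
    have h2 := abs_mul_le_mul_cutoff (hD x) (bE x).2.2.1 hD0
    have h3 := abs_mul_le_mul_cutoff (hB x) (bE x).2.2.2 hB0
    have h4 := abs_add_le (g'' x * E x + 2 * (g' x * E' x)) (g x * E'' x)
    have h5 := abs_add_le (g'' x * E x) (2 * (g' x * E' x))
    rw [abs_mul 2, abs_two] at h5
    linarith
  have e3 : ∀ x, -(1 / 2) * (g'' x * E x + 2 * (g' x * E' x) + g x * E'' x) + V x * (g x * E x) =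
      k x * E x - g' x * E' x - 1 / 2 * (g x * E'' x) := fun x => by rw [← hk]; ring
  have by3 : ∀ x, |k x * E x - g' x * E' x - 1 / 2 * (g x * E'' x)| ≤
      (D + D * √T + B * (10 * T)) * E x := by
    intro x
    have h1 := abs_mul_le_mul_cutoff (hkD x) (bEE x) hD0
    have h2 := abs_mul_le_mul_cutoff (hD x) (bE x).2.2.1 hD0
    have h3 := abs_mul_le_mul_cutoff (hB x) (bE x).2.2.2 hB0
    have h4 := abs_sub (k x * E x - g' x * E' x) (1 / 2 * (g x * E'' x))
    have h5 := abs_sub (k x * E x) (g' x * E' x)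
    rw [abs_mul (1 / 2), abs_of_pos (by norm_num : (0 : ℝ) < 1 / 2)] at h4
    have := abs_nonneg (g x * E'' x)
    linarith
  obtain ⟨X, hX, hLX⟩ := exists_schrodinger_ofReal hV
    (y := fun x => g x * E x) (y' := fun x => g' x * E x + g x * E' x)
    (y'' := fun x => g'' x * E x + 2 * (g' x * E' x) + g x * E'' x)
    (fun x => (hg x).fun_mul (dE x))
    (fun x => (((hg' x).fun_mul (dE x)).fun_add ((hg x).fun_mul (dE' x))).congr_deriv (by ring))
    (by fun_prop) (iE.const_mul (K ^ 2))
    (fun x => hsq (by0 x) (by linarith)) (fun x => hsq (by1 x) (by linarith))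
    (fun x => hsq (by2 x) (by linarith))
    (fun x => by rw [e3]; exact hsq (by3 x) (by linarith))
  refine ⟨X, hX, ?_⟩
  filter_upwards [hLX] with x hx
  rw [hx, e3]

/-- Cut-offs `g / (1 + T x²)` of a bounded function `g` with `-g''/2 + Vg = k` decaying. -/
theorem exists_cutoff_family {V g g' g'' k : ℝ → ℝ} (hV : Continuous V) {C : ℝ}
    (hC : ∀ x, |V x| ≤ C) (hg : ∀ x, HasDerivAt g (g' x) x) (hg' : ∀ x, HasDerivAt g' (g'' x) x)
    (hk : ∀ x, -(1 / 2) * g'' x + V x * g x = k x) (ck : Continuous k) {B D : ℝ}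
    (hB : ∀ x, |g x| ≤ B) (hD : ∀ x, |g' x| ≤ D * ((1 + x ^ 2) ^ 2)⁻¹)
    (hkD : ∀ x, |k x| ≤ D * ((1 + x ^ 2) ^ 2)⁻¹) :
    ∃ (X : ℝ → (schrodinger V).domain) (M : ℝ), 0 ≤ M ∧ ∀ T ∈ Ioc (0 : ℝ) 1,
      (X T : L2) =ᵐ[volume] (fun x => ((g x * cutoff T x : ℝ) : ℂ)) ∧
      ‖(X T : L2)‖ ^ 2 * √T ≤ M ^ 2 ∧
      ∀ kL : L2, kL =ᵐ[volume] (fun x => (k x : ℂ)) →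
        ‖kL - (schrodinger V (X T) + (T : ℂ) • (X T : L2))‖ ≤ M * √T := by
  have hB0 : 0 ≤ B := (abs_nonneg _).trans (hB 0)
  have hD0 : 0 ≤ D := by simpa using (abs_nonneg _).trans (hD 0)
  have hw1 : ∀ x : ℝ, ((1 + x ^ 2) ^ 2)⁻¹ ≤ 1 := fun x =>
    inv_le_one_of_one_le₀ (by nlinarith [sq_nonneg x])
  have ex : ∀ T : ℝ, ∃ X : (schrodinger V).domain, 0 < T →
      (X : L2) =ᵐ[volume] (fun x => ((g x * cutoff T x : ℝ) : ℂ)) ∧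
      schrodinger V X =ᵐ[volume] (fun x => ((k x * cutoff T x - g' x * cutoffDeriv T x -
        1 / 2 * (g x * cutoffDeriv₂ T x) : ℝ) : ℂ)) := by
    intro T
    by_cases hT : 0 < T
    · obtain ⟨X, hX⟩ := exists_cutoff hV hC hg hg' hk ck hB
        (fun x => (hD x).trans (mul_le_of_le_one_right hD0 (hw1 x)))
        (fun x => (hkD x).trans (mul_le_of_le_one_right hD0 (hw1 x))) hT
      exact ⟨X, fun _ => hX⟩
    · exact ⟨0, fun h => absurd h hT⟩
  choose X hX using ex
  have hpi := Real.pi_pos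
  set M : ℝ := √((8 * D ^ 2 + 72 * B ^ 2) * Real.pi + B ^ 2 * Real.pi) with hM
  have hMsq : M ^ 2 = (8 * D ^ 2 + 72 * B ^ 2) * Real.pi + B ^ 2 * Real.pi :=
    Real.sq_sqrt (by positivity)
  refine ⟨X, M, Real.sqrt_nonneg _, fun T hT => ?_⟩
  obtain ⟨hT0, hT1⟩ := hT
  obtain ⟨h1, h2⟩ := hX T hT0
  have hsT : √T ^ 2 = T := Real.sq_sqrt hT0.le
  have hsT0 : 0 < √T := Real.sqrt_pos.mpr hT0
  have hsT1 : √T ≤ 1 := Real.sqrt_le_one.mpr hT1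
  obtain ⟨iE, vE⟩ := integrable_inv_one_add_mul_sq hT0
  change Integrable (cutoff T) at iE
  change ∫ x, cutoff T x = _ at vE
  refine ⟨h1, ?_, fun kL hkL => ?_⟩
  · have h3 : ‖(X T : L2)‖ ^ 2 ≤ B ^ 2 * (Real.pi / √T) := by
      rw [norm_sq_ofReal_L2 h1, ← vE, ← integral_const_mul]
      refine integral_mono_of_nonneg (Eventually.of_forall fun x => sq_nonneg _)
        (iE.const_mul _) (Eventually.of_forall fun x => ?_)
      obtain ⟨e0, e1, -⟩ := cutoff_bounds hT0 x
      change 0 < cutoff T x at e0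
      change cutoff T x ≤ 1 at e1
      have e2 : g x ^ 2 ≤ B ^ 2 := by
        rw [← sq_abs]; exact pow_le_pow_left₀ (abs_nonneg _) (hB x) 2
      calc (g x * cutoff T x) ^ 2 = g x ^ 2 * (cutoff T x * cutoff T x) := by ring
        _ ≤ B ^ 2 * (cutoff T x * 1) := by gcongr
        _ = B ^ 2 * cutoff T x := by ring
    calc ‖(X T : L2)‖ ^ 2 * √T ≤ B ^ 2 * (Real.pi / √T) * √T := by gcongr
      _ = B ^ 2 * Real.pi := by field_simp
      _ ≤ M ^ 2 := by rw [hMsq]; nlinarith [sq_nonneg D, sq_nonneg B]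
  · have hdiff : (kL - (schrodinger V (X T) + (T : ℂ) • (X T : L2)) : L2) =ᵐ[volume]
        fun x => ((k x * (1 - cutoff T x) + g' x * cutoffDeriv T x +
          g x * (1 / 2 * cutoffDeriv₂ T x - T * cutoff T x) : ℝ) : ℂ) := by
      filter_upwards [Lp.coeFn_sub kL (schrodinger V (X T) + (T : ℂ) • (X T : L2)),
        Lp.coeFn_add (schrodinger V (X T)) ((T : ℂ) • (X T : L2)),
        Lp.coeFn_smul (T : ℂ) (X T : L2), h1, h2, hkL] with x e1 e2 e3 e4 e5 e6
      rw [e1, Pi.sub_apply, e2, Pi.add_apply, e3, Pi.smul_apply, e4, e5, e6]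
      push_cast
      simp only [smul_eq_mul]
      ring
    have hn : ‖kL - (schrodinger V (X T) + (T : ℂ) • (X T : L2))‖ ^ 2 ≤ (M * √T) ^ 2 := by
      rw [norm_sq_ofReal_L2 hdiff]
      calc _ ≤ ∫ x, (8 * D ^ 2 * T * (1 + x ^ 2)⁻¹ + 72 * B ^ 2 * T ^ 2 * cutoff T x) :=
            integral_mono_of_nonneg (Eventually.of_forall fun x => sq_nonneg _)
              ((integrable_inv_one_add_sq.const_mul _).add (iE.const_mul _))
              (Eventually.of_forall fun x => cutoff_remainder_sq_le hT0 (hB x) (hD x) (hkD x))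
        _ = 8 * D ^ 2 * T * Real.pi + 72 * B ^ 2 * T ^ 2 * (Real.pi / √T) := by
            rw [integral_add (integrable_inv_one_add_sq.const_mul _) (iE.const_mul _),
              integral_const_mul, integral_const_mul, integral_univ_inv_one_add_sq, vE]
        _ = 8 * D ^ 2 * T * Real.pi + 72 * B ^ 2 * T * √T * Real.pi := by
            have : T ^ 2 * (Real.pi / √T) = T * √T * Real.pi := by
              field_simp; rw [hsT]
            linear_combination 72 * B ^ 2 * this
        _ ≤ 8 * D ^ 2 * T * Real.pi + 72 * B ^ 2 * T * 1 * Real.pi := by gcongr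
        _ = (8 * D ^ 2 + 72 * B ^ 2) * Real.pi * T := by ring
        _ ≤ (M * √T) ^ 2 := by
            rw [mul_pow, hMsq, hsT]
            have : 0 ≤ B ^ 2 * Real.pi * T := by positivity
            linarith
    exact (pow_le_pow_iff_left₀ (norm_nonneg _) (by positivity) two_ne_zero).mp hn

/-- The pairings of the cut-offs converge. -/
theorem tendsto_cutoff_pairing {g k : ℝ → ℝ} (cg : Continuous g) (ck : Continuous k) {B D : ℝ}
    (hB : ∀ x, |g x| ≤ B) (hkD : ∀ x, |k x| ≤ D * ((1 + x ^ 2) ^ 2)⁻¹) :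
    Tendsto (fun T => ∫ x, g x * cutoff T x * k x) (𝓝[>] (0 : ℝ))
      (𝓝 (∫ x, g x * k x)) := by
  have hB0 : 0 ≤ B := (abs_nonneg _).trans (hB 0)
  unfold cutoff
  refine tendsto_integral_filter_of_dominated_convergence
    (fun x => B * (D * ((1 + x ^ 2) ^ 2)⁻¹)) ?_ ?_
    ((integrable_inv_one_add_sq_sq.const_mul D).const_mul B) ?_
  · filter_upwards [self_mem_nhdsWithin] with T hT
    have hT' : (0 : ℝ) < T := hT
    have cE : Continuous fun x : ℝ => (1 + T * x ^ 2)⁻¹ :=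
      Continuous.inv₀ (by fun_prop) fun x => by positivity
    exact ((cg.mul cE).mul ck).aestronglyMeasurable
  · filter_upwards [self_mem_nhdsWithin] with T hT
    refine Eventually.of_forall fun x => ?_
    obtain ⟨h1, h2, -⟩ := cutoff_bounds hT x
    rw [norm_mul, norm_mul, Real.norm_of_nonneg h1.le]
    refine mul_le_mul ?_ (hkD x) (norm_nonneg _) hB0
    exact (mul_le_of_le_one_right (norm_nonneg _) h2).trans (hB x)
  · refine Eventually.of_forall fun x => ?_
    have c : ContinuousAt (fun T : ℝ => g x * (1 + T * x ^ 2)⁻¹ * k x) 0 := by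
      refine ContinuousAt.mul (continuousAt_const.mul (ContinuousAt.inv₀ (by fun_prop) ?_))
        continuousAt_const
      simp
    have := c.tendsto.mono_left (nhdsWithin_le_nhds (s := Ioi 0))
    simpa using this

/-- If `∫ g k < 0` then the operator has a negative direction. -/
theorem exists_negative_of_cutoff {V g g' g'' k : ℝ → ℝ} (hV : Continuous V) {C : ℝ}
    (hC : ∀ x, |V x| ≤ C) (hg : ∀ x, HasDerivAt g (g' x) x) (hg' : ∀ x, HasDerivAt g' (g'' x) x)
    (hk : ∀ x, -(1 / 2) * g'' x + V x * g x = k x) (ck : Continuous k) {B D : ℝ}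
    (hB : ∀ x, |g x| ≤ B) (hD : ∀ x, |g' x| ≤ D * ((1 + x ^ 2) ^ 2)⁻¹)
    (hkD : ∀ x, |k x| ≤ D * ((1 + x ^ 2) ^ 2)⁻¹) (hneg : ∫ x, g x * k x < 0) :
    ∃ ψ : (schrodinger V).domain, (⟪(ψ : L2), schrodinger V ψ⟫_ℂ).re < 0 := by
  obtain ⟨X, M, hM, hX⟩ := exists_cutoff_family hV hC hg hg' hk ck hB hD hkD
  have cg : Continuous g := continuous_iff_continuousAt.mpr fun x => (hg x).continuousAt
  have hD0 : 0 ≤ D := by simpa using (abs_nonneg _).trans (hD 0)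
  have mk := memLp_two_of_bound ck (integrable_inv_one_add_sq_sq.const_mul (D ^ 2)) fun x => by
    have h1 : k x ^ 2 ≤ (D * ((1 + x ^ 2) ^ 2)⁻¹) ^ 2 := by
      rw [← sq_abs]; exact pow_le_pow_left₀ (abs_nonneg _) (hkD x) 2
    refine h1.trans ?_
    rw [mul_pow]
    have hw0 : 0 < ((1 + x ^ 2) ^ 2)⁻¹ := by positivity
    have hw1 : ((1 + x ^ 2) ^ 2)⁻¹ ≤ 1 := inv_le_one_of_one_le₀ (by nlinarith [sq_nonneg x])
    gcongr
    nlinarith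
  have h1 := tendsto_cutoff_pairing cg ck hB hkD
  have h2 : Tendsto (fun T : ℝ => M ^ 2 * √√T) (𝓝[>] 0) (𝓝 0) := by
    have : Continuous fun T : ℝ => M ^ 2 * √√T := by fun_prop
    simpa using (this.tendsto 0).mono_left (nhdsWithin_le_nhds (s := Ioi 0))
  have h3 := h1.add h2
  rw [add_zero] at h3
  obtain ⟨T, hlt, hT⟩ := ((h3.eventually_lt_const hneg).and
    (Ioc_mem_nhdsGT (zero_lt_one' ℝ))).exists
  obtain ⟨e1, e2, e3⟩ := hX T hT
  refine ⟨X T, ?_⟩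
  have e4 := e3 _ mk.coeFn_toLp
  set kL : L2 := mk.toLp
  set R := kL - (schrodinger V (X T) + (T : ℂ) • (X T : L2)) with hR
  -- The form at X T is ∫ g E k, minus ⟨X, R⟩, minus T‖X‖². Here ‖X‖ = O(T^(-1/4)) and ‖R‖ = O(√T),
  -- so the error term is O(T^(1/4)) and the sign of ∫ g k decides.
  have e5 : schrodinger V (X T) = kL - R - (T : ℂ) • (X T : L2) := by rw [hR]; abel
  rw [e5, inner_sub_right, inner_sub_right, inner_smul_right, inner_self_eq_norm_sq_to_K,
    inner_ofReal_L2 e1 mk.coeFn_toLp, Complex.sub_re, Complex.sub_re, Complex.ofReal_re]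
  have e6 : (((T : ℂ) * ((‖(X T : L2)‖ : ℝ) : ℂ) ^ 2)).re = T * ‖(X T : L2)‖ ^ 2 := by
    rw [← Complex.ofReal_pow, ← Complex.ofReal_mul, Complex.ofReal_re]
  have e7 : -(⟪(X T : L2), R⟫_ℂ).re ≤ M ^ 2 * √√T := by
    have a1 : -(⟪(X T : L2), R⟫_ℂ).re ≤ ‖(X T : L2)‖ * ‖R‖ :=
      (neg_le_abs _).trans ((Complex.abs_re_le_norm _).trans (norm_inner_le_norm _ _))
    have hs0 : 0 < √√T := Real.sqrt_pos.mpr (Real.sqrt_pos.mpr hT.1)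
    have hs : √√T ^ 2 = √T := Real.sq_sqrt (Real.sqrt_nonneg _)
    have a2 : ‖(X T : L2)‖ * √√T ≤ M := by
      refine (pow_le_pow_iff_left₀ (by positivity) hM two_ne_zero).mp ?_
      rw [mul_pow, hs]; exact e2
    calc _ ≤ ‖(X T : L2)‖ * (M * √T) := a1.trans (by gcongr)
      _ = ‖(X T : L2)‖ * (M * √√T ^ 2) := by rw [hs]
      _ = (‖(X T : L2)‖ * √√T) * (M * √√T) := by ring
      _ ≤ M * (M * √√T) := by gcongr
      _ = _ := by ring
  have e8 : 0 ≤ T * ‖(X T : L2)‖ ^ 2 := mul_nonneg hT.1.le (sq_nonneg _)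
  have e9 : (((T : ℂ) * ((RCLike.ofReal ‖(X T : L2)‖ : ℂ)) ^ 2)).re = T * ‖(X T : L2)‖ ^ 2 := e6
  rw [e9]
  linarith

open scoped InnerProductSpace

variable {f : ℝ → ℝ} {q₀ v : ℝ}

/-! ### The operator at a black soliton -/

/-- The potential of `L₋`. -/
noncomputable def linPotential (f : ℝ → ℝ) (q₀ : ℝ) (φ₀ : ℝ → ℝ) (x : ℝ) : ℝ :=
  f (φ₀ x ^ 2) - f q₀

theorem continuous_linPotential (hf : ContDiff ℝ 2 f) {φ₀ : ℝ → ℝ} (hφ : Continuous φ₀) :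
    Continuous (linPotential f q₀ φ₀) := by
  have := hf.continuous
  unfold linPotential
  fun_prop

theorem exists_bound_linPotential (hf : ContDiff ℝ 2 f) {φ₀ : ℝ → ℝ} (hφ : ∀ x, φ₀ x ^ 2 ≤ q₀) :
    ∃ C, ∀ x, |linPotential f q₀ φ₀ x| ≤ C := by
  have := hf.continuous
  obtain ⟨M, hM⟩ := (isCompact_Icc (a := (0 : ℝ)) (b := q₀)).exists_bound_of_continuousOn
    (f := fun q => f q - f q₀) (by fun_prop)
  exact ⟨M, fun x => hM _ ⟨sq_nonneg _, hφ x⟩⟩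

theorem schrodinger_form_nonneg {V φ φ' : ℝ → ℝ} (hV : Continuous V) {C : ℝ}
    (hC : ∀ x, |V x| ≤ C) (hVe : ∀ x, V (-x) = V x)
    (hφ : ∀ x, HasDerivAt φ (φ' x) x) (hφ' : ∀ x, HasDerivAt φ' (2 * V x * φ x) x)
    (hpos : ∀ x, 0 < x → 0 < φ x) (hmono : ∀ x, 0 < x → 0 ≤ φ' x) (w : (schrodinger V).domain)
    (hb : ∀ u u' : ℝ → ℂ, (∀ x, HasDerivAt u (u' x) x) → u =ᵐ[volume] (w : L2) →
      Tendsto (fun x => φ' x / φ x * ‖u x‖ ^ 2) (𝓝[>] 0) (𝓝 0) ∧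
      Tendsto (fun x => φ' x / φ x * ‖u (-x)‖ ^ 2) (𝓝[>] 0) (𝓝 0)) :
    0 ≤ (⟪(w : L2), schrodinger V w⟫_ℂ).re := by
  obtain ⟨u, u', hu⟩ := schrodinger_exists_rep w
  obtain ⟨g, h, m, h₁, h₂, -⟩ := schrodinger_spec w
  have hr := hu g h h₁ h₂
  obtain ⟨hi, -, -, he, -⟩ := schrodinger_form hV hC w hu
  obtain ⟨b1, b2⟩ := hb u u' hr.hasDerivAt hr.ae_eq
  rw [he]
  exact form_nonneg hV hVe hφ hφ' hpos hmono hr.hasDerivAt hr.continuous b1 b2 hi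

theorem IsBubble.form_nonneg {U : ℝ → ℝ → ℂ} {φ₀ : ℝ → ℝ} (hq₀ : 0 < q₀) (hf : ContDiff ℝ 2 f)
    (h : IsBlackSoliton f q₀ U φ₀) (hb : IsBubble q₀ φ₀)
    (w : (schrodinger (linPotential f q₀ φ₀)).domain) :
    0 ≤ (⟪(w : L2), schrodinger (linPotential f q₀ φ₀) w⟫_ℂ).re := by
  obtain ⟨d0, d1, -⟩ := hasDerivAt_of_contDiff_two h.2.1
  obtain ⟨C, hC⟩ := exists_bound_linPotential hf (h.sq_le hq₀ hf)
  obtain ⟨hd0, hd, hpos⟩ := hb.pos hq₀ hf h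
  refine schrodinger_form_nonneg (continuous_linPotential hf h.2.1.continuous) hC
    (fun x => by simp only [linPotential, hb.1]) d0 (h.ode hq₀ hf) (fun x hx => hpos x hx.le)
    (fun x hx => (hd x hx).le) w fun u u' hu _ => ?_
  have cu : Continuous u := continuous_iff_continuousAt.mpr fun x => (hu x).continuousAt
  have key : ∀ z : ℝ → ℂ, Continuous z →
      Tendsto (fun x => deriv φ₀ x / φ₀ x * ‖z x‖ ^ 2) (𝓝[>] 0) (𝓝 0) := by
    intro z hz
    have c : ContinuousAt (fun x => deriv φ₀ x / φ₀ x * ‖z x‖ ^ 2) 0 :=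
      ((d1 0).continuousAt.div (d0 0).continuousAt (hpos 0 le_rfl).ne').mul (by fun_prop)
    have := c.tendsto.mono_left (nhdsWithin_le_nhds (s := Ioi 0))
    simpa [hd0] using this
  exact ⟨key u cu, key (fun x => u (-x)) (by fun_prop)⟩

/-- The value at zero, on the domain of a Schrödinger operator. -/
theorem exists_evalZero {V : ℝ → ℝ} (hV : Continuous V) {C : ℝ} (hC : ∀ x, |V x| ≤ C) :
    ∃ ε : (schrodinger V).domain →ₗ[ℂ] ℂ, ∀ (w : (schrodinger V).domain) (u : ℝ → ℂ),
      Continuous u → u =ᵐ[volume] (w : L2) → ε w = u 0 :=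
  ⟨evalZero ∘ₗ Submodule.inclusion (schrodinger_domain hV hC).le, fun w _ hu h =>
    evalZero_eq (w := Submodule.inclusion (schrodinger_domain hV hC).le w) hu h⟩

/-! ### L₋ at a kink: non-negative when w(0) = 0, and negative somewhere. -/

section Kink

variable {U : ℝ → ℝ → ℂ} {φ₀ : ℝ → ℝ}

theorem IsKink.strictMono (hq₀ : 0 < q₀) (hf : ContDiff ℝ 2 f) (hf' : 0 < deriv f q₀)
    (h : IsBlackSoliton f q₀ U φ₀) (hk : IsKink q₀ φ₀) : StrictMono φ₀ :=
  strictMono_of_deriv_pos (hk.deriv_pos hq₀ hf hf' h)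

/-- The functional is evaluation at the origin: φ₀ is positive and increasing on the right half-line
with a simple zero at 0, so Jacobi's boundary term vanishes once u(0) = 0. -/
theorem IsKink.form_nonneg (hq₀ : 0 < q₀) (hf : ContDiff ℝ 2 f) (hf' : 0 < deriv f q₀)
    (h : IsBlackSoliton f q₀ U φ₀) (hk : IsKink q₀ φ₀) :
    ∃ ε : (schrodinger (linPotential f q₀ φ₀)).domain →ₗ[ℂ] ℂ,
      ∀ w, ε w = 0 → 0 ≤ (⟪(w : L2), schrodinger (linPotential f q₀ φ₀) w⟫_ℂ).re := by
  obtain ⟨d0, d1, -⟩ := hasDerivAt_of_contDiff_two h.2.1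
  obtain ⟨C, hC⟩ := exists_bound_linPotential hf (h.sq_le hq₀ hf)
  have hV := continuous_linPotential (q₀ := q₀) hf h.2.1.continuous
  obtain ⟨ε, hε⟩ := exists_evalZero hV hC
  have hd := hk.deriv_pos hq₀ hf hf' h
  refine ⟨ε, fun w hw => schrodinger_form_nonneg hV hC
    (fun x => by simp only [linPotential, hk.1, neg_sq]) d0 (h.ode hq₀ hf) (fun x hx => ?_)
    (fun x _ => (hd x).le) w fun u u' hu hue => ?_⟩
  · have := hk.strictMono hq₀ hf hf' h hx
    rwa [hk.2.1] at this
  · have cu : Continuous u := continuous_iff_continuousAt.mpr fun x => (hu x).continuousAt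
    have hu0 : u 0 = 0 := by rw [← hε w u cu hue, hw]
    have hun : HasDerivAt (fun x => u (-x)) (-u' 0) 0 := by
      have h1 : HasDerivAt u (u' 0) (-0) := by rw [neg_zero]; exact hu 0
      simpa [Function.comp_def] using h1.scomp (0 : ℝ) (hasDerivAt_neg (0 : ℝ))
    exact ⟨tendsto_boundary_term (d0 0) hk.2.1 (hd 0).ne' (d1 0).continuousAt (hu 0) hu0,
      tendsto_boundary_term (u := fun x => u (-x)) (d0 0) hk.2.1 (hd 0).ne' (d1 0).continuousAt hun
        (by simpa using hu0)⟩

/-- Decay of the derivative and of the potential of a kink. -/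
theorem IsKink.exists_decay (hq₀ : 0 < q₀) (hf : ContDiff ℝ 2 f) (hf' : 0 < deriv f q₀)
    (h : IsBlackSoliton f q₀ U φ₀) (hk : IsKink q₀ φ₀) :
    ∃ D : ℝ, 0 ≤ D ∧ (∀ x, deriv φ₀ x ≤ D * ((1 + x ^ 2) ^ 2)⁻¹) ∧
      ∀ x, |linPotential f q₀ φ₀ x| ≤ D * ((1 + x ^ 2) ^ 2)⁻¹ := by
  have hp := hk.profile hq₀ hf hf' h
  obtain ⟨D, hD0, hD⟩ := hp.exists_decay
  have c0 := continuous_energyQuot (q₀ := q₀) hf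
  have c1 := continuous_energyQuotDeriv (q₀ := q₀) hf
  obtain ⟨M, hM⟩ := (isCompact_Icc (a := (0 : ℝ)) (b := q₀)).exists_bound_of_continuousOn
    (f := fun q => √(2 * energyQuot f q₀ q)) (by fun_prop)
  obtain ⟨N, hN⟩ := (isCompact_Icc (a := (0 : ℝ)) (b := q₀)).exists_bound_of_continuousOn
    (f := fun q => 2 * energyQuot f q₀ q + (q - q₀) * energyQuotDeriv f q₀ q) (by fun_prop)
  have hM0 : 0 ≤ M := (norm_nonneg _).trans (hM 0 ⟨le_rfl, hq₀.le⟩)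
  have hN0 : 0 ≤ N := (norm_nonneg _).trans (hN 0 ⟨le_rfl, hq₀.le⟩)
  have hw : ∀ x : ℝ, 0 ≤ ((1 + x ^ 2) ^ 2)⁻¹ := fun x => by positivity
  refine ⟨D * M + D * N, by positivity, fun x => ?_, fun x => ?_⟩
  · rw [hk.deriv_eq hq₀ hf hf' h]
    have h1 := (le_abs_self _).trans (hM _ (hp.mem_Icc x))
    calc _ ≤ (D * ((1 + x ^ 2) ^ 2)⁻¹) * M :=
          mul_le_mul (hD x) h1 (Real.sqrt_nonneg _) (mul_nonneg hD0 (hw x))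
      _ ≤ _ := by
        have := mul_nonneg (mul_nonneg hD0 hN0) (hw x)
        linarith
  · rw [linPotential, sub_eq_energyQuot hf]
    have e : 2 * (φ₀ x ^ 2 - q₀) * energyQuot f q₀ (φ₀ x ^ 2) +
        (φ₀ x ^ 2 - q₀) ^ 2 * energyQuotDeriv f q₀ (φ₀ x ^ 2) =
        -((q₀ - φ₀ x ^ 2) * (2 * energyQuot f q₀ (φ₀ x ^ 2) +
          (φ₀ x ^ 2 - q₀) * energyQuotDeriv f q₀ (φ₀ x ^ 2))) := by ring
    rw [e, abs_neg, abs_mul, abs_of_pos (sub_pos.mpr (hp.lt x))]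
    calc _ ≤ (D * ((1 + x ^ 2) ^ 2)⁻¹) * N :=
          mul_le_mul (hD x) (hN _ (hp.mem_Icc x)) (abs_nonneg _) (mul_nonneg hD0 (hw x))
      _ ≤ _ := by
        have := mul_nonneg (mul_nonneg hD0 hM0) (hw x)
        linarith

/-- The integral of `φ'² / (φ² + δ²)` is large for small `δ`. -/
theorem exists_large_integral {φ φ' : ℝ → ℝ} (hφ : ∀ x, HasDerivAt φ (φ' x) x)
    (hc : Continuous φ') (h0 : φ 0 = 0) (hpos : ∀ x, 0 < φ' x) {D : ℝ} (hD : ∀ x, φ' x ≤ D)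
    (hi : ∀ δ > 0, Integrable fun x => φ' x ^ 2 / (φ x ^ 2 + δ ^ 2)) (R : ℝ) :
    ∃ δ > 0, R < ∫ x, φ' x ^ 2 / (φ x ^ 2 + δ ^ 2) := by
  obtain ⟨xm, -, hmin⟩ := (isCompact_Icc (a := (0 : ℝ)) (b := 1)).exists_isMinOn
    (nonempty_Icc.mpr zero_le_one) hc.continuousOn
  set m := φ' xm with hm
  have hm0 : 0 < m := hpos xm
  have hD0 : 0 < D := (hpos 0).trans_le (hD 0)
  set R' := |R| + 1 with hR'
  have hR0 : 0 < R' := by positivity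
  -- On [0, δ] one has φ ≤ Dδ and φ' ≥ m, so the integral is at least m²/((D² + 1)δ), and this δ
  -- makes it at least R'.
  set δ := min 1 (m ^ 2 / ((D ^ 2 + 1) * R')) with hδ
  have hδ0 : 0 < δ := lt_min one_pos (by positivity)
  have hδ1 : δ ≤ 1 := min_le_left _ _
  have hδ2 : δ * ((D ^ 2 + 1) * R') ≤ m ^ 2 := by
    rw [← le_div_iff₀ (by positivity)]; exact min_le_right _ _
  refine ⟨δ, hδ0, ?_⟩
  have hφb : ∀ x ∈ Icc 0 δ, 0 ≤ φ x ∧ φ x ≤ D * δ := by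
    intro x hx
    have hmono : StrictMono φ := strictMono_of_deriv_pos fun x => by rw [(hφ x).deriv]; exact hpos x
    refine ⟨h0 ▸ hmono.monotone hx.1, ?_⟩
    have := image_le_of_deriv_right_le_deriv_boundary (f := φ) (f' := φ') (a := 0) (b := x)
      (B := fun x => D * x) (B' := fun _ => D)
      (continuous_iff_continuousAt.mpr fun x => (hφ x).continuousAt).continuousOn
      (fun x _ => (hφ x).hasDerivWithinAt) (by simp [h0]) (by fun_prop)
      (fun x _ => by simpa using ((hasDerivAt_id x).const_mul D).hasDerivWithinAt)
      (fun x _ => hD x) (right_mem_Icc.mpr hx.1)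
    exact this.trans (by have := hx.2; gcongr)
  have hlow : ∀ x ∈ Icc 0 δ, m ^ 2 / ((D ^ 2 + 1) * δ ^ 2) ≤ φ' x ^ 2 / (φ x ^ 2 + δ ^ 2) := by
    intro x hx
    have h1 : m ≤ φ' x := hmin ⟨hx.1, hx.2.trans hδ1⟩
    obtain ⟨h2, h3⟩ := hφb x hx
    have h4 : φ x ^ 2 ≤ (D * δ) ^ 2 := pow_le_pow_left₀ h2 h3 2
    gcongr
    linarith [mul_pow D δ 2]
  calc R < R' := by linarith [le_abs_self R]
    _ ≤ δ * (m ^ 2 / ((D ^ 2 + 1) * δ ^ 2)) := by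
      have : δ * (m ^ 2 / ((D ^ 2 + 1) * δ ^ 2)) = m ^ 2 / ((D ^ 2 + 1) * δ) := by
        field_simp
      rw [this, le_div_iff₀ (by positivity)]
      linarith
    _ = ∫ x in Icc 0 δ, m ^ 2 / ((D ^ 2 + 1) * δ ^ 2) := by
      simp [hδ0.le]
    _ ≤ ∫ x in Icc 0 δ, φ' x ^ 2 / (φ x ^ 2 + δ ^ 2) :=
      setIntegral_mono_on (by simp) (hi δ hδ0).integrableOn measurableSet_Icc hlow
    _ ≤ _ := setIntegral_le_integral (hi δ hδ0) (Eventually.of_forall fun x => by positivity)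

/-- The operator at a kink is not non-negative. -/
theorem IsKink.exists_negative (hq₀ : 0 < q₀) (hf : ContDiff ℝ 2 f) (hf' : 0 < deriv f q₀)
    (h : IsBlackSoliton f q₀ U φ₀) (hk : IsKink q₀ φ₀) :
    ∃ ψ : (schrodinger (linPotential f q₀ φ₀)).domain,
      (⟪(ψ : L2), schrodinger (linPotential f q₀ φ₀) ψ⟫_ℂ).re < 0 := by
  obtain ⟨d0, -, -⟩ := hasDerivAt_of_contDiff_two h.2.1
  have d1 := h.ode hq₀ hf
  obtain ⟨C, hC⟩ := exists_bound_linPotential hf (h.sq_le hq₀ hf)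
  have cφ := h.2.1.continuous
  have cV := continuous_linPotential (q₀ := q₀) hf cφ
  have cφ' : Continuous (deriv φ₀) := continuous_iff_continuousAt.mpr fun x => (d1 x).continuousAt
  have hpos := hk.deriv_pos hq₀ hf hf' h
  obtain ⟨D, hD0, hDφ, hDV⟩ := hk.exists_decay hq₀ hf hf' h
  change ∀ x, HasDerivAt (deriv φ₀) (2 * linPotential f q₀ φ₀ x * φ₀ x) x at d1
  generalize linPotential f q₀ φ₀ = V at *
  set w : ℝ → ℝ := fun x => ((1 + x ^ 2) ^ 2)⁻¹ with hwdef
  have hw0 : ∀ x, 0 < w x := fun x => by simp only [hwdef]; positivity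
  have hw1 : ∀ x, w x ≤ 1 := fun x => inv_le_one_of_one_le₀ (by nlinarith [sq_nonneg x])
  have hφsq : ∀ x, deriv φ₀ x ^ 2 ≤ D ^ 2 * w x := by
    intro x
    calc deriv φ₀ x ^ 2 ≤ (D * w x) ^ 2 := pow_le_pow_left₀ (hpos x).le (hDφ x) 2
      _ = D ^ 2 * (w x * w x) := by ring
      _ ≤ D ^ 2 * (w x * 1) := by have := (hw0 x).le; gcongr; exact hw1 x
      _ = _ := by ring
  have hi : ∀ δ > 0, Integrable fun x => deriv φ₀ x ^ 2 / (φ₀ x ^ 2 + δ ^ 2) := by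
    intro δ hδ
    refine (integrable_inv_one_add_sq_sq.const_mul (D ^ 2 / δ ^ 2)).mono'
      (Continuous.aestronglyMeasurable (Continuous.div (by fun_prop) (by fun_prop)
        fun x => by positivity)) (Eventually.of_forall fun x => ?_)
    rw [Real.norm_of_nonneg (by positivity), div_mul_eq_mul_div]
    gcongr
    · exact hφsq x
    · nlinarith [sq_nonneg (φ₀ x)]
  have hVi : Integrable V := (integrable_inv_one_add_sq_sq.const_mul D).mono'
    cV.aestronglyMeasurable (Eventually.of_forall hDV)
  -- The threshold 2∫V is what makes ∫ g k = δ²(∫V - ½∫φ₀'²/(φ₀² + δ²)) negative below.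
  obtain ⟨δ, hδ, hlarge⟩ := exists_large_integral d0 cφ' hk.2.1 hpos
    (fun x => (hDφ x).trans (mul_le_of_le_one_right hD0 (hw1 x))) hi (2 * ∫ x, V x)
  -- A smoothing of |φ₀|, whose corner at the zero of φ₀ supplies the negative energy.
  set g : ℝ → ℝ := fun x => √(φ₀ x ^ 2 + δ ^ 2) with hg
  have hgp : ∀ x, 0 < φ₀ x ^ 2 + δ ^ 2 := fun x => by positivity
  have hg0 : ∀ x, 0 < g x := fun x => Real.sqrt_pos.mpr (hgp x)
  have hgsq : ∀ x, g x ^ 2 = φ₀ x ^ 2 + δ ^ 2 := fun x => Real.sq_sqrt (hgp x).le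
  have hgδ : ∀ x, δ ≤ g x := fun x => Real.le_sqrt_of_sq_le (by nlinarith [sq_nonneg (φ₀ x)])
  have cg : Continuous g := by fun_prop
  have dg : ∀ x, HasDerivAt g (φ₀ x * deriv φ₀ x / g x) x := by
    intro x
    have hsq : HasDerivAt (fun x => φ₀ x ^ 2 + δ ^ 2) (2 * φ₀ x * deriv φ₀ x) x := by
      simpa using ((d0 x).fun_pow 2).add_const (δ ^ 2)
    refine (hsq.sqrt (hgp x).ne').congr_deriv ?_
    have := (hg0 x).ne'
    change 2 * φ₀ x * deriv φ₀ x / (2 * g x) = _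
    field_simp
  have dg' := fun x => ((d0 x).fun_mul (d1 x)).fun_div (dg x) (hg0 x).ne'
  set k : ℝ → ℝ := fun x => δ ^ 2 * (V x - 1 / 2 * (deriv φ₀ x ^ 2 / (φ₀ x ^ 2 + δ ^ 2))) / g x
    with hk_def
  have ck : Continuous k := by
    refine Continuous.div (continuous_const.mul (cV.sub (continuous_const.mul
      (Continuous.div (by fun_prop) (by fun_prop) fun x => (hgp x).ne')))) cg fun x => (hg0 x).ne'
  have hkb : ∀ x, |k x| ≤ (δ ^ 2 * (D + 1 / 2 * (D ^ 2 / δ ^ 2)) / δ) * w x := by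
    intro x
    have a1 : |deriv φ₀ x ^ 2 / (φ₀ x ^ 2 + δ ^ 2)| ≤ D ^ 2 / δ ^ 2 * w x := by
      rw [abs_of_nonneg (by positivity), div_mul_eq_mul_div]
      gcongr
      · exact hφsq x
      · nlinarith [sq_nonneg (φ₀ x)]
    have a2 := abs_sub (V x) (1 / 2 * (deriv φ₀ x ^ 2 / (φ₀ x ^ 2 + δ ^ 2)))
    rw [abs_mul (1 / 2), abs_of_pos (by norm_num : (0 : ℝ) < 1 / 2)] at a2
    have a3 : |V x - 1 / 2 * (deriv φ₀ x ^ 2 / (φ₀ x ^ 2 + δ ^ 2))| ≤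
        (D + 1 / 2 * (D ^ 2 / δ ^ 2)) * w x := by
      have := hDV x
      have e : (D + 1 / 2 * (D ^ 2 / δ ^ 2)) * w x = D * w x + 1 / 2 * (D ^ 2 / δ ^ 2 * w x) := by
        ring
      rw [e]
      linarith
    have := hw0 x
    simp only [hk_def]
    rw [abs_div, abs_mul, abs_of_pos (hg0 x), abs_of_pos (by positivity : 0 < δ ^ 2)]
    calc _ ≤ δ ^ 2 * ((D + 1 / 2 * (D ^ 2 / δ ^ 2)) * w x) / δ := by
          gcongr
          exact hgδ x
      _ = _ := by ring
  have hg'b : ∀ x, |φ₀ x * deriv φ₀ x / g x| ≤ D * w x := by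
    intro x
    have a1 : |φ₀ x| ≤ g x := Real.abs_le_sqrt (by nlinarith)
    rw [abs_div, abs_mul, abs_of_pos (hg0 x), abs_of_pos (hpos x), div_le_iff₀ (hg0 x)]
    calc |φ₀ x| * deriv φ₀ x ≤ g x * (D * w x) :=
          mul_le_mul a1 (hDφ x) (hpos x).le (hg0 x).le
      _ = _ := by ring
  set D' := D + δ ^ 2 * (D + 1 / 2 * (D ^ 2 / δ ^ 2)) / δ with hD'
  have hD2 : 0 ≤ δ ^ 2 * (D + 1 / 2 * (D ^ 2 / δ ^ 2)) / δ := by positivity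
  refine exists_negative_of_cutoff cV hC dg dg' (k := k) (fun x => ?_) ck
    (B := √(q₀ + δ ^ 2)) (D := D') (fun x => ?_) (fun x => (hg'b x).trans ?_)
    (fun x => (hkb x).trans ?_) ?_
  · have e1 := hgsq x
    have e2 := (hg0 x).ne'
    simp only [hk_def, ← e1]
    field_simp
    have e3 : φ₀ x ^ 2 = g x ^ 2 - δ ^ 2 := by rw [e1]; ring
    linear_combination (deriv φ₀ x ^ 2 - 2 * V x * g x ^ 2) * e3
  · rw [abs_of_pos (hg0 x)]
    exact Real.sqrt_le_sqrt (by linarith [h.sq_le hq₀ hf x])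
  · exact mul_le_mul_of_nonneg_right (by linarith) (hw0 x).le
  · exact mul_le_mul_of_nonneg_right (by linarith) (hw0 x).le
  · have e : ∀ x, g x * k x = δ ^ 2 * (V x - 1 / 2 * (deriv φ₀ x ^ 2 / (φ₀ x ^ 2 + δ ^ 2))) :=
      fun x => by simp only [hk_def]; have := (hg0 x).ne'; field_simp
    simp_rw [e]
    rw [integral_const_mul, integral_sub hVi ((hi δ hδ).const_mul _), integral_const_mul]
    have : 0 < δ ^ 2 := by positivity
    nlinarith

end Kink

open scoped InnerProductSpace

variable {f : ℝ → ℝ} {q₀ v : ℝ}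

/-! ### The bounded solution of L₋χ = φ₀' and its pairing with φ₀'. -/

section Kink

variable {U : ℝ → ℝ → ℂ} {φ₀ : ℝ → ℝ}

/-- The bounded function `χ` with `L₋ χ = φ₀'`. -/
theorem IsKink.exists_generalized_resolvent (hq₀ : 0 < q₀) (hf : ContDiff ℝ 2 f)
    (hf' : 0 < deriv f q₀) (h : IsBlackSoliton f q₀ U φ₀) (hk : IsKink q₀ φ₀) :
    ∃ (χ χ' χ'' : ℝ → ℝ) (B D : ℝ), (∀ x, HasDerivAt χ (χ' x) x) ∧
      (∀ x, HasDerivAt χ' (χ'' x) x) ∧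
      (∀ x, -(1 / 2) * χ'' x + linPotential f q₀ φ₀ x * χ x = deriv φ₀ x) ∧
      (∀ x, |χ x| ≤ B) ∧ (∀ x, |χ' x| ≤ D * ((1 + x ^ 2) ^ 2)⁻¹) ∧
      (∀ x, |deriv φ₀ x| ≤ D * ((1 + x ^ 2) ^ 2)⁻¹) ∧
      ∫ x, χ x * deriv φ₀ x = -(q₀ / √(slopeSq f q₀ q₀) +
        ∫ x in Ioi (0 : ℝ), momentumWeight f q₀ (φ₀ x ^ 2) * (q₀ - φ₀ x ^ 2)) := by
  obtain ⟨d0, -, -⟩ := hasDerivAt_of_contDiff_two h.2.1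
  have d1 := h.ode hq₀ hf
  have hp := hk.profile hq₀ hf hf' h
  have cφ := h.2.1.continuous
  have cφ' : Continuous (deriv φ₀) := continuous_iff_continuousAt.mpr fun x => (d1 x).continuousAt
  have hpos := hk.deriv_pos hq₀ hf hf' h
  have hder := hk.deriv_eq hq₀ hf hf' h
  obtain ⟨D, hD0, hDφ, -⟩ := hk.exists_decay hq₀ hf hf' h
  have hGpos : ∀ q ∈ Icc 0 q₀, 0 < energyQuot f q₀ q := fun q hq =>
    hk.energyQuot_pos hq₀ hf hf' h hq
  have c0 := continuous_energyQuot (q₀ := q₀) hf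
  have c1 := continuous_energyQuotDeriv (q₀ := q₀) hf
  have dG := fun q => hasDerivAt_energyQuot (q₀ := q₀) hf q
  have hVeq : ∀ x, linPotential f q₀ φ₀ x = -(2 * (q₀ - φ₀ x ^ 2) * energyQuot f q₀ (φ₀ x ^ 2)) +
      (q₀ - φ₀ x ^ 2) ^ 2 * energyQuotDeriv f q₀ (φ₀ x ^ 2) := fun x => by
    rw [linPotential, sub_eq_energyQuot hf]; ring
  have cw := continuousOn_momentumWeight hf hGpos
  have hwt : ∀ q, momentumWeight f q₀ q = 1 + q₀ * energyQuotDeriv f q₀ q / energyQuot f q₀ q :=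
    fun _ => rfl
  have hsl : slopeSq f q₀ q₀ = 2 * q₀ * energyQuot f q₀ q₀ := rfl
  change ∀ x, HasDerivAt (deriv φ₀) (2 * linPotential f q₀ φ₀ x * φ₀ x) x at d1
  generalize linPotential f q₀ φ₀ = V at *
  generalize momentumWeight f q₀ = kw at *
  rw [hsl]
  set G := energyQuot f q₀ with hGdef
  set G1 := energyQuotDeriv f q₀ with hG1def
  set a : ℝ → ℝ := fun x => G (φ₀ x ^ 2) with ha
  set b : ℝ → ℝ := fun x => G1 (φ₀ x ^ 2) with hb
  set r : ℝ → ℝ := fun x => √(2 * a x) with hr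
  have ha0 : ∀ x, 0 < a x := fun x => hGpos _ (hp.mem_Icc x)
  have hr0 : ∀ x, 0 < r x := fun x => Real.sqrt_pos.mpr (by have := ha0 x; positivity)
  have hrsq : ∀ x, r x ^ 2 = 2 * a x := fun x => Real.sq_sqrt (by have := ha0 x; positivity)
  have ca : Continuous a := by fun_prop
  have cb : Continuous b := by fun_prop
  have cr : Continuous r := by fun_prop
  have hder' : ∀ x, deriv φ₀ x = (q₀ - φ₀ x ^ 2) * r x := hder
  have dsq : ∀ x, HasDerivAt (fun x => φ₀ x ^ 2) (2 * φ₀ x * deriv φ₀ x) x := fun x => by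
    simpa using (d0 x).fun_pow 2
  have da : ∀ x, HasDerivAt a (b x * (2 * φ₀ x * deriv φ₀ x)) x := fun x =>
    HasDerivAt.comp x (h₂ := G) (h := fun x => φ₀ x ^ 2) (dG _) (dsq x)
  have dr : ∀ x, HasDerivAt r (b x * (2 * φ₀ x * deriv φ₀ x) / r x) x := fun x => by
    refine (((da x).const_mul 2).sqrt (by have := ha0 x; positivity)).congr_deriv ?_
    change _ / (2 * r x) = _
    have := (hr0 x).ne'
    field_simp
  -- the logarithmic integral
  set e : ℝ → ℝ := fun x => b x / a x * (q₀ - φ₀ x ^ 2) with he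
  have ce : Continuous e := (cb.div ca fun x => (ha0 x).ne').mul (by fun_prop)
  have ie : Integrable e := hp.integrable_comp_mul (g := fun q => G1 q / G q)
    (c1.continuousOn.div c0.continuousOn fun q hq => (hGpos q hq).ne')
  have hee : ∀ x, e (-x) = e x := fun x => by simp only [he, ha, hb, hk.1, neg_sq]
  set I : ℝ → ℝ := fun x => ∫ t in (0 : ℝ)..x, e t with hI
  have dI : ∀ x, HasDerivAt I (e x) x := fun x =>
    intervalIntegral.integral_hasDerivAt_right (ce.intervalIntegrable _ _)
      (ce.stronglyMeasurableAtFilter _ _) ce.continuousAt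
  have cI : Continuous I := continuous_iff_continuousAt.mpr fun x => (dI x).continuousAt
  have hIodd : ∀ x, I (-x) = -I x := by
    intro x
    have := intervalIntegral.integral_comp_neg (a := 0) (b := x) e
    simp only [hee, neg_zero] at this
    simp only [hI]
    rw [this, intervalIntegral.integral_symm]
  have hI0 : I 0 = 0 := intervalIntegral.integral_same
  set L := ∫ x, |e x| with hL
  have hL0 : 0 ≤ L := integral_nonneg fun x => abs_nonneg _
  have hIb : ∀ x, |I x| ≤ L := by
    intro x
    have h1 : |I x| ≤ ∫ t in uIoc 0 x, ‖e t‖ := by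
      rw [← Real.norm_eq_abs]
      exact intervalIntegral.norm_integral_le_integral_norm_uIoc
    exact h1.trans (setIntegral_le_integral ie.norm (Eventually.of_forall fun t => norm_nonneg _))
  obtain ⟨N, hN⟩ := (isCompact_Icc (a := (0 : ℝ)) (b := q₀)).exists_bound_of_continuousOn
    (f := fun q => (√(2 * G q))⁻¹) (ContinuousOn.inv₀ (by fun_prop) fun q hq =>
      (Real.sqrt_pos.mpr (by have := hGpos q hq; positivity)).ne')
  have hNr : ∀ x, |(r x)⁻¹| ≤ N := fun x => hN _ (hp.mem_Icc x)
  have hφb : ∀ x, |φ₀ x| ≤ √q₀ := fun x => Real.abs_le_sqrt (hp.lt x).le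
  -- Reduction of order: L₋φ₀ = 0 and L₋χ = φ₀' give (φ₀χ' - φ₀'χ)' = -2φ₀φ₀', and this χ has
  -- Wronskian φ₀χ' - φ₀'χ = q₀ - φ₀². The odd integral I makes χ even, and it is bounded because e
  -- is integrable.
  set χ : ℝ → ℝ := fun x => -(r x)⁻¹ - φ₀ x * I x with hχ
  have dχ : ∀ x, HasDerivAt χ (-(deriv φ₀ x * I x)) x := by
    intro x
    refine (((dr x).fun_inv (hr0 x).ne').fun_neg.fun_sub
      ((d0 x).fun_mul (dI x))).congr_deriv ?_
    have h1 := (hr0 x).ne'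
    have h2 := (ha0 x).ne'
    simp only [he]
    rw [hder']
    field_simp
    linear_combination (-(φ₀ x * b x * (q₀ - φ₀ x ^ 2))) * hrsq x
  have dχ' : ∀ x, HasDerivAt (fun x => -(deriv φ₀ x * I x))
      (-(2 * V x * φ₀ x * I x + deriv φ₀ x * e x)) x := fun x =>
    ((d1 x).fun_mul (dI x)).fun_neg
  have cχ : Continuous χ := continuous_iff_continuousAt.mpr fun x => (dχ x).continuousAt
  have hχb : ∀ x, |χ x| ≤ N + √q₀ * L := by
    intro x
    have h1 := abs_sub (-(r x)⁻¹) (φ₀ x * I x)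
    rw [abs_neg, abs_mul] at h1
    have h2 : |φ₀ x| * |I x| ≤ √q₀ * L :=
      mul_le_mul (hφb x) (hIb x) (abs_nonneg _) (Real.sqrt_nonneg _)
    linarith [hNr x]
  refine ⟨χ, _, _, N + √q₀ * L, D * (L + 1), dχ, dχ', fun x => ?_, hχb, fun x => ?_, fun x => ?_, ?_⟩
  · have h1 := (hr0 x).ne'
    have h2 := (ha0 x).ne'
    have h3 := hrsq x
    simp only [hχ, he]
    rw [hVeq, hder']
    change -(1 / 2) * -(2 * (-(2 * (q₀ - φ₀ x ^ 2) * a x) + (q₀ - φ₀ x ^ 2) ^ 2 * b x) *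
      φ₀ x * I x + (q₀ - φ₀ x ^ 2) * r x * (b x / a x * (q₀ - φ₀ x ^ 2))) +
      (-(2 * (q₀ - φ₀ x ^ 2) * a x) + (q₀ - φ₀ x ^ 2) ^ 2 * b x) * (-(r x)⁻¹ - φ₀ x * I x) = _
    have h4 : a x = r x ^ 2 / 2 := by rw [h3]; ring
    rw [h4]
    field_simp
    ring
  · rw [abs_neg, abs_mul, abs_of_pos (hpos x)]
    calc deriv φ₀ x * |I x| ≤ (D * ((1 + x ^ 2) ^ 2)⁻¹) * (L + 1) :=
          mul_le_mul (hDφ x) ((hIb x).trans (by linarith)) (abs_nonneg _) (by positivity)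
      _ = _ := by ring
  · rw [abs_of_pos (hpos x)]
    refine (hDφ x).trans ?_
    have : 0 ≤ D * ((1 + x ^ 2) ^ 2)⁻¹ * L := by positivity
    linarith
  · have iφ' : Integrable (deriv φ₀) := (integrable_inv_one_add_sq_sq.const_mul D).mono'
      cφ'.aestronglyMeasurable (Eventually.of_forall fun x => by
        rw [Real.norm_of_nonneg (hpos x).le]; exact hDφ x)
    have iχ : Integrable fun x => χ x * deriv φ₀ x :=
      iφ'.bdd_mul cχ.aestronglyMeasurable (Eventually.of_forall hχb)
    have ik : Integrable fun x => kw (φ₀ x ^ 2) * (q₀ - φ₀ x ^ 2) := hp.integrable_comp_mul cw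
    have hrlim : Tendsto r atTop (𝓝 √(2 * G q₀)) :=
      (((c0.tendsto q₀).comp hp.tendsto_density).const_mul 2).sqrt
    have hrl0 : 0 < √(2 * G q₀) :=
      Real.sqrt_pos.mpr (by have := hGpos q₀ ⟨hq₀.le, le_rfl⟩; positivity)
    -- An explicit primitive of χφ₀' plus half the weighted density. Its limit at infinity supplies
    -- q₀/c, and the integral of the weight supplies the rest.
    let Z : ℝ → ℝ := fun x => 1 / 2 * ((q₀ - φ₀ x ^ 2) * I x) - 1 / 2 * (φ₀ x / r x)
    have dZ : ∀ x, HasDerivAt Z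
        (χ x * deriv φ₀ x + 1 / 2 * (kw (φ₀ x ^ 2) * (q₀ - φ₀ x ^ 2))) x := by
      intro x
      refine (((((dsq x).const_sub q₀).fun_mul (dI x)).const_mul (1 / 2)).fun_sub
        (((d0 x).fun_div (dr x) (hr0 x).ne').const_mul (1 / 2))).congr_deriv ?_
      have h1 := (hr0 x).ne'
      have h4 : a x = r x ^ 2 / 2 := by rw [hrsq]; ring
      have h5 : kw (φ₀ x ^ 2) = 1 + q₀ * b x / a x := hwt _
      simp only [hχ, he]
      rw [h5, hder', h4]
      field_simp
      ring
    have hZlim : Tendsto Z atTop (𝓝 (1 / 2 * 0 - 1 / 2 * (√q₀ / √(2 * G q₀)))) := by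
      have l1 : Tendsto (fun x => (q₀ - φ₀ x ^ 2) * I x) atTop (𝓝 0) := by
        have l2 : Tendsto (fun x => (q₀ - φ₀ x ^ 2) * L) atTop (𝓝 0) := by
          have := (hp.tendsto_density.const_sub q₀).mul_const L
          simpa using this
        refine squeeze_zero_norm (fun x => ?_) l2
        rw [norm_mul, Real.norm_of_nonneg (sub_pos.mpr (hp.lt x)).le]
        exact mul_le_mul_of_nonneg_left (hIb x) (sub_pos.mpr (hp.lt x)).le
      exact (l1.const_mul _).sub ((hk.tendsto.div hrlim hrl0.ne').const_mul _)
    have hint := integral_Ioi_of_hasDerivAt_of_tendsto' (a := 0) (fun x _ => dZ x)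
      (iχ.add (ik.const_mul _)).integrableOn hZlim
    rw [integral_add iχ.integrableOn (ik.const_mul _).integrableOn, integral_const_mul] at hint
    have hZ0 : Z 0 = 0 := by simp [Z, hI0, hk.2.1]
    rw [hZ0] at hint
    have heven : ∫ x, χ x * deriv φ₀ x = 2 * ∫ x in Ioi (0 : ℝ), χ x * deriv φ₀ x := by
      rw [← integral_comp_abs (f := fun x => χ x * deriv φ₀ x)]
      refine integral_congr_ae (Eventually.of_forall fun x => ?_)
      have hr' : r (-x) = r x := by simp only [hr, ha, hk.1, neg_sq]
      rcases abs_choice x with h' | h'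
      · simp only [h']
      · simp only [h', hχ, hder', hr', hk.1, hIodd, neg_sq]
        ring
    rw [heven]
    have hc : q₀ / √(2 * q₀ * G q₀) = √q₀ / √(2 * G q₀) := by
      rw [show 2 * q₀ * G q₀ = q₀ * (2 * G q₀) by ring, Real.sqrt_mul hq₀.le]
      have := Real.sqrt_pos.mpr hq₀
      field_simp
      exact (Real.sq_sqrt hq₀.le).symm
    rw [hc]
    linarith

end Kink

/-! ### Translation of the almost-everywhere statements into the abstract Hilbert space setting. -/

open scoped InnerProductSpace

variable {f : ℝ → ℝ} {q₀ : ℝ} {φ₀ : ℝ → ℝ}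

theorem ae_eq_smul_iff {φ u : L2} (hφ : φ =ᵐ[volume] fun x => ((deriv φ₀ x : ℝ) : ℂ)) (ν : ℂ) :
    (∀ᵐ x ∂(volume : Measure ℝ), u x = ν * ((deriv φ₀ x : ℝ) : ℂ)) ↔ u = ν • φ := by
  have h : ((ν • φ : L2) : ℝ → ℂ) =ᵐ[volume] fun x => ν * ((deriv φ₀ x : ℝ) : ℂ) := by
    filter_upwards [Lp.coeFn_smul ν φ, hφ] with x h1 h2
    rw [h1, Pi.smul_apply, h2, smul_eq_mul]
  refine ⟨fun hu => Lp.ext ?_, fun hu => hu ▸ h⟩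
  filter_upwards [hu, h] with x h1 h2 using h1.trans h2.symm

theorem inner_eq_integral_deriv {φ : L2} (hφ : φ =ᵐ[volume] fun x => ((deriv φ₀ x : ℝ) : ℂ))
    (w : L2) : ⟪φ, w⟫_ℂ = ∫ x, ((deriv φ₀ x : ℝ) : ℂ) * w x := by
  rw [L2.inner_def]
  refine integral_congr_ae ?_
  filter_upwards [hφ] with x hx
  rw [hx, RCLike.inner_apply, Complex.conj_ofReal, mul_comm]

theorem isConstrainedEigenvector_iff {φ : L2}
    (hφ : φ =ᵐ[volume] fun x => ((deriv φ₀ x : ℝ) : ℂ))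
    (hdom : (Lminus f q₀ φ₀).domain = H2) {μ : ℝ} {w : L2} :
    IsConstrainedEigenvector f q₀ φ₀ μ w ↔ ∃ hw : w ∈ (Lminus f q₀ φ₀).domain,
      IsCompressedEigenvector (Lminus f q₀ φ₀) φ μ ⟨w, hw⟩ := by
  have hint : ⟪φ, w⟫_ℂ = ∫ x, w x * ((deriv φ₀ x : ℝ) : ℂ) := by
    rw [inner_eq_integral_deriv hφ]
    simp only [mul_comm]
  constructor
  · rintro ⟨h0, ⟨-, h1⟩, hw, ν, h2⟩
    exact ⟨hw, h0, hint.trans h1, ν, (ae_eq_smul_iff hφ _).mp h2⟩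
  · rintro ⟨hw, h0, h1, ν, h2⟩
    exact ⟨h0, ⟨hdom ▸ hw, hint.symm.trans h1⟩, hw, ν, (ae_eq_smul_iff hφ _).mpr h2⟩

theorem isResolventSolution_iff {φ : L2} (hφ : φ =ᵐ[volume] fun x => ((deriv φ₀ x : ℝ) : ℂ))
    {μ : ℝ} {w : L2} : IsResolventSolution f q₀ φ₀ μ w ↔ ∃ hw : w ∈ (Lminus f q₀ φ₀).domain,
      Lminus f q₀ φ₀ ⟨w, hw⟩ + ((-μ : ℝ) : ℂ) • w = φ := by
  refine exists_congr fun hw => ?_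
  have h := ae_eq_smul_iff (u := Lminus f q₀ φ₀ ⟨w, hw⟩ - (μ : ℂ) • w) hφ 1
  simp only [one_mul, one_smul] at h
  rw [h, Complex.ofReal_neg, neg_smul, sub_eq_add_neg]

/-! ### Spectral conclusions for a kink. -/

section Kink

variable {U : ℝ → ℝ → ℂ}

theorem IsKink.exists_deriv_L2 (hq₀ : 0 < q₀) (hf : ContDiff ℝ 2 f) (hf' : 0 < deriv f q₀)
    (h : IsBlackSoliton f q₀ U φ₀) (hk : IsKink q₀ φ₀) :
    ∃ φ : L2, φ ≠ 0 ∧ φ =ᵐ[volume] fun x => ((deriv φ₀ x : ℝ) : ℂ) := by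
  obtain ⟨D, hD0, hD, -⟩ := hk.exists_decay hq₀ hf hf' h
  have hpos := hk.deriv_pos hq₀ hf hf' h
  have cφ' : Continuous (deriv φ₀) :=
    continuous_iff_continuousAt.mpr fun x => (h.ode hq₀ hf x).continuousAt
  have hm := memLp_two_of_bound (b := fun x => D ^ 2 * ((1 + x ^ 2) ^ 2)⁻¹) cφ'
    (integrable_inv_one_add_sq_sq.const_mul _) fun x => by
      have h1 : ((1 + x ^ 2) ^ 2)⁻¹ ≤ 1 := inv_le_one_of_one_le₀ (by nlinarith [sq_nonneg x])
      calc deriv φ₀ x ^ 2 ≤ (D * ((1 + x ^ 2) ^ 2)⁻¹) ^ 2 :=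
            pow_le_pow_left₀ (hpos x).le (hD x) 2
        _ = D ^ 2 * ((1 + x ^ 2) ^ 2)⁻¹ * ((1 + x ^ 2) ^ 2)⁻¹ := by ring
        _ ≤ D ^ 2 * ((1 + x ^ 2) ^ 2)⁻¹ * 1 := by gcongr
        _ = _ := mul_one _
  refine ⟨hm.toLp, fun h0 => ?_, hm.coeFn_toLp⟩
  have h1 := hm.coeFn_toLp
  rw [h0] at h1
  obtain ⟨x, hx, hx'⟩ := (h1.and (Lp.coeFn_zero ℂ 2 (volume : Measure ℝ))).exists
  rw [hx] at hx'
  exact (hpos x).ne' (by simpa using hx')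

/-- The resolvent at μ is the shift by T = -μ, and ⟨φ₀', (L₋ + T)⁻¹φ₀'⟩ tends to ∫χφ₀' = -p/2. Once
p ≠ 0 its sign is settled for all small T, and the two abstract alternatives apply. -/
theorem IsKink.spectral (hq₀ : 0 < q₀) (hf : ContDiff ℝ 2 f) (hf' : 0 < deriv f q₀)
    (h : IsBlackSoliton f q₀ U φ₀) (hk : IsKink q₀ φ₀) {p : ℝ}
    (hp : p = 2 * q₀ / √(slopeSq f q₀ q₀) +
      2 * ∫ x in Ioi (0 : ℝ), momentumWeight f q₀ (φ₀ x ^ 2) * (q₀ - φ₀ x ^ 2)) :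
    (∃ w : ℝ → L2,
      (∀ᶠ μ in 𝓝[<] (0 : ℝ), ∀ w' : L2, IsResolventSolution f q₀ φ₀ μ w' ↔ w' = w μ) ∧
      Tendsto (fun μ => -∫ x, ((deriv φ₀ x : ℝ) : ℂ) * w μ x) (𝓝[<] (0 : ℝ))
        (𝓝 ((p / 2 : ℝ) : ℂ))) ∧
    (p < 0 → ∃ μ : ℝ, μ < 0 ∧ ∃ w : L2, IsConstrainedEigenvector f q₀ φ₀ μ w ∧
      ∀ μ' : ℝ, μ' < 0 → ∀ w' : L2, IsConstrainedEigenvector f q₀ φ₀ μ' w' →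
        μ' = μ ∧ ∃ a : ℂ, w' = a • w) ∧
    (0 < p → ∀ μ : ℝ, μ < 0 → ∀ w : L2, ¬ IsConstrainedEigenvector f q₀ φ₀ μ w) := by
  obtain ⟨C, hC⟩ := exists_bound_linPotential hf (h.sq_le hq₀ hf)
  have hV := continuous_linPotential (q₀ := q₀) hf h.2.1.continuous
  obtain ⟨φ, hφ0, hφ⟩ := hk.exists_deriv_L2 hq₀ hf hf' h
  obtain ⟨ε, hε⟩ := hk.form_nonneg hq₀ hf hf' h
  obtain ⟨ψ, hψ⟩ := hk.exists_negative hq₀ hf hf' h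
  obtain ⟨χ, χ', χ'', B, D, d1, d2, hχ, hB, hD, hkD, hint⟩ :=
    hk.exists_generalized_resolvent hq₀ hf hf' h
  have hA := schrodinger_isSymm (linPotential f q₀ φ₀)
  have hs := schrodinger_adjointLE hV hC
  have hM := schrodinger_bddBelow hV hC
  have hdom : (Lminus f q₀ φ₀).domain = H2 := schrodinger_domain hV hC
  have heig := fun (μ : ℝ) (w : L2) =>
    isConstrainedEigenvector_iff (f := f) (q₀ := q₀) hφ hdom (μ := μ) (w := w)
  have hres := fun (μ : ℝ) (w : L2) =>
    isResolventSolution_iff (f := f) (q₀ := q₀) hφ (μ := μ) (w := w)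
  have hLA : Lminus f q₀ φ₀ = schrodinger (linPotential f q₀ φ₀) := rfl
  rw [hLA] at heig hres
  have cφ' : Continuous (deriv φ₀) :=
    continuous_iff_continuousAt.mpr fun x => (h.ode hq₀ hf x).continuousAt
  have cχ : Continuous χ := continuous_iff_continuousAt.mpr fun x => (d1 x).continuousAt
  obtain ⟨X, M, -, hX⟩ := exists_cutoff_family hV hC d1 d2 hχ cφ' hB hD hkD
  generalize schrodinger (linPotential f q₀ φ₀) = A at *
  obtain ⟨T₀, hT₀, hshift⟩ : ∃ T₀ > 0, ∀ T, 0 < T → T < T₀ → (shiftForm A T ψ ψ).re < 0 := by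
    have hcont : ∀ T : ℝ, (shiftForm A T ψ ψ).re =
        (⟪(ψ : L2), A ψ⟫_ℂ).re + T * ‖(ψ : L2)‖ ^ 2 := fun T => by
      rw [shiftForm, inner_add_right, inner_smul_right, inner_self_eq_norm_sq_to_K, Complex.add_re,
        Complex.re_ofReal_mul]
      norm_cast
    have hlim : Tendsto (fun T : ℝ => (⟪(ψ : L2), A ψ⟫_ℂ).re + T * ‖(ψ : L2)‖ ^ 2) (𝓝 0)
        (𝓝 ((⟪(ψ : L2), A ψ⟫_ℂ).re + 0 * ‖(ψ : L2)‖ ^ 2)) :=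
      (Continuous.tendsto (by fun_prop) 0)
    obtain ⟨T₀, hT₀, hb⟩ := Metric.eventually_nhds_iff.mp
      (hlim.eventually (Iio_mem_nhds (by simpa using hψ)))
    refine ⟨T₀, hT₀, fun T h1 h2 => ?_⟩
    rw [hcont]
    exact hb (by simpa [abs_of_pos h1] using h2)
  have hex : ∀ T : ℝ, ∃ u : A.domain, 0 < T → T < T₀ → A u + (T : ℂ) • (u : L2) = φ := fun T => by
    by_cases hT : 0 < T ∧ T < T₀
    · obtain ⟨u, hu⟩ := shift_surjective hA hs hε hT.1 (hshift T hT.1 hT.2) φ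
      exact ⟨u, fun _ _ => hu⟩
    · exact ⟨0, fun h1 h2 => absurd ⟨h1, h2⟩ hT⟩
  choose R hR using hex
  have hsmall : ∀ᶠ T in 𝓝[>] (0 : ℝ), T ∈ Ioo 0 T₀ := Ioo_mem_nhdsGT hT₀
  have hR' : ∀ᶠ T in 𝓝[>] (0 : ℝ), A (R T) + (T : ℂ) • (R T : L2) = φ := by
    filter_upwards [hsmall] with T hT
    exact hR T hT.1 hT.2
  have hXlim : Tendsto (fun T => ⟪φ, (X T : L2)⟫_ℂ) (𝓝[>] (0 : ℝ)) (𝓝 ((-(p / 2) : ℝ) : ℂ)) := by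
    have h1 := tendsto_cutoff_pairing cχ cφ' hB hkD
    rw [hint, show -(q₀ / √(slopeSq f q₀ q₀) + ∫ x in Ioi (0 : ℝ),
      momentumWeight f q₀ (φ₀ x ^ 2) * (q₀ - φ₀ x ^ 2)) = -(p / 2) by rw [hp]; ring] at h1
    refine ((Complex.continuous_ofReal.tendsto _).comp h1).congr' ?_
    filter_upwards [Ioc_mem_nhdsGT one_pos] with T hT
    rw [inner_ofReal_L2 hφ (hX T hT).1, Function.comp_apply]
    simp only [mul_comm]
  have hlim := resolvent_tendsto hA hε hψ (C := M) (w := R) (by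
    filter_upwards [Ioc_mem_nhdsGT one_pos] with T hT using (hX T hT).2.2 φ hφ) hXlim hR'
  have hre : Tendsto (fun T => (⟪φ, (R T : L2)⟫_ℂ).re) (𝓝[>] (0 : ℝ)) (𝓝 (-(p / 2))) :=
    (Complex.continuous_re.tendsto _).comp hlim
  refine ⟨⟨fun μ => R (-μ), ?_, ?_⟩, fun hp0 => ?_, fun hp0 μ hμ w hw => ?_⟩
  · filter_upwards [Ioo_mem_nhdsLT (neg_lt_zero.mpr hT₀)] with μ hμ w'
    have h1 : 0 < -μ := neg_pos.mpr hμ.2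
    have h2 : -μ < T₀ := neg_lt.mp hμ.1
    rw [hres]
    constructor
    · rintro ⟨hw, he⟩
      exact congrArg Subtype.val
        (shift_injective hA hε h1 (hshift _ h1 h2) (u := ⟨w', hw⟩) (he.trans (hR _ h1 h2).symm))
    · rintro rfl
      exact ⟨(R (-μ)).2, hR _ h1 h2⟩
  · have hneg : Tendsto (fun μ : ℝ => -μ) (𝓝[<] 0) (𝓝[>] 0) := by
      simpa using tendsto_neg_nhdsLT (a := (0 : ℝ))
    have h1 := (hlim.comp hneg).neg
    rw [← Complex.ofReal_neg, neg_neg] at h1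
    exact h1.congr fun μ => by rw [Function.comp_apply, inner_eq_integral_deriv hφ]
  · obtain ⟨T, ⟨hT, hT'⟩, hTpos⟩ := (hsmall.and (hre.eventually (Ioi_mem_nhds (by linarith : 0 < -(p / 2))))).exists
    obtain ⟨e, he, hneg⟩ := exists_negative_orthogonal hA hT.le (hR T hT hT') hTpos
      (hshift T hT hT')
    obtain ⟨μ, hμ, w, hw⟩ := exists_isCompressedEigenvector hA hs hM hε hφ0 he hneg
    refine ⟨μ, hμ, w, (heig _ _).mpr ⟨w.2, hw⟩, fun μ' hμ' w' hw' => ?_⟩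
    obtain ⟨hw'd, hw'⟩ := (heig _ _).mp hw'
    exact hw.unique hA hε hw' hμ hμ'
  -- The shift must also satisfy T < -μ, so that the supposed eigenvector remains negative for the
  -- shifted form.
  · have hsmall' : ∀ᶠ T in 𝓝[>] (0 : ℝ), T ∈ Ioo 0 (-μ) := Ioo_mem_nhdsGT (neg_pos.mpr hμ)
    obtain ⟨T, ⟨⟨hT, hT'⟩, hT''⟩, hTneg⟩ := ((hsmall.and hsmall').and
        (hre.eventually (Iio_mem_nhds (by linarith : -(p / 2) < 0)))).exists
    obtain ⟨hwd, hw⟩ := (heig _ _).mp hw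
    exact not_isCompressedEigenvector hA hε hT.le (hR T hT hT') hTneg (by linarith [hT''.2]) hw

end Kink

/-! ### Independence of the values of f on the negative half-line. -/

section Congruence

variable {f g : ℝ → ℝ} {q₀ : ℝ}

/-- Only q₀ and squared moduli are ever inserted into f, so f may be replaced by a C² extension of
its restriction to [0, ∞). -/
theorem IsBlackSoliton.congr {U : ℝ → ℝ → ℂ} {φ₀ : ℝ → ℝ} (h : IsBlackSoliton f q₀ U φ₀)
    (hq₀ : 0 ≤ q₀) (hg : ∀ x, 0 ≤ x → g x = f x) : IsBlackSoliton g q₀ U φ₀ := by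
  refine ⟨h.1.mono fun v hv => ⟨fun z => ?_, hv.2⟩, h.2⟩
  rw [hg _ hq₀, hg _ (sq_nonneg _)]
  exact hv.1 z

theorem Lminus_congr (φ₀ : ℝ → ℝ) (hq₀ : 0 ≤ q₀) (hg : ∀ x, 0 ≤ x → g x = f x) :
    Lminus g q₀ φ₀ = Lminus f q₀ φ₀ := by
  unfold Lminus
  congr 1
  funext x
  rw [hg _ hq₀, hg _ (sq_nonneg _)]

end Congruence

end BlackSoliton

theorem mainTheorem11 (f : ℝ → ℝ) (q₀ : ℝ) (hq₀ : 0 < q₀)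
    (hf : ContDiffOn ℝ 2 f (Ici 0)) (hf' : 0 < deriv f q₀)
    (U : ℝ → ℝ → ℂ) (φ₀ : ℝ → ℝ) (hφ₀ : BlackSoliton.IsBlackSoliton f q₀ U φ₀) :
    (BlackSoliton.IsKink q₀ φ₀ →
      ∃ p : ℝ,
        -- `p` is the one-sided limit of the derivative of the momentum
        (∀ᶠ v in 𝓝[>] (0 : ℝ),
          DifferentiableAt ℝ (fun s => BlackSoliton.momentum q₀ (U s)) v) ∧
        Tendsto (deriv fun s => BlackSoliton.momentum q₀ (U s)) (𝓝[>] (0 : ℝ)) (𝓝 p) ∧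
        -- the limit of `g(μ) = -(φ₀', (L₋ - μ)⁻¹ φ₀')` as `μ ↑ 0` is `p / 2`
        (∃ w : ℝ → BlackSoliton.L2,
          (∀ᶠ μ in 𝓝[<] (0 : ℝ), ∀ w' : BlackSoliton.L2,
            BlackSoliton.IsResolventSolution f q₀ φ₀ μ w' ↔ w' = w μ) ∧
          Tendsto (fun μ => -∫ x, ((deriv φ₀ x : ℝ) : ℂ) * w μ x) (𝓝[<] (0 : ℝ))
            (𝓝 ((p / 2 : ℝ) : ℂ))) ∧
        -- exactly one negative eigenvalue, counted with multiplicity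
        (p < 0 → ∃ μ : ℝ, μ < 0 ∧ ∃ w : BlackSoliton.L2,
          BlackSoliton.IsConstrainedEigenvector f q₀ φ₀ μ w ∧
          ∀ μ' : ℝ, μ' < 0 → ∀ w' : BlackSoliton.L2,
            BlackSoliton.IsConstrainedEigenvector f q₀ φ₀ μ' w' →
              μ' = μ ∧ ∃ a : ℂ, w' = a • w) ∧
        (0 < p → ∀ μ : ℝ, μ < 0 → ∀ w : BlackSoliton.L2,
          ¬ BlackSoliton.IsConstrainedEigenvector f q₀ φ₀ μ w)) ∧
    (BlackSoliton.IsBubble q₀ φ₀ →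
      ∀ w : (BlackSoliton.Lminus f q₀ φ₀).domain, (w : BlackSoliton.L2) ∈ BlackSoliton.Xc φ₀ →
        0 ≤ (inner ℂ (w : BlackSoliton.L2) (BlackSoliton.Lminus f q₀ φ₀ w)).re) := by
  -- The analysis uses a nonlinearity that is C² on the whole line. Since q₀ is interior to [0, ∞),
  -- the extension keeps the derivative there.
  obtain ⟨g, hg, hgf⟩ := BlackSoliton.exists_contDiff_two_extension hf
  have h := hφ₀.congr hq₀.le hgf
  have hL := BlackSoliton.Lminus_congr φ₀ hq₀.le hgf
  have hg' : 0 < deriv g q₀ := by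
    have : g =ᶠ[𝓝 q₀] f := by
      filter_upwards [Ioi_mem_nhds hq₀] with x hx using hgf x (le_of_lt hx)
    rwa [this.deriv_eq]
  refine ⟨fun hk => ?_, fun hb w _ => ?_⟩
  · obtain ⟨hdiff, hlim⟩ := hk.momentum_deriv hq₀ hg hg' h
    have hs := hk.spectral hq₀ hg hg' h rfl
    unfold BlackSoliton.IsResolventSolution BlackSoliton.IsConstrainedEigenvector at hs ⊢
    rw [hL] at hs
    exact ⟨_, hdiff, hlim, hs⟩
  · revert w
    rw [← hL]
    exact fun w _ => hb.form_nonneg hq₀ hg h w
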